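/- **Setting.** Let $d,H\in\mathbb N$, let $\mathcal X=\mathbb R^{d}$ (write $d_{\mathcal X}=d$), let $\mathcal U$ be a measurable space of controls, $\mathcal H$ a separable real Hilbert space, $\phi:\mathcal X\times\mathcal U\to\mathcal H$ a known measurable feature map, $W^\star:\mathcal H\to\mathcal X$ an unknown nonzero bounded linear map with operator norm $\|W^\star\|_2$, $\sigma>0$, $x_0\in\mathcal X$, and $\Pi$ a set of measurable policies $\pi:\mathcal X\times\{0,\dots,H-1\}\to\mathcal U$. For a bounded linear map $W$, a policy $\pi$ and a measurable cost $c:\mathcal X\times\mathcal U\to[0,\infty)$ let $J^\pi(x_0;c,W)=\mathbb E\big[\sum_{h=0}^{H-1}c(x_h,u_h)\big]$, where $u_h=\pi(x_h,h)$ and $x_{h+1}=W\phi(x_h,u_h)+\epsilon_h$ with $\epsilon_h\sim\mathcal N(0,\sigma^2I)$ independent; put $J^\pi(x_0;c)=J^\pi(x_0;c,W^\star)$ and $J^\star(x_0;c)=\inf_{\pi\in\Pi}J^\pi(x_0;c)$. An algorithm maps (measurably) the history before episode $t$ to the policy $\pi^t\in\Pi$ that is executed in episode $t$, under $W^\star$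 and from $x_0$; it produces $x^t_0,u^t_0,\dots,u^t_{H-1},x^t_H$. With $\phi^t_h=\phi(x^t_h,u^t_h)$, let $$\Sigma^t=\lambda I+\sum_{\tau<t}\sum_{h<H}\phi^\tau_h(\phi^\tau_h)^\top,$$ where $\det(\Sigma^t)/\det(\Sigma^0)$ means $\det\big(I+\tfrac1\lambda\sum_{\tau<t}\sum_{h<H}\phi^\tau_h(\phi^\tau_h)^\top\big)$, and let $$\gamma_T(\lambda)=\sup_{\mathcal A}\mathbb E_{\mathcal A}\Big[\log\tfrac{\det\Sigma^T}{\det\Sigma^0}\Big],\qquad \gamma_{2,T}(\lambda)=\sup_{\mathcal A}\mathbb E_{\mathcal A}\Big[\Big(\log\tfrac{\det\Sigma^{T-1}}{\det\Sigma^0}\Big)^2\Big],$$ $$\widetilde d_T^{\,2}=\gamma_T(\lambda)\big(\gamma_T(\lambda)+d_{\mathcal X}+\log T+H\big),$$ with suprema over all algorithms $\mathcal A$. **LC³** with parameters $\lambda,C_1$ and an arbitrary initial set $\mathrm{Ball}^0\ni W^\star$ is an algorithm that, given a sequence of measurable costs $c^t:\mathcal X\times\mathcal U\to[0,\infty)$,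 plays in each episode $t$ a policy $\pi^t\in\arg\min_{\pi\in\Pi}\inf_{W\in\mathrm{Ball}^t}J^\pi(x_0;c^t,W)$, where for $t\ge1$ $$\mathrm{Ball}^t=\big\{W:\|(W-\overline W^t)(\Sigma^t)^{1/2}\|_2^2\le\beta^t\big\},\qquad \beta^t=C_1\Big(\lambda\|W^\star\|_2^2+\sigma^2\big(d_{\mathcal X}+\log(t\det\Sigma^t/\det\Sigma^0)\big)\Big),$$ and $\overline W^t$ minimizes $\sum_{\tau<t}\sum_{h<H}\|W\phi^\tau_h-x^\tau_{h+1}\|_2^2+\lambda\|W\|_F^2$. Its regret is $$\mathrm{Regret}_T=\sum_{t<T}\sum_{h<H}c^t(x^t_h,u^t_h)-\sum_{t<T}J^\star(x_0;c^t).$$ **Theorem.** There exist absolute constants $C_1,C_2>0$ such that the following holds in every setting as above. Assume that $V_{\max},\alpha,J^\star\ge0$ are such that for all $t$ and all $\pi\in\Pi$, with the expectation taken under $\pi$ and $W^\star$ from $x_0$, $$\mathbb E\Big[\Big(\sum_{h<H}c^t(x_h,u_h)\Big)^2\Big]\le V_{\max},\qquad \mathbb E\Big[\Big(\sum_{h<H}c^t(x_h,u_h)\Big)^2\Big]\le\big(\alpha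 J^\pi(x_0;c^t)\big)^2,\qquad J^\star(x_0;c^t)\le J^\star .$$ Let LC³ be run with parameters $\lambda=\sigma^2/\|W^\star\|_2^2$ and $C_1$. Then for all $T\ge 1$ the regret is integrable and $$\mathbb E[\mathrm{Regret}_T]\le C_2\Big(\alpha J^\star\,\widetilde d_T\sqrt{HT}+\alpha H\sqrt{V_{\max}}\,\big(\widetilde d_T^{\,2}+\gamma_{2,T}(\lambda)\big)+\sqrt{V_{\max}}\Big);$$ moreover, for every $T\ge1$ with $\widetilde d_T\ge1$, $$\mathbb E[\mathrm{Regret}_T]\le C_2\Big(\alpha J^\star\,\widetilde d_T\sqrt{HT}+\alpha H\sqrt{V_{\max}}\,\big(\widetilde d_T^{\,2}+\gamma_{2,T}(\lambda)\big)\Big).$$ -/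

import Mathlib

open MeasureTheory ProbabilityTheory
open scoped ENNReal NNReal

noncomputable section

/-- The state space `ℝ^d` with the Euclidean norm. -/
abbrev State (d : ℕ) : Type := EuclideanSpace ℝ (Fin d)

/-- A controller `π : 𝒳 × {0, …, H-1} → 𝒰`. -/
abbrev Policy (d H : ℕ) (U : Type*) : Type _ := State d → Fin H → U

/-- The sequence of states `x_0, …, x_H` of one episode. -/
abbrev Traj (d H : ℕ) : Type := Fin (H + 1) → State d

/-- The states observed in episodes `0, …, t-1`. (The controls and costs observed in those
episodes are functions of the states, as controllers are deterministic.) -/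
abbrev History (d H t : ℕ) : Type := Fin t → Traj d H

/-- A learning algorithm: a map from the history before episode `t` to the controller that is
executed in episode `t`. -/
abbrev Algorithm (d H : ℕ) (U : Type*) : Type _ := (t : ℕ) → History d H t → Policy d H U

/-- A kernelized nonlinear regulator: `x_{h+1} = W⋆ φ(x_h, u_h) + ε_h`, `ε_h ∼ 𝒩(0, σ² I)`,
with horizon `H`, starting state `x₀`, and features in a real Hilbert space `E`. -/
structure KNR (d H : ℕ) (U E : Type*) [MeasurableSpace U] [NormedAddCommGroup E]
    [InnerProductSpace ℝ E] [MeasurableSpace E] where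
  /-- the feature map -/
  φ : State d × U → E
  measurable_φ : Measurable φ
  /-- the unknown linear map; `‖Wstar‖` is its spectral norm -/
  Wstar : E →L[ℝ] State d
  /-- the noise level -/
  σ : ℝ
  σ_pos : 0 < σ
  /-- the starting state -/
  x₀ : State d

/-- The law `𝒩(0, σ² I)` on `ℝ^d`: the law of `σ Z` with `Z` standard Gaussian. -/
def gaussianNoise (d : ℕ) (σ : ℝ) : Measure (State d) :=
  (stdGaussian (State d)).map (fun z => σ • z)

instance isProbabilityMeasure_gaussianNoise (d : ℕ) (σ : ℝ) :
    IsProbabilityMeasure (gaussianNoise d σ) :=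
  Measure.isProbabilityMeasure_map (measurable_const_smul σ).aemeasurable

/-- The law of the independent noise variables `ε_0, …, ε_{H-1}` of one episode. -/
def episodeNoise (d H : ℕ) (σ : ℝ) : Measure (Fin H → State d) :=
  Measure.pi (fun _ => gaussianNoise d σ)

instance isProbabilityMeasure_episodeNoise (d H : ℕ) (σ : ℝ) :
    IsProbabilityMeasure (episodeNoise d H σ) := by
  unfold episodeNoise; infer_instance

/-- The law of the noise of all episodes `t = 0, 1, 2, …`, which are independent. -/
def fullNoise (d H : ℕ) (σ : ℝ) : Measure (ℕ → Fin H → State d) :=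
  Measure.infinitePi (fun _ => episodeNoise d H σ)

/-- The ratio `det (λ I + ∑ᵢ fᵢ fᵢᵀ) / det (λ I)`, that is `det (I + λ⁻¹ ∑ᵢ fᵢ fᵢᵀ)`, for finitely
many vectors `fᵢ` of a possibly infinite-dimensional Hilbert space. It is written as
`det (I + λ⁻¹ K)`, with `K` the Gram matrix of the `fᵢ`; `detRatio_eq` below shows that in a
finite-dimensional space (in particular in the span of the `fᵢ`, outside of which the operator
`I + λ⁻¹ ∑ᵢ fᵢ fᵢᵀ` is the identity) this is the ratio of the two determinants. -/
def detRatio {E ι : Type*} [NormedAddCommGroup E] [InnerProductSpace ℝ E] [Fintype ι]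
    [DecidableEq ι] (lam : ℝ) (f : ι → E) : ℝ :=
  (1 + lam⁻¹ • Matrix.gram ℝ f).det

/-- The regularized feature covariance `λ I + ∑ᵢ fᵢ fᵢᵀ`. -/
def featureCov {E ι : Type*} [NormedAddCommGroup E] [InnerProductSpace ℝ E] [Fintype ι]
    (lam : ℝ) (f : ι → E) : E →L[ℝ] E :=
  lam • ContinuousLinearMap.id ℝ E + ∑ i, InnerProductSpace.rankOne ℝ (f i) (f i)

theorem detRatio_eq {E ι : Type*} [NormedAddCommGroup E] [InnerProductSpace ℝ E] [Fintype ι]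
    [DecidableEq ι] [FiniteDimensional ℝ E] {lam : ℝ} (hlam : lam ≠ 0) (f : ι → E) :
    detRatio lam f = LinearMap.det (featureCov lam f : E →ₗ[ℝ] E) /
      LinearMap.det (lam • LinearMap.id : E →ₗ[ℝ] E) := by
  have hrat : LinearMap.det (featureCov lam f : E →ₗ[ℝ] E) /
      LinearMap.det (lam • LinearMap.id : E →ₗ[ℝ] E) =
      LinearMap.det (lam⁻¹ • (featureCov lam f : E →ₗ[ℝ] E)) := by
    rw [LinearMap.det_smul, LinearMap.det_smul, LinearMap.det_id, mul_one, inv_pow, div_eq_inv_mul]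
  rw [hrat]
  let b := stdOrthonormalBasis ℝ E
  let B : Matrix (Fin (Module.finrank ℝ E)) ι ℝ := Matrix.of fun k i => inner ℝ (b k) (f i)
  have hG : Matrix.gram ℝ f = B.transpose * B := by
    ext i j
    simp only [Matrix.gram_apply, Matrix.mul_apply, Matrix.transpose_apply, B, Matrix.of_apply]
    rw [← b.sum_inner_mul_inner (f i) (f j)]
    exact Finset.sum_congr rfl fun k _ => by rw [real_inner_comm]
  have hM : LinearMap.toMatrix b.toBasis b.toBasis (lam⁻¹ • (featureCov lam f : E →ₗ[ℝ] E)) =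
      1 + B * (lam⁻¹ • B.transpose) := by
    ext k l
    rw [LinearMap.toMatrix_apply]
    simp only [OrthonormalBasis.coe_toBasis_repr_apply, OrthonormalBasis.coe_toBasis,
      OrthonormalBasis.repr_apply_apply, featureCov, LinearMap.smul_apply,
      ContinuousLinearMap.coe_coe, add_apply, smul_apply,
      ContinuousLinearMap.id_apply, sum_apply,
      InnerProductSpace.rankOne_apply, inner_smul_right, inner_add_right, inner_sum,
      Matrix.add_apply, Matrix.mul_apply, Matrix.smul_apply, Matrix.transpose_apply, B,
      Matrix.of_apply, smul_eq_mul, Matrix.one_apply, b.inner_eq_ite, mul_add, Finset.mul_sum]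
    rw [← mul_assoc, inv_mul_cancel₀ hlam, one_mul]
    congr 1
    refine Finset.sum_congr rfl fun i _ => ?_
    rw [real_inner_comm (b l) (f i)]
    ring
  rw [← LinearMap.det_toMatrix b.toBasis, hM, Matrix.det_one_add_mul_comm, detRatio, hG,
    Matrix.smul_mul]

theorem norm_comp_sqrt_sq {d : ℕ} {E : Type*} [NormedAddCommGroup E] [InnerProductSpace ℝ E]
    [CompleteSpace E] (D : E →L[ℝ] State d) (S R : E →L[ℝ] E)
    (hR : IsSelfAdjoint R) (hS : R ∘L R = S) :
    ‖D ∘L R‖ ^ 2 = ‖D ∘L S ∘L ContinuousLinearMap.adjoint D‖ := by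
  have hR' : ContinuousLinearMap.adjoint R = R := hR
  have h := ContinuousLinearMap.norm_adjoint_comp_self (ContinuousLinearMap.adjoint (D ∘L R))
  rw [ContinuousLinearMap.adjoint_adjoint, LinearIsometryEquiv.norm_map] at h
  rw [sq, ← h, ContinuousLinearMap.adjoint_comp, hR', ← hS]
  rfl

namespace KNR

variable {d H : ℕ} {U E : Type*} [MeasurableSpace U] [NormedAddCommGroup E]
  [InnerProductSpace ℝ E] [MeasurableSpace E]

/-- The states `x_0, …, x_H` under the dynamics `x_{h+1} = W φ(x_h, π(x_h, h)) + ξ_h`. -/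
def rollout (M : KNR d H U E) (W : E →L[ℝ] State d) (π : Policy d H U)
    (ξ : Fin H → State d) : Traj d H :=
  fun k => Fin.induction (motive := fun _ => State d) M.x₀
    (fun h x => W (M.φ (x, π x h)) + ξ h) k

/-- The realized cumulative cost `∑_{h<H} c(x_h, u_h)` of a trajectory of the controller `π`. -/
def trajCost (c : State d × U → ℝ≥0) (π : Policy d H U) (x : Traj d H) : ℝ≥0 :=
  ∑ h : Fin H, c (x h.castSucc, π (x h.castSucc) h)

/-- The expected total cost `J^π(x₀; c, W)`. -/
def J (M : KNR d H U E) (π : Policy d H U) (c : State d × U → ℝ≥0)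
    (W : E →L[ℝ] State d) : ℝ≥0∞ :=
  ∫⁻ ξ, (trajCost c π (M.rollout W π ξ) : ℝ≥0∞) ∂(episodeNoise d H M.σ)

/-- The second moment of the realized cumulative cost of `π` under the true dynamics. -/
def secondMoment (M : KNR d H U E) (π : Policy d H U) (c : State d × U → ℝ≥0) : ℝ≥0∞ :=
  ∫⁻ ξ, (trajCost c π (M.rollout M.Wstar π ξ) : ℝ≥0∞) ^ 2 ∂(episodeNoise d H M.σ)

/-- The best-in-class cost `J⋆(x₀; c)`. -/
def Jopt (M : KNR d H U E) (Pol : Set (Policy d H U)) (c : State d × U → ℝ≥0) : ℝ≥0∞ :=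
  ⨅ π ∈ Pol, M.J π c M.Wstar

/-- `A` is a (measurable) algorithm with controllers in `Pol`. -/
structure IsAlgorithm (Pol : Set (Policy d H U)) (A : Algorithm d H U) : Prop where
  mem : ∀ t hist, A t hist ∈ Pol
  measurable : ∀ t h, Measurable fun p : History d H t × State d => A t p.1 p.2 h

/-- The states of episode `t` when the algorithm `A` runs on the true dynamics with noise `ω`. -/
def run (M : KNR d H U E) (A : Algorithm d H U) (ω : ℕ → Fin H → State d) (t : ℕ) : Traj d H :=
  M.rollout M.Wstar (A t fun τ : Fin t => M.run A ω τ) (ω t)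
termination_by t
decreasing_by exact τ.2

/-- The history before episode `t` when `A` runs with noise `ω`. -/
def runHist (M : KNR d H U E) (A : Algorithm d H U) (ω : ℕ → Fin H → State d) (t : ℕ) :
    History d H t :=
  fun τ => M.run A ω τ

/-- The controller `π^τ` that `A` executed in the past episode `τ < t`. -/
def pastPolicy (A : Algorithm d H U) {t : ℕ} (hist : History d H t) (τ : Fin t) :
    Policy d H U :=
  A τ fun s : Fin τ => hist ⟨s, s.2.trans τ.2⟩

/-- The observed features `φ(x^τ_h, u^τ_h)`, `τ < t`, `h < H`. -/
def features (M : KNR d H U E) (A : Algorithm d H U) {t : ℕ} (hist : History d H t)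
    (i : Fin t × Fin H) : E :=
  M.φ (hist i.1 i.2.castSucc, pastPolicy A hist i.1 (hist i.1 i.2.castSucc) i.2)

/-- `log (det Σ^t / det Σ^0)`. -/
def logDet (M : KNR d H U E) (lam : ℝ) (A : Algorithm d H U) {t : ℕ} (hist : History d H t) : ℝ :=
  Real.log (detRatio lam (M.features A hist))

/-- The maximum information gain
`γ_T(λ) = sup_A E_A [log (det Σ^T / det Σ^0)]`. -/
def gamma (M : KNR d H U E) (Pol : Set (Policy d H U)) (lam : ℝ) (T : ℕ) : ℝ≥0∞ :=
  ⨆ (A : Algorithm d H U) (_ : IsAlgorithm Pol A),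
    ∫⁻ ω, ENNReal.ofReal (M.logDet lam A (M.runHist A ω T)) ∂(fullNoise d H M.σ)

/-- The second-moment information gain
`γ_{2,T}(λ) = sup_A E_A [(log (det Σ^{T-1} / det Σ^0))²]`. -/
def gamma₂ (M : KNR d H U E) (Pol : Set (Policy d H U)) (lam : ℝ) (T : ℕ) : ℝ≥0∞ :=
  ⨆ (A : Algorithm d H U) (_ : IsAlgorithm Pol A),
    ∫⁻ ω, ENNReal.ofReal (M.logDet lam A (M.runHist A ω (T - 1)) ^ 2) ∂(fullNoise d H M.σ)

/-- `d̃_T² = γ_T(λ) (γ_T(λ) + d + log T + H)`. -/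
def dTildeSq (M : KNR d H U E) (Pol : Set (Policy d H U)) (lam : ℝ) (T : ℕ) : ℝ≥0∞ :=
  M.gamma Pol lam T * (M.gamma Pol lam T + d + ENNReal.ofReal (Real.log T) + H)

/-- The realized regret
`∑_{t<T} ∑_{h<H} c^t(x^t_h, u^t_h) - ∑_{t<T} J⋆(x₀; c^t)` of the algorithm `A`. -/
def regret (M : KNR d H U E) (Pol : Set (Policy d H U)) (c : ℕ → State d × U → ℝ≥0)
    (A : Algorithm d H U) (T : ℕ) (ω : ℕ → Fin H → State d) : ℝ :=
  ∑ t ∈ Finset.range T, (trajCost (c t) (A t (M.runHist A ω t)) (M.run A ω t) : ℝ) -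
    ∑ t ∈ Finset.range T, (M.Jopt Pol (c t)).toReal

section Ball

variable [CompleteSpace E]

/-- The squared Frobenius norm `‖W‖_F²` (sum of the squared norms of the rows of `W`). -/
def frobeniusSq (W : E →L[ℝ] State d) : ℝ :=
  ∑ i : Fin d, ‖ContinuousLinearMap.adjoint W (EuclideanSpace.single i (1 : ℝ))‖ ^ 2

/-- The regularized least squares objective at episode `t`. -/
def ridgeLoss (M : KNR d H U E) (lam : ℝ) (A : Algorithm d H U) {t : ℕ} (hist : History d H t)
    (W : E →L[ℝ] State d) : ℝ :=
  (∑ τ : Fin t, ∑ h : Fin H, ‖W (M.features A hist (τ, h)) - hist τ h.succ‖ ^ 2) +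
    lam * frobeniusSq W

/-- The radius `β^t = C₁ (λ ‖W⋆‖² + σ² (d + log (t det Σ^t / det Σ^0)))`. -/
def beta (M : KNR d H U E) (C₁ lam : ℝ) (A : Algorithm d H U) {t : ℕ} (hist : History d H t) : ℝ :=
  C₁ * (lam * ‖M.Wstar‖ ^ 2 +
    M.σ ^ 2 * (d + Real.log (t * detRatio lam (M.features A hist))))

/-- The confidence set `{W | ‖(W - W̄) Σ^{1/2}‖² ≤ β}` at an episode `t ≥ 1`, where `W̄` is the
minimizer of the regularized least squares objective. By the C⋆-identity, `‖(W - W̄) Σ^{1/2}‖²`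
is `‖(W - W̄) Σ (W - W̄)⋆‖`, see `norm_comp_sqrt_sq`. -/
def confBall (M : KNR d H U E) (C₁ lam : ℝ) (A : Algorithm d H U) {t : ℕ}
    (hist : History d H t) : Set (E →L[ℝ] State d) :=
  {W | ∃ Wbar : E →L[ℝ] State d,
    (∀ W', M.ridgeLoss lam A hist Wbar ≤ M.ridgeLoss lam A hist W') ∧
    ‖(W - Wbar) ∘L featureCov lam (M.features A hist) ∘L ContinuousLinearMap.adjoint (W - Wbar)‖
      ≤ M.beta C₁ lam A hist}

/-- The set `Ball^t`: an arbitrary initial set at `t = 0`, the confidence set afterwards. -/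
def ball (M : KNR d H U E) (Ball₀ : Set (E →L[ℝ] State d)) (C₁ lam : ℝ) (A : Algorithm d H U)
    {t : ℕ} (hist : History d H t) : Set (E →L[ℝ] State d) :=
  if t = 0 then Ball₀ else M.confBall C₁ lam A hist

/-- `A` is the LC³ algorithm with input parameters `λ`, `C₁`, initial set `Ball₀` and costs `c`:
`Ball₀` contains `W⋆`, and in every episode `A` plays
`π^t ∈ argmin_{π ∈ Pol} min_{W ∈ Ball^t} J^π(x₀; c^t, W)`
(the inner minimum is taken as an infimum). -/
structure IsLC3 (M : KNR d H U E) (Pol : Set (Policy d H U)) (c : ℕ → State d × U → ℝ≥0)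
    (Ball₀ : Set (E →L[ℝ] State d)) (C₁ lam : ℝ) (A : Algorithm d H U) : Prop where
  isAlgorithm : IsAlgorithm Pol A
  init : M.Wstar ∈ Ball₀
  optimistic : ∀ᵐ ω ∂(fullNoise d H M.σ), ∀ t : ℕ, ∀ π ∈ Pol,
    ⨅ W ∈ M.ball Ball₀ C₁ lam A (M.runHist A ω t), M.J (A t (M.runHist A ω t)) (c t) W ≤
      ⨅ W ∈ M.ball Ball₀ C₁ lam A (M.runHist A ω t), M.J π (c t) W

end Ball

end KNR

end

/-! ### Regularized covariance: inverse, determinants and self-normalized sums. -/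

section Ridge

variable {E ι κ : Type*} [NormedAddCommGroup E] [InnerProductSpace ℝ E] [Fintype ι] [Fintype κ]

/-! The proof combines optimism with a change of measure for a whole episode and a log-determinant
potential.

Confidence. For a unit vector v, the `mixtureRatio` built from the features and the noise in
direction v is a nonnegative martingale of mean one (`lintegral_dirRatio`), because each transition
multiplies it by a ratio of two Gaussian densities. Its average over v is therefore at most t² off
an event of probability at most 1/t². The exponent is a quadratic form in v, so the averaged bound
controls all directions at once, at a cost of order d (`le_of_mean_exp_le`). With the normal
equations of ridge regression this puts `Wstar` in the confidence set for C₁ = 32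
(`Wstar_mem_confBall`).

Simulation. Running a policy under W with suitably shifted noise reproduces its trajectory under
`Wstar`, and Girsanov's formula supplies the density r of the shift. Cauchy–Schwarz bounds the
difference of the two values by the root of the second moment of the cost times the root of E[((1 -
r)⁺)²]. The latter expectation is controlled by the Kullback–Leibler divergence, capped at 1
(`lintegral_sq_one_sub_prod_le_min`). Only the second moment under the true dynamics appears, and
the episode is compared as a whole, with no telescoping over time steps (`J_Wstar_le`).

One episode. On the good event, optimism gives J ≤ J⋆ + √V √B, with V the second moment of the cost
and B the model error. Since also √V ≤ α J, substituting this bound once into itself yields J - J⋆ ≤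
α J⋆ √B + α √Vmax B (`J_Wstar_sub_Jopt_le`). The leading term thus scales with J⋆ instead of √Vmax.

Summation. B is the confidence radius times the expected capped gain in log-determinant. The gains
telescope; Cauchy–Schwarz handles the sum of √B with first moments only
(`sum_lintegral_sqrt_modelError_le`), while the sum of B needs the second moment of the
log-determinant before the last episode (`sum_lintegral_modelError_le`). Each episode contributes at
most √Vmax on its bad event, and the bad probabilities sum to at most 3; this is the additive √Vmax,
which is absorbed when d̃_T ≥ 1. -/

theorem featureCov_apply (lam : ℝ) (f : ι → E) (x : E) :
    featureCov lam f x = lam • x + ∑ i, inner ℝ (f i) x • f i := by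
  simp [featureCov, InnerProductSpace.rankOne_apply]

theorem inner_featureCov (lam : ℝ) (f : ι → E) (x y : E) :
    inner ℝ x (featureCov lam f y) =
      lam * inner ℝ x y + ∑ i, inner ℝ (f i) x * inner ℝ (f i) y := by
  rw [featureCov_apply, inner_add_right, inner_smul_right, inner_sum]
  congr 1
  refine Finset.sum_congr rfl fun i _ => ?_
  rw [inner_smul_right, real_inner_comm (f i) x, mul_comm]

theorem inner_featureCov_comm (lam : ℝ) (f : ι → E) (x y : E) :
    inner ℝ (featureCov lam f x) y = inner ℝ x (featureCov lam f y) := by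
  rw [real_inner_comm, inner_featureCov, inner_featureCov, real_inner_comm]
  congr 1
  exact Finset.sum_congr rfl fun i _ => mul_comm _ _

theorem le_inner_featureCov_self (lam : ℝ) (f : ι → E) (x : E) :
    lam * ‖x‖ ^ 2 ≤ inner ℝ x (featureCov lam f x) := by
  rw [inner_featureCov, real_inner_self_eq_norm_sq]
  have : 0 ≤ ∑ i, inner ℝ (f i) x * inner ℝ (f i) x :=
    Finset.sum_nonneg fun i _ => mul_self_nonneg _
  linarith

theorem featureCov_comp_equiv (lam : ℝ) (f : ι → E) (e : κ ≃ ι) :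
    featureCov lam (f ∘ e) = featureCov lam f := by
  simp only [featureCov, Function.comp_apply]
  rw [e.sum_comp (fun i => InnerProductSpace.rankOne ℝ (f i) (f i))]

theorem featureCov_sumElim (lam : ℝ) (f : ι → E) (g : κ → E) (x : E) :
    featureCov lam (Sum.elim f g) x = featureCov lam f x + ∑ k, inner ℝ (g k) x • g k := by
  simp only [featureCov_apply, Fintype.sum_sum_type, Sum.elim_inl, Sum.elim_inr, add_assoc]

/-- The inverse of the regularized feature covariance. -/
noncomputable def regInv (lam : ℝ) (f : ι → E) : E →L[ℝ] E :=
  (featureCov lam f).inverse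

section Det

variable [DecidableEq ι] [DecidableEq κ] {lam : ℝ}

theorem posDef_one_add_gram (hlam : 0 < lam) (f : ι → E) :
    (1 + lam⁻¹ • Matrix.gram ℝ f).PosDef :=
  Matrix.PosDef.one.add_posSemidef ((Matrix.posSemidef_gram ℝ f).smul (inv_nonneg.2 hlam.le))

theorem _root_.Finset.one_add_sum_le_prod_one_add {α : Type*} (s : Finset α) (a : α → ℝ)
    (ha : ∀ i, 0 ≤ a i) : 1 + ∑ i ∈ s, a i ≤ ∏ i ∈ s, (1 + a i) := by
  classical
  induction s using Finset.induction_on with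
  | empty => simp
  | insert i s hi ih =>
    rw [Finset.sum_insert hi, Finset.prod_insert hi]
    have h0 : 0 ≤ ∑ j ∈ s, a j := Finset.sum_nonneg fun j _ => ha j
    nlinarith [ha i, mul_nonneg (ha i) h0, mul_le_mul_of_nonneg_left ih (ha i)]

/-- The eigenvalues of 1 + N are 1 + aᵢ with aᵢ ≥ 0, and expanding the product of the 1 + aᵢ leaves
only nonnegative terms beyond 1 + ∑ aᵢ. -/
theorem _root_.Matrix.PosSemidef.one_add_trace_le_det_one_add {N : Matrix ι ι ℝ}
    (hN : N.PosSemidef) : 1 + N.trace ≤ (1 + N).det := by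
  have hP : (1 + N).PosDef := Matrix.PosDef.one.add_posSemidef hN
  have hH := hP.isHermitian
  have hge : ∀ i, 0 ≤ hH.eigenvalues i - 1 := by
    intro i
    let v : ι → ℝ := hH.eigenvectorBasis i
    have hv : v ⬝ᵥ v = 1 := by
      have h : inner ℝ (hH.eigenvectorBasis i) (hH.eigenvectorBasis i) = 1 := by
        rw [real_inner_self_eq_norm_sq, hH.eigenvectorBasis.norm_eq_one, one_pow]
      rw [← h]
      rfl
    have h1 : v ⬝ᵥ (1 + N).mulVec v = hH.eigenvalues i := by
      rw [hH.mulVec_eigenvectorBasis i, dotProduct_smul, hv, smul_eq_mul, mul_one]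
    have h2 : 0 ≤ v ⬝ᵥ N.mulVec v := by simpa using hN.dotProduct_mulVec_nonneg v
    rw [Matrix.add_mulVec, Matrix.one_mulVec, dotProduct_add, hv] at h1
    linarith
  have h1 := Finset.one_add_sum_le_prod_one_add Finset.univ
    (fun i => hH.eigenvalues i - 1) hge
  have h2 : (1 + N).trace = ∑ i, hH.eigenvalues i := by
    simpa using hH.trace_eq_sum_eigenvalues
  have h3 : (1 + N).det = ∏ i, hH.eigenvalues i := by
    simpa using hH.det_eq_prod_eigenvalues
  rw [Matrix.trace_add, Matrix.trace_one] at h2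
  rw [Finset.sum_sub_distrib, ← h2] at h1
  simp only [add_sub_cancel, Finset.sum_const, Finset.card_univ, nsmul_eq_mul, mul_one] at h1
  rw [h3]
  linarith

theorem detRatio_pos (hlam : 0 < lam) (f : ι → E) : 0 < detRatio lam f :=
  (posDef_one_add_gram hlam f).det_pos

theorem one_le_detRatio (hlam : 0 < lam) (f : ι → E) : 1 ≤ detRatio lam f := by
  have hN := (Matrix.posSemidef_gram ℝ f).smul (inv_nonneg.2 hlam.le)
  have := hN.one_add_trace_le_det_one_add
  have h0 : 0 ≤ (lam⁻¹ • Matrix.gram ℝ f).trace := hN.trace_nonneg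
  exact le_trans (by linarith) this

theorem detRatio_comp_equiv (f : ι → E) (e : κ ≃ ι) :
    detRatio lam (f ∘ e) = detRatio lam f := by
  have : (1 + lam⁻¹ • Matrix.gram ℝ (f ∘ e)) = (1 + lam⁻¹ • Matrix.gram ℝ f).submatrix e e := by
    ext i j
    simp [Matrix.one_apply, Matrix.gram_apply]
  rw [detRatio, this, Matrix.det_submatrix_equiv_self, detRatio]

end Det

section Complete

variable [CompleteSpace E] {lam : ℝ}

/-- Lax–Milgram: the bilinear form of the covariance is coercive with constant `lam`. This gives
invertibility in infinite dimension as well. -/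
theorem exists_equiv_featureCov (hlam : 0 < lam) (f : ι → E) :
    ∃ e : E ≃L[ℝ] E, (e : E →L[ℝ] E) = featureCov lam f := by
  let B : E →L[ℝ] E →L[ℝ] ℝ := (innerSL ℝ).comp (featureCov lam f)
  have hB : IsCoercive B := by
    refine ⟨lam, hlam, fun u => ?_⟩
    have := le_inner_featureCov_self lam f u
    rw [← inner_featureCov_comm] at this
    calc lam * ‖u‖ * ‖u‖ = lam * ‖u‖ ^ 2 := by ring
      _ ≤ _ := this
  refine ⟨hB.continuousLinearEquivOfBilin, ?_⟩
  ext v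
  refine ext_inner_right ℝ fun w => ?_
  exact hB.continuousLinearEquivOfBilin_apply v w

theorem featureCov_regInv (hlam : 0 < lam) (f : ι → E) (x : E) :
    featureCov lam f (regInv lam f x) = x := by
  obtain ⟨e, he⟩ := exists_equiv_featureCov hlam f
  rw [regInv, ← he, ContinuousLinearMap.inverse_equiv]
  simp

theorem regInv_featureCov (hlam : 0 < lam) (f : ι → E) (x : E) :
    regInv lam f (featureCov lam f x) = x := by
  obtain ⟨e, he⟩ := exists_equiv_featureCov hlam f
  rw [regInv, ← he, ContinuousLinearMap.inverse_equiv]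
  simp

theorem regInv_eq_of_featureCov_eq (hlam : 0 < lam) (f : ι → E) {x z : E}
    (h : featureCov lam f z = x) : regInv lam f x = z := by
  rw [← h, regInv_featureCov hlam]

theorem inner_regInv_comm (hlam : 0 < lam) (f : ι → E) (x y : E) :
    inner ℝ (regInv lam f x) y = inner ℝ x (regInv lam f y) := by
  conv_lhs => rw [← featureCov_regInv hlam f y]
  rw [← inner_featureCov_comm, featureCov_regInv hlam]

theorem inner_regInv_self_nonneg (hlam : 0 < lam) (f : ι → E) (x : E) :
    0 ≤ inner ℝ x (regInv lam f x) := by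
  have h := le_inner_featureCov_self lam f (regInv lam f x)
  rw [featureCov_regInv hlam, real_inner_comm] at h
  exact le_trans (by positivity) h

/-- Since Σ ≥ λ, its inverse is at most 1/λ. This controls the bias that regularization causes. -/
theorem mul_inner_regInv_self_le (hlam : 0 < lam) (f : ι → E) (x : E) :
    lam * inner ℝ x (regInv lam f x) ≤ ‖x‖ ^ 2 := by
  set z := regInv lam f x with hz
  have h := le_inner_featureCov_self lam f z
  rw [hz, featureCov_regInv hlam, ← hz, real_inner_comm] at h
  have hcs : inner ℝ x z ≤ ‖x‖ * ‖z‖ := real_inner_le_norm x z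
  have h1 : lam * ‖z‖ ≤ ‖x‖ := by
    rcases (norm_nonneg z).eq_or_lt with h0 | h0
    · rw [← h0]; simp
    · refine le_of_mul_le_mul_right ?_ h0
      nlinarith
  nlinarith [norm_nonneg x, norm_nonneg z]

/-- Cauchy–Schwarz for the pair of dual quadratic forms. -/
theorem inner_sq_le_featureCov_mul_regInv (hlam : 0 < lam) (f : ι → E) (x y : E) :
    inner ℝ x y ^ 2 ≤ inner ℝ x (featureCov lam f x) * inner ℝ y (regInv lam f y) := by
  -- The quadratic form of Σ at x + s Σ⁻¹y is nonnegative for every s, so its discriminant in s is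
  -- not positive.
  have key : ∀ s : ℝ, 0 ≤ inner ℝ y (regInv lam f y) * (s * s) + (2 * inner ℝ x y) * s +
      inner ℝ x (featureCov lam f x) := by
    intro s
    have h := le_inner_featureCov_self lam f (x + s • regInv lam f y)
    have h0 : 0 ≤ inner ℝ (x + s • regInv lam f y)
        (featureCov lam f (x + s • regInv lam f y)) := le_trans (by positivity) h
    rw [map_add, map_smul, featureCov_regInv hlam] at h0
    simp only [inner_add_left, inner_add_right, inner_smul_left, inner_smul_right,
      RCLike.conj_to_real] at h0
    rw [← inner_featureCov_comm lam f (regInv lam f y) x, featureCov_regInv hlam,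
      real_inner_comm x y, real_inner_comm y (regInv lam f y)] at h0
    linarith
  have := discrim_le_zero key
  rw [discrim] at this
  nlinarith

variable [DecidableEq ι] [DecidableEq κ]

/-- Schur complement of the old block in the enlarged Gram matrix. Solving against the old block
turns the mixed inner products into ⟨fᵢ, Σ⁻¹ gₖ⟩, so the complement is the identity plus the Gram
matrix of the new vectors in the Σ⁻¹ inner product. Only finite matrices occur, whatever the
dimension of the space. -/
theorem detRatio_sumElim (hlam : 0 < lam) (f : ι → E) (g : κ → E) :
    detRatio lam (Sum.elim f g) = detRatio lam f *
      (1 + Matrix.of fun j k => inner ℝ (g j) (regInv lam f (g k))).det := by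
  set A : Matrix ι ι ℝ := 1 + lam⁻¹ • Matrix.gram ℝ f with hA
  let B : Matrix ι κ ℝ := Matrix.of fun i k => lam⁻¹ * inner ℝ (f i) (g k)
  let D : Matrix κ κ ℝ := 1 + lam⁻¹ • Matrix.gram ℝ g
  let Z : Matrix ι κ ℝ := Matrix.of fun i k => inner ℝ (f i) (regInv lam f (g k))
  have hblock : (1 + lam⁻¹ • Matrix.gram ℝ (Sum.elim f g)) =
      Matrix.fromBlocks A B B.transpose D := by
    ext (i | i) (j | j) <;>
      simp [A, B, D, Matrix.one_apply, Matrix.gram_apply, real_inner_comm]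
  have hdet : IsUnit A.det := (posDef_one_add_gram hlam f).det_pos.ne'.isUnit
  let _ : Invertible A := Matrix.invertibleOfIsUnitDet A hdet
  -- This is Σ Σ⁻¹ gₖ = gₖ divided by λ; pairing it with fᵢ gives `hAZ`, and with gⱼ the Schur
  -- complement.
  have hcov : ∀ k, lam⁻¹ • g k = regInv lam f (g k) +
      lam⁻¹ • ∑ j, inner ℝ (f j) (regInv lam f (g k)) • f j := by
    intro k
    have h := featureCov_regInv hlam f (g k)
    rw [featureCov_apply] at h
    nth_rewrite 1 [← h]
    rw [smul_add, smul_smul, inv_mul_cancel₀ hlam.ne', one_smul]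
  have hAZ : A * Z = B := by
    ext i k
    have h := congrArg (fun w => inner ℝ (f i) w) (hcov k)
    simp only [inner_smul_right, inner_add_right, inner_sum] at h
    rw [hA, Matrix.add_mul, Matrix.one_mul, Matrix.smul_mul]
    simp only [B, Z, Matrix.add_apply,
      Matrix.smul_apply, Matrix.mul_apply, Matrix.of_apply, Matrix.gram_apply, smul_eq_mul]
    rw [h]
    congr 2
    exact Finset.sum_congr rfl fun j _ => mul_comm (inner ℝ (f i) (f j)) _
  have hinv : ⅟A * B = Z := by
    rw [← hAZ, ← Matrix.mul_assoc, invOf_mul_self, Matrix.one_mul]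
  rw [detRatio, hblock, Matrix.det_fromBlocks₁₁, Matrix.mul_assoc, hinv, detRatio]
  congr 2
  ext j k
  have h := congrArg (fun w => inner ℝ (g j) w) (hcov k)
  simp only [inner_smul_right, inner_add_right, inner_sum] at h
  simp only [D, B, Z, Matrix.sub_apply, Matrix.add_apply, Matrix.smul_apply, Matrix.mul_apply,
    Matrix.transpose_apply, Matrix.of_apply, Matrix.gram_apply, smul_eq_mul]
  rw [h, Finset.mul_sum]
  have : ∀ i, lam⁻¹ * (inner ℝ (f i) (regInv lam f (g k)) * inner ℝ (g j) (f i)) =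
      lam⁻¹ * inner ℝ (f i) (g j) * inner ℝ (f i) (regInv lam f (g k)) := by
    intro i; rw [real_inner_comm (f i) (g j)]; ring
  simp only [this]
  ring

/-- The potential bound for a whole batch of vectors: all widths are measured by the covariance
before the batch, which is the one that defines the confidence set of the episode. It follows from
det (1 + N) ≥ 1 + tr N. -/
theorem detRatio_mul_one_add_sum_le (hlam : 0 < lam) (f : ι → E) (g : κ → E) :
    detRatio lam f * (1 + ∑ k, inner ℝ (g k) (regInv lam f (g k))) ≤
      detRatio lam (Sum.elim f g) := by
  rw [detRatio_sumElim hlam]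
  refine mul_le_mul_of_nonneg_left ?_ (detRatio_pos hlam f).le
  have hN : (Matrix.of fun j k => inner ℝ (g j) (regInv lam f (g k))).PosSemidef := by
    refine Matrix.PosSemidef.of_dotProduct_mulVec_nonneg ?_ fun x => ?_
    · ext j k
      simp only [Matrix.conjTranspose_apply, Matrix.of_apply, star_trivial]
      rw [real_inner_comm, inner_regInv_comm hlam]
    · have : star x ⬝ᵥ (Matrix.of fun j k => inner ℝ (g j) (regInv lam f (g k))).mulVec x =
          inner ℝ (∑ k, x k • g k) (regInv lam f (∑ k, x k • g k)) := by
        simp only [dotProduct, Matrix.mulVec, Matrix.of_apply, map_sum, map_smul, sum_inner,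
          inner_sum, inner_smul_left, inner_smul_right, Pi.star_apply, star_trivial,
          RCLike.conj_to_real, Finset.mul_sum]
        refine Finset.sum_congr rfl fun j _ => Finset.sum_congr rfl fun k _ => ?_
        rw [← inner_regInv_comm hlam f (g j) (g k), real_inner_comm]
        ring
      rw [this]
      exact inner_regInv_self_nonneg hlam f _
  have := hN.one_add_trace_le_det_one_add
  simpa [Matrix.trace] using this

theorem detRatio_sumElim_unit (hlam : 0 < lam) (f : ι → E) (g : E) :
    detRatio lam (Sum.elim f fun _ : Unit => g) =
      detRatio lam f * (1 + inner ℝ g (regInv lam f g)) := by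
  rw [detRatio_sumElim hlam]
  simp

end Complete

/-- The squared `Σ⁻¹`-norm of `∑ᵢ yᵢ fᵢ`, with `Σ` the regularized covariance of the `fᵢ`. -/
noncomputable def selfNormSq (lam : ℝ) (f : ι → E) (y : ι → ℝ) : ℝ :=
  inner ℝ (∑ i, y i • f i) (regInv lam f (∑ i, y i • f i))

theorem selfNormSq_comp_equiv (lam : ℝ) (f : ι → E) (y : ι → ℝ) (e : κ ≃ ι) :
    selfNormSq lam (f ∘ e) (y ∘ e) = selfNormSq lam f y := by
  simp only [selfNormSq, regInv, featureCov_comp_equiv, Function.comp_apply]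
  rw [e.sum_comp (fun i => y i • f i)]

variable [CompleteSpace E] {lam : ℝ}

/-- A rank-one update of Σ⁻¹. In this form, half the increment is the exponent of the density ratio
between the predictive law N(μ, 1 + s) of the new label and N(0, 1); `lintegral_exp_gaussianReal`
integrates exactly this expression. -/
theorem selfNormSq_sumElim_unit (hlam : 0 < lam) (f : ι → E) (y : ι → ℝ) (g : E) (a : ℝ) :
    selfNormSq lam (Sum.elim f fun _ : Unit => g) (Sum.elim y fun _ => a) =
      selfNormSq lam f y + (a ^ 2 - (a - inner ℝ g (regInv lam f (∑ i, y i • f i))) ^ 2 /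
        (1 + inner ℝ g (regInv lam f g))) := by
  set S := ∑ i, y i • f i with hS
  set s := inner ℝ g (regInv lam f g) with hs
  set μ := inner ℝ g (regInv lam f S) with hμ
  have hspos : 0 ≤ s := inner_regInv_self_nonneg hlam f g
  have h1s : (1 + s) ≠ 0 := by positivity
  -- The coefficient that makes Σ⁻¹S + k Σ⁻¹g solve the updated system: the coefficient of g there
  -- is μ + k (1 + s), which has to equal a.
  set k := (a - μ) / (1 + s) with hk
  have hkeq : k * (1 + s) = a - μ := div_mul_cancel₀ _ h1s
  have hsum : ∑ i, (Sum.elim y fun _ : Unit => a) i • (Sum.elim f fun _ : Unit => g) i =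
      S + a • g := by
    simp [Fintype.sum_sum_type, hS]
  have hinv : regInv lam (Sum.elim f fun _ : Unit => g) (S + a • g) =
      regInv lam f S + k • regInv lam f g := by
    refine regInv_eq_of_featureCov_eq hlam _ ?_
    rw [featureCov_sumElim, map_add, map_smul, featureCov_regInv hlam, featureCov_regInv hlam]
    simp only [Finset.univ_unique, Finset.sum_const, Finset.card_singleton, one_smul,
      inner_add_right, inner_smul_right, ← hμ, ← hs]
    rw [add_assoc, ← add_smul]
    congr 2
    linarith
  rw [selfNormSq, hsum, hinv, selfNormSq, ← hS]
  simp only [inner_add_left, inner_add_right, inner_smul_left, inner_smul_right,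
    RCLike.conj_to_real]
  have hμ' : inner ℝ S (regInv lam f g) = μ := by
    rw [← inner_regInv_comm hlam, real_inner_comm]
  rw [hμ', ← hμ, ← hs]
  have : (a - μ) ^ 2 / (1 + s) = k * (a - μ) := by rw [hk]; ring
  rw [this]
  linear_combination a * hkeq

/-- The kernel form, in terms of the finite Gram matrix alone. It serves to prove measurability in
the features without discussing measurability of an operator inverse. -/
theorem selfNormSq_eq [DecidableEq ι] (hlam : 0 < lam) (f : ι → E) (y : ι → ℝ) :
    selfNormSq lam f y = y ⬝ᵥ y - y ⬝ᵥ ((1 + lam⁻¹ • Matrix.gram ℝ f)⁻¹).mulVec y := by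
  set A : Matrix ι ι ℝ := 1 + lam⁻¹ • Matrix.gram ℝ f with hA
  set S := ∑ i, y i • f i with hS
  let c : ι → ℝ := fun i => inner ℝ (f i) (regInv lam f S)
  have hdet : IsUnit A.det := (posDef_one_add_gram hlam f).det_pos.ne'.isUnit
  have hcov : regInv lam f S + lam⁻¹ • ∑ j, c j • f j = lam⁻¹ • S := by
    have h := featureCov_regInv hlam f S
    rw [featureCov_apply] at h
    nth_rewrite 2 [← h]
    rw [smul_add, smul_smul, inv_mul_cancel₀ hlam.ne', one_smul]
  have hAc : A.mulVec (y - c) = y := by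
    ext i
    have h := congrArg (fun w => inner ℝ (f i) w) hcov
    simp only [inner_smul_right, inner_add_right, inner_sum, hS] at h
    rw [hA, Matrix.add_mulVec, Matrix.one_mulVec, Matrix.smul_mulVec]
    simp only [Pi.add_apply,
      Pi.sub_apply, Pi.smul_apply, Matrix.mulVec, dotProduct, Matrix.gram_apply, smul_eq_mul,
      mul_sub, Finset.sum_sub_distrib]
    have e1 : ∑ j, inner ℝ (f i) (f j) * y j = ∑ j, y j * inner ℝ (f i) (f j) :=
      Finset.sum_congr rfl fun j _ => mul_comm _ _
    have e2 : ∑ j, inner ℝ (f i) (f j) * c j = ∑ j, c j * inner ℝ (f i) (f j) :=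
      Finset.sum_congr rfl fun j _ => mul_comm _ _
    rw [e1, e2]
    have e3 : c i = inner ℝ (f i) (regInv lam f (∑ i, y i • f i)) := rfl
    rw [← e3] at h
    linarith
  have hinv : A⁻¹.mulVec y = y - c := by
    nth_rewrite 1 [← hAc]
    rw [Matrix.mulVec_mulVec, Matrix.nonsing_inv_mul A hdet, Matrix.one_mulVec]
  rw [hinv, dotProduct_sub, sub_sub_cancel, selfNormSq, ← hS]
  conv_lhs => rw [hS, sum_inner]
  simp only [dotProduct, c, inner_smul_left, RCLike.conj_to_real]
  rfl

end Ridge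

/-! ### Adapted shifts of product measures. -/

section Pi

variable {X : Type*} [MeasurableSpace X]

theorem measurable_finCons {α : Type*} [MeasurableSpace α] {n : ℕ} {a : α → X}
    {b : α → Fin n → X} (ha : Measurable a) (hb : Measurable b) :
    Measurable fun p => (Fin.cons (a p) (b p) : Fin (n + 1) → X) := by
  refine measurable_pi_lambda _ fun i => ?_
  refine Fin.cases ?_ (fun j => ?_) i
  · simpa using ha
  · simpa [Function.comp_def] using (measurable_pi_apply j).comp hb

theorem lintegral_pi_succ (N : Measure X) [IsProbabilityMeasure N] {n : ℕ}
    {F : (Fin (n + 1) → X) → ℝ≥0∞} (hF : Measurable F) :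
    ∫⁻ x, F x ∂(Measure.pi fun _ => N) =
      ∫⁻ a, ∫⁻ b, F (Fin.cons a b) ∂(Measure.pi fun _ : Fin n => N) ∂N := by
  have h := (measurePreserving_piFinSuccAbove (fun _ : Fin (n + 1) => N) 0).symm
  rw [← h.lintegral_comp hF, lintegral_prod]
  · simp only [MeasurableEquiv.piFinSuccAbove_symm_apply, Fin.insertNthEquiv, Equiv.coe_fn_mk,
      Fin.insertNth_zero]
    rfl
  · exact (hF.comp (MeasurableEquiv.measurable _)).aemeasurable

/-- Change of variables under an adapted shift, for a product of copies of a measure whose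
translates have the density `ρ`. -/
theorem lintegral_pi_adapted_shift [Add X] [MeasurableAdd₂ X] (N : Measure X)
    [IsProbabilityMeasure N] {ρ : X → X → ℝ≥0∞} (hρ : Measurable (Function.uncurry ρ))
    (hshift : ∀ (m : X) (F : X → ℝ≥0∞), Measurable F →
      ∫⁻ x, F (x + m) * ρ m x ∂N = ∫⁻ x, F x ∂N) {n : ℕ} :
    ∀ (m : (Fin n → X) → Fin n → X), Measurable m →
      (∀ i x y, (∀ j < i, x j = y j) → m x i = m y i) →
      ∀ F : (Fin n → X) → ℝ≥0∞, Measurable F →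
      ∫⁻ x, F (x + m x) * ∏ i, ρ (m x i) (x i) ∂(Measure.pi fun _ => N) =
        ∫⁻ x, F x ∂(Measure.pi fun _ => N) := by
  induction n with
  | zero =>
    intro m _ _ F _
    simp only [Finset.univ_eq_empty, Finset.prod_empty, mul_one]
    refine lintegral_congr fun x => ?_
    rw [Subsingleton.elim (x + m x) x]
  | succ n ih =>
    intro m hm hadap F hF
    -- A probability measure needs a nonempty space; a point is wanted only to name the first shift,
    -- which is constant by adaptedness.
    obtain ⟨a₀⟩ : Nonempty X := by
      by_contra h
      rw [not_nonempty_iff] at h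
      have := measure_univ (μ := N)
      rw [Set.univ_eq_empty_iff.2 h, measure_empty] at this
      exact zero_ne_one this
    have hmi : ∀ i, Measurable fun x => m x i := fun i => (measurable_pi_apply i).comp hm
    have hadd : Measurable fun x => x + m x :=
      measurable_pi_lambda _ fun i => (measurable_pi_apply i).add (hmi i)
    have hprod : Measurable fun x => ∏ i, ρ (m x i) (x i) :=
      Finset.measurable_prod _ fun i _ => hρ.comp ((hmi i).prodMk (measurable_pi_apply i))
    have hcons : Measurable fun p : X × (Fin n → X) => (Fin.cons p.1 p.2 : Fin (n + 1) → X) :=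
      measurable_finCons measurable_fst measurable_snd
    have hcons' : ∀ a, Measurable fun b : Fin n → X => (Fin.cons a b : Fin (n + 1) → X) :=
      fun a => measurable_finCons measurable_const measurable_id
    set m₀ : X := m (fun _ => a₀) 0 with hm₀
    have hm0 : ∀ x, m x 0 = m₀ := fun x => hadap 0 _ _ fun j hj => absurd hj (Fin.not_lt_zero j)
    -- With the first coordinate frozen the remaining shift is still adapted, so induction removes
    -- all densities but the first. That one is removed last, by the outer integral.
    have key : ∀ a, ∫⁻ b, F (Fin.cons a b + m (Fin.cons a b)) *
        ∏ i, ρ (m (Fin.cons a b) i) ((Fin.cons a b : Fin (n + 1) → X) i)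
          ∂(Measure.pi fun _ : Fin n => N) =
        (∫⁻ b, F (Fin.cons (a + m₀) b) ∂(Measure.pi fun _ : Fin n => N)) * ρ m₀ a := by
      intro a
      rw [← ih (fun b i => m (Fin.cons a b) i.succ)
        (measurable_pi_lambda _ fun i => (hmi _).comp (hcons' a)) ?_
        (fun b => F (Fin.cons (a + m₀) b)) (hF.comp (hcons' _)),
        ← lintegral_mul_const]
      · refine lintegral_congr fun b => ?_
        rw [Fin.prod_univ_succ]
        have : (Fin.cons a b + m (Fin.cons a b) : Fin (n + 1) → X) =
            Fin.cons (a + m₀) (b + fun i => m (Fin.cons a b) i.succ) := by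
          funext i
          refine Fin.cases ?_ (fun j => ?_) i
          · simp [hm0]
          · simp
        rw [this]
        simp only [Fin.cons_zero, Fin.cons_succ, hm0]
        ring
      · refine Measurable.mul ?_ ?_
        · refine hF.comp (measurable_finCons measurable_const ?_)
          exact measurable_pi_lambda _ fun i =>
            (measurable_pi_apply i).add ((hmi _).comp (hcons' a))
        · exact Finset.measurable_prod _ fun i _ =>
            hρ.comp (((hmi _).comp (hcons' a)).prodMk (measurable_pi_apply i))
      · intro i x y hxy
        refine hadap _ _ _ fun j hj => ?_
        refine Fin.cases (fun _ => rfl) (fun k hk => ?_) j hj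
        simpa using hxy k (Fin.succ_lt_succ_iff.1 hk)
    have hsplit := lintegral_pi_succ N ((hF.comp hadd).mul hprod)
    simp only [Pi.mul_apply, Function.comp_apply, key] at hsplit
    rw [hsplit, lintegral_pi_succ N hF]
    refine hshift m₀ (fun a => ∫⁻ b, F (Fin.cons a b) ∂(Measure.pi fun _ : Fin n => N)) ?_
    exact (hF.comp hcons).lintegral_prod_right'

end Pi

/-! ### Gaussian shifts and one-dimensional Gaussian integrals. -/

section Gaussian

/-- Density of a translate of the Gaussian noise with respect to the noise. -/
noncomputable def shiftDensity {d : ℕ} (σ : ℝ) (m z : State d) : ℝ :=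
  Real.exp (-(inner ℝ z m / σ ^ 2 + ‖m‖ ^ 2 / (2 * σ ^ 2)))

/-- Translation invariance of Lebesgue measure; the exponential factor is the ratio of the Gaussian
densities at x + m and x. -/
theorem lintegral_gaussianReal_shift (m : ℝ) (F : ℝ → ℝ≥0∞) (hF : Measurable F) :
    ∫⁻ x, F (x + m) * ENNReal.ofReal (Real.exp (-(x * m + m ^ 2 / 2))) ∂(gaussianReal 0 1) =
      ∫⁻ x, F x ∂(gaussianReal 0 1) := by
  rw [gaussianReal_of_var_ne_zero 0 one_ne_zero]
  rw [lintegral_withDensity_eq_lintegral_mul _ (measurable_gaussianPDF 0 1) (by fun_prop),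
    lintegral_withDensity_eq_lintegral_mul _ (measurable_gaussianPDF 0 1) hF,
    ← lintegral_add_right_eq_self (fun x => (gaussianPDF 0 1 * F) x) m]
  refine lintegral_congr fun x => ?_
  simp only [Pi.mul_apply, gaussianPDF]
  rw [mul_comm (F (x + m)), ← mul_assoc, ← ENNReal.ofReal_mul (gaussianPDFReal_nonneg _ _ _)]
  congr 2
  simp only [gaussianPDFReal, mul_assoc, ← Real.exp_add]
  congr 2
  simp
  ring

theorem lintegral_stdGaussian_shift {d : ℕ} (m : State d) (F : State d → ℝ≥0∞)
    (hF : Measurable F) :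
    ∫⁻ x, F (x + m) * ENNReal.ofReal (Real.exp (-(inner ℝ x m + ‖m‖ ^ 2 / 2)))
      ∂(stdGaussian (State d)) = ∫⁻ x, F x ∂(stdGaussian (State d)) := by
  rw [← map_pi_eq_stdGaussian]
  have hto : Measurable (WithLp.toLp 2 : (Fin d → ℝ) → State d) := by fun_prop
  have hin : Measurable fun x : State d => inner ℝ x m := by fun_prop
  rw [lintegral_map (by fun_prop) hto, lintegral_map hF hto]
  refine Eq.trans ?_ (lintegral_pi_adapted_shift (gaussianReal 0 1)
    (ρ := fun m x => ENNReal.ofReal (Real.exp (-(x * m + m ^ 2 / 2))))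
    (by unfold Function.uncurry; fun_prop) lintegral_gaussianReal_shift (fun _ => m.ofLp)
    measurable_const (fun _ _ _ _ => rfl) _ (hF.comp hto))
  refine lintegral_congr fun x => ?_
  rw [← ENNReal.ofReal_prod_of_nonneg (fun i _ => (Real.exp_pos _).le), ← Real.exp_sum]
  congr 3
  simp only [PiLp.inner_apply, EuclideanSpace.real_norm_sq_eq, Finset.sum_neg_distrib,
    Finset.sum_add_distrib, Finset.sum_div]
  simp [mul_comm]

theorem measurable_shiftDensity {d : ℕ} (σ : ℝ) :
    Measurable (Function.uncurry (shiftDensity (d := d) σ)) := by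
  unfold Function.uncurry shiftDensity
  fun_prop

theorem shiftDensity_smul {d : ℕ} {σ : ℝ} (hσ : 0 < σ) (m x : State d) :
    shiftDensity σ m (σ • x) =
      Real.exp (-(inner ℝ x (σ⁻¹ • m) + ‖σ⁻¹ • m‖ ^ 2 / 2)) := by
  rw [shiftDensity, inner_smul_left, inner_smul_right, norm_smul, mul_pow, norm_inv, inv_pow,
    Real.norm_eq_abs, sq_abs]
  congr 2
  simp only [RCLike.conj_to_real]
  field_simp

theorem lintegral_gaussianNoise_shift {d : ℕ} {σ : ℝ} (hσ : 0 < σ) (m : State d)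
    (F : State d → ℝ≥0∞) (hF : Measurable F) :
    ∫⁻ x, F (x + m) * ENNReal.ofReal (shiftDensity σ m x) ∂(gaussianNoise d σ) =
      ∫⁻ x, F x ∂(gaussianNoise d σ) := by
  have hs : Measurable fun z : State d => σ • z := measurable_const_smul σ
  have hd : Measurable fun z : State d => shiftDensity σ m z := by
    unfold shiftDensity
    fun_prop
  have hF' : Measurable fun x => F (x + m) * ENNReal.ofReal (shiftDensity σ m x) :=
    (hF.comp (measurable_id.add_const m)).mul hd.ennreal_ofReal
  have h := lintegral_stdGaussian_shift (σ⁻¹ • m) (fun z => F (σ • z)) (hF.comp hs)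
  rw [gaussianNoise, lintegral_map hF' hs, lintegral_map hF hs]
  refine Eq.trans (lintegral_congr fun x => ?_) h
  have hx : σ • (x + σ⁻¹ • m) = σ • x + m := by
    rw [smul_add, smul_smul, mul_inv_cancel₀ hσ.ne', one_smul]
  rw [shiftDensity_smul hσ, hx]

/-- Girsanov's formula for the noise of one episode. -/
theorem lintegral_episodeNoise_shift {d H : ℕ} {σ : ℝ} (hσ : 0 < σ)
    (m : (Fin H → State d) → Fin H → State d) (hm : Measurable m)
    (hadap : ∀ i x y, (∀ j < i, x j = y j) → m x i = m y i)
    (F : (Fin H → State d) → ℝ≥0∞) (hF : Measurable F) :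
    ∫⁻ ξ, F (ξ + m ξ) * ∏ i, ENNReal.ofReal (shiftDensity σ (m ξ i) (ξ i))
      ∂(episodeNoise d H σ) = ∫⁻ ξ, F ξ ∂(episodeNoise d H σ) :=
  lintegral_pi_adapted_shift (gaussianNoise d σ)
    (ρ := fun m x => ENNReal.ofReal (shiftDensity σ m x))
    (measurable_shiftDensity σ).ennreal_ofReal (lintegral_gaussianNoise_shift hσ) m hm hadap F hF

theorem map_inner_gaussianNoise {d : ℕ} {σ : ℝ} (hσ : 0 < σ) {v : State d} (hv : ‖v‖ = 1) :
    (gaussianNoise d σ).map (fun z => inner ℝ v z / σ) = gaussianReal 0 1 := by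
  have hs : Measurable fun z : State d => σ • z := measurable_const_smul σ
  rw [gaussianNoise, Measure.map_map (by fun_prop) hs]
  have : (fun z : State d => inner ℝ v z / σ) ∘ (fun z => σ • z) = innerSL ℝ v := by
    ext z
    simp [inner_smul_right, hσ.ne']
  rw [this, IsGaussian.map_eq_gaussianReal, integral_strongDual_stdGaussian,
    variance_dual_stdGaussian, innerSL_apply_norm, hv]
  simp

theorem map_neg_gaussianNoise (d : ℕ) (σ : ℝ) :
    (gaussianNoise d σ).map (fun z => -z) = gaussianNoise d σ := by
  have hs : Measurable fun z : State d => σ • z := measurable_const_smul σ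
  have h := stdGaussian_map (LinearIsometryEquiv.neg ℝ (E := State d))
  rw [gaussianNoise, Measure.map_map measurable_neg hs]
  conv_rhs => rw [← h, Measure.map_map hs (by fun_prop)]
  congr 1
  ext z
  simp

theorem integrable_norm_gaussianNoise (d : ℕ) (σ : ℝ) :
    Integrable (fun z => ‖z‖) (gaussianNoise d σ) := by
  have hs : Measurable fun z : State d => σ • z := measurable_const_smul σ
  rw [gaussianNoise, integrable_map_measure (by fun_prop) hs.aemeasurable]
  have : Integrable (fun z : State d => z) (stdGaussian (State d)) := IsGaussian.integrable_id
  exact (this.smul σ).norm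

/-- The standard Gaussian density times the integrand is √(1 + s) times the density of N(μ, 1 + s).
-/
theorem lintegral_exp_gaussianReal {s : ℝ} (hs : 0 ≤ s) (μ : ℝ) :
    ∫⁻ a, ENNReal.ofReal (Real.exp ((a ^ 2 - (a - μ) ^ 2 / (1 + s)) / 2)) ∂(gaussianReal 0 1) =
      ENNReal.ofReal (√(1 + s)) := by
  have h1s : 0 < 1 + s := by positivity
  have hv : (1 + s).toNNReal ≠ 0 := (Real.toNNReal_pos.2 h1s).ne'
  have h1 := lintegral_gaussianPDF_eq_one μ hv
  rw [gaussianReal_of_var_ne_zero 0 one_ne_zero,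
    lintegral_withDensity_eq_lintegral_mul _ (measurable_gaussianPDF 0 1) (by fun_prop),
    ← mul_one (ENNReal.ofReal (√(1 + s))), ← h1,
    ← lintegral_const_mul _ (measurable_gaussianPDF _ _)]
  refine lintegral_congr fun x => ?_
  simp only [Pi.mul_apply, gaussianPDF]
  rw [← ENNReal.ofReal_mul (gaussianPDFReal_nonneg _ _ _),
    ← ENNReal.ofReal_mul (Real.sqrt_nonneg _)]
  congr 1
  simp only [gaussianPDFReal, Real.coe_toNNReal _ h1s.le, NNReal.coe_one, mul_one]
  have hsq : √(1 + s) * (√(2 * Real.pi))⁻¹ * (√(1 + s))⁻¹ = (√(2 * Real.pi))⁻¹ := by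
    have : √(1 + s) ≠ 0 := (Real.sqrt_pos.2 h1s).ne'
    field_simp
  rw [mul_assoc, ← Real.exp_add, Real.sqrt_mul (by positivity) (1 + s), mul_inv, ← mul_assoc,
    ← mul_assoc, hsq]
  congr 2
  field_simp
  ring

end Gaussian

/-! ### Noise-driven paths. -/

section Path

variable {X : Type*} {H : ℕ}

/-- The path `x_{h+1} = g_h(x_h) + ξ_h` started at `x₀`. -/
def path [Add X] (g : Fin H → X → X) (x₀ : X) (ξ : Fin H → X) : Fin (H + 1) → X :=
  fun k => Fin.induction (motive := fun _ => X) x₀ (fun h x => g h x + ξ h) k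

@[simp]
theorem path_succ [Add X] (g : Fin H → X → X) (x₀ : X) (ξ : Fin H → X) (h : Fin H) :
    path g x₀ ξ h.succ = g h (path g x₀ ξ h.castSucc) + ξ h :=
  rfl

theorem path_congr [Add X] (g : Fin H → X → X) (x₀ : X) {ξ ξ' : Fin H → X} (k : Fin (H + 1))
    (h : ∀ j : Fin H, j.castSucc < k → ξ j = ξ' j) : path g x₀ ξ k = path g x₀ ξ' k := by
  induction k using Fin.induction with
  | zero => rfl
  | succ i ih =>
    rw [path_succ, path_succ, h i i.castSucc_lt_succ,
      ih fun j hj => h j (hj.trans i.castSucc_lt_succ)]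

theorem path_cons [Add X] (g : Fin (H + 1) → X → X) (x₀ a : X) (b : Fin H → X) (k : Fin (H + 1)) :
    path g x₀ (Fin.cons a b) k.succ = path (fun i => g i.succ) (g 0 x₀ + a) b k := by
  induction k using Fin.induction with
  | zero => rfl
  | succ i ih =>
    rw [path_succ, path_succ, ← ih]
    rfl

/-- At each step the added noise compensates the difference of the two drifts at the common state.
This coupling turns a change of model into an adapted shift of the noise. -/
theorem path_add_sub [AddCommGroup X] (g g' : Fin H → X → X) (x₀ : X) (ξ : Fin H → X) :
    path g' x₀ (ξ + fun h => g h (path g x₀ ξ h.castSucc) - g' h (path g x₀ ξ h.castSucc)) =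
      path g x₀ ξ := by
  funext k
  induction k using Fin.induction with
  | zero => rfl
  | succ i ih =>
    rw [path_succ, path_succ, ih, Pi.add_apply]
    abel

theorem measurable_path {α : Type*} [MeasurableSpace α] [MeasurableSpace X] [Add X]
    [MeasurableAdd₂ X] {g : α → Fin H → X → X}
    (hg : ∀ h, Measurable fun p : α × X => g p.1 h p.2) {x₀ : α → X} (hx₀ : Measurable x₀)
    {ξ : α → Fin H → X} (hξ : Measurable ξ) : Measurable fun a => path (g a) (x₀ a) (ξ a) := by
  refine measurable_pi_lambda _ fun k => ?_
  induction k using Fin.induction with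
  | zero => exact hx₀
  | succ i ih =>
    simp only [path_succ]
    exact ((hg i).comp (measurable_id.prodMk ih)).add ((measurable_pi_apply i).comp hξ)

end Path

/-! ### Measurability of the interaction; each episode is independent of its past. -/

namespace KNR

variable {d H : ℕ} {U E : Type*} [MeasurableSpace U] [NormedAddCommGroup E]
  [InnerProductSpace ℝ E] [MeasurableSpace E]

/-- The mean `x ↦ W φ(x, π(x, h))` of the transition at time `h`. -/
def drift (M : KNR d H U E) (W : E →L[ℝ] State d) (π : Policy d H U) (h : Fin H) (x : State d) :
    State d :=
  W (M.φ (x, π x h))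

theorem rollout_eq_path (M : KNR d H U E) (W : E →L[ℝ] State d) (π : Policy d H U)
    (ξ : Fin H → State d) : M.rollout W π ξ = path (M.drift W π) M.x₀ ξ :=
  rfl

/-- The features along one episode. -/
def episodeFeatures (M : KNR d H U E) (π : Policy d H U) (x : Traj d H) (h : Fin H) : E :=
  M.φ (x h.castSucc, π (x h.castSucc) h)

theorem run_eq (M : KNR d H U E) (A : Algorithm d H U) (ω : ℕ → Fin H → State d) (t : ℕ) :
    M.run A ω t = M.rollout M.Wstar (A t (M.runHist A ω t)) (ω t) := by
  rw [run]
  rfl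

theorem run_congr (M : KNR d H U E) (A : Algorithm d H U) {ω ω' : ℕ → Fin H → State d} (t : ℕ)
    (h : ∀ s ≤ t, ω s = ω' s) : M.run A ω t = M.run A ω' t := by
  induction t using Nat.strong_induction_on with
  | _ t ih =>
    rw [run_eq, run_eq, h t le_rfl]
    have : M.runHist A ω t = M.runHist A ω' t :=
      funext fun τ => ih τ τ.2 fun s hs => h s (hs.trans τ.2.le)
    rw [this]

theorem runHist_congr (M : KNR d H U E) (A : Algorithm d H U) {ω ω' : ℕ → Fin H → State d} (t : ℕ)
    (h : ∀ s < t, ω s = ω' s) : M.runHist A ω t = M.runHist A ω' t :=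
  funext fun τ => M.run_congr A τ fun s hs => h s (hs.trans_lt τ.2)

section Measurability

variable {Pol : Set (Policy d H U)} {A : Algorithm d H U} {α : Type*} [MeasurableSpace α]

theorem measurable_episodeFeatures (M : KNR d H U E) {π : α → Policy d H U}
    (hπ : ∀ h, Measurable fun p : α × State d => π p.1 p.2 h) {x : α → Traj d H}
    (hx : Measurable x) (h : Fin H) :
    Measurable fun a => M.episodeFeatures (π a) (x a) h := by
  have hxh : Measurable fun a => x a h.castSucc := (measurable_pi_apply _).comp hx
  exact M.measurable_φ.comp (hxh.prodMk ((hπ h).comp (measurable_id.prodMk hxh)))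

theorem measurable_trajCost {c : State d × U → ℝ≥0} (hc : Measurable c) {π : α → Policy d H U}
    (hπ : ∀ h, Measurable fun p : α × State d => π p.1 p.2 h) {x : α → Traj d H}
    (hx : Measurable x) : Measurable fun a => trajCost c (π a) (x a) := by
  refine Finset.measurable_sum _ fun h _ => ?_
  have hxh : Measurable fun a => x a h.castSucc := (measurable_pi_apply _).comp hx
  exact hc.comp (hxh.prodMk ((hπ h).comp (measurable_id.prodMk hxh)))

theorem measurable_features (M : KNR d H U E) (hA : IsAlgorithm Pol A) {t : ℕ}
    (i : Fin t × Fin H) : Measurable fun hist : History d H t => M.features A hist i := by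
  refine M.measurable_episodeFeatures (π := fun hist => pastPolicy A hist i.1) (fun h => ?_)
    (measurable_pi_apply i.1) i.2
  refine (hA.measurable i.1 h).comp (Measurable.prodMk ?_ measurable_snd)
  exact measurable_pi_lambda _ fun s => (measurable_pi_apply _).comp measurable_fst

variable [BorelSpace E]

theorem measurable_drift (M : KNR d H U E) (W : E →L[ℝ] State d) {π : α → Policy d H U}
    (hπ : ∀ h, Measurable fun p : α × State d => π p.1 p.2 h) (h : Fin H) :
    Measurable fun p : α × State d => M.drift W (π p.1) h p.2 :=
  W.continuous.measurable.comp (M.measurable_φ.comp (measurable_snd.prodMk (hπ h)))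

theorem measurable_rollout (M : KNR d H U E) (W : E →L[ℝ] State d) {π : α → Policy d H U}
    (hπ : ∀ h, Measurable fun p : α × State d => π p.1 p.2 h) {ξ : α → Fin H → State d}
    (hξ : Measurable ξ) : Measurable fun a => M.rollout W (π a) (ξ a) :=
  measurable_path (M.measurable_drift W hπ) measurable_const hξ

theorem measurable_run (M : KNR d H U E) (hA : IsAlgorithm Pol A) (t : ℕ) :
    Measurable fun ω => M.run A ω t := by
  induction t using Nat.strong_induction_on with
  | _ t ih =>
    simp only [run_eq]
    have hh : Measurable fun ω => M.runHist A ω t := measurable_pi_lambda _ fun τ => ih τ τ.2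
    exact M.measurable_rollout M.Wstar (π := fun ω => A t (M.runHist A ω t))
      (fun h => (hA.measurable t h).comp ((hh.comp measurable_fst).prodMk measurable_snd))
      (measurable_pi_apply t)

theorem measurable_runHist (M : KNR d H U E) (hA : IsAlgorithm Pol A) (t : ℕ) :
    Measurable fun ω => M.runHist A ω t :=
  measurable_pi_lambda _ fun τ => M.measurable_run hA τ

end Measurability

section Independence

variable [BorelSpace E] {Pol : Set (Policy d H U)} {A : Algorithm d H U}

theorem indepFun_runHist (M : KNR d H U E) (hA : IsAlgorithm Pol A) (t : ℕ) :
    IndepFun (fun ω => M.runHist A ω t) (fun ω => ω t) (fullNoise d H M.σ) := by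
  have hi : iIndepFun (fun (n : ℕ) (ω : ℕ → Fin H → State d) => ω n) (fullNoise d H M.σ) :=
    iIndepFun_infinitePi (P := fun _ : ℕ => episodeNoise d H M.σ) (X := fun _ ξ => ξ)
      fun _ => measurable_id
  have h2 := hi.indepFun_finset (Finset.range t) {t} (by simp) fun n => measurable_pi_apply n
  -- Padding the first t episodes with zeros exhibits the history as a measurable function of those
  -- coordinates, since `runHist` at t ignores the later ones.
  let ext : ((n : Finset.range t) → Fin H → State d) → ℕ → Fin H → State d :=
    fun r n => if hn : n ∈ Finset.range t then r ⟨n, hn⟩ else 0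
  have hext : Measurable ext := by
    refine measurable_pi_lambda _ fun n => ?_
    by_cases hn : n ∈ Finset.range t
    · simp only [ext, hn, dite_true]
      exact measurable_pi_apply _
    · simp only [ext, hn, dite_false]
      exact measurable_const
  have h3 := h2.comp ((M.measurable_runHist hA t).comp hext)
    (measurable_pi_apply (⟨t, Finset.mem_singleton_self t⟩ : ({t} : Finset ℕ)))
  have he : (fun ω => M.runHist A ω t) = ((fun ω => M.runHist A ω t) ∘ ext) ∘
      fun (ω : ℕ → Fin H → State d) (i : Finset.range t) => ω i := by
    funext ω
    refine M.runHist_congr A t fun s hs => ?_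
    simp [ext, hs]
  rw [he]
  exact h3

/-- Conditioning on the history in Fubini form: the noise of the current episode may be resampled.
This replaces conditional expectations throughout. -/
theorem lintegral_runHist_episode (M : KNR d H U E) (hA : IsAlgorithm Pol A) (t : ℕ)
    {g : History d H t × (Fin H → State d) → ℝ≥0∞} (hg : Measurable g) :
    ∫⁻ ω, g (M.runHist A ω t, ω t) ∂(fullNoise d H M.σ) =
      ∫⁻ ω, ∫⁻ ξ, g (M.runHist A ω t, ξ) ∂(episodeNoise d H M.σ) ∂(fullNoise d H M.σ) := by
  have : IsProbabilityMeasure (fullNoise d H M.σ) := by unfold fullNoise; infer_instance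
  have hr := M.measurable_runHist hA t
  have ht : Measurable fun ω : ℕ → Fin H → State d => ω t := measurable_pi_apply t
  have hm : (fullNoise d H M.σ).map (fun ω => ω t) = episodeNoise d H M.σ :=
    Measure.infinitePi_map_eval _ t
  have h := (indepFun_iff_map_prod_eq_prod_map_map hr.aemeasurable ht.aemeasurable).1
    (M.indepFun_runHist hA t)
  rw [hm] at h
  rw [← lintegral_map hg (hr.prodMk ht), h, lintegral_prod _ hg.aemeasurable,
    lintegral_map hg.lintegral_prod_right' hr]

end Independence

end KNR

/-! ### The Gaussian mixture martingale. -/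

section SelfNormalized

variable {E ι κ α : Type*} [NormedAddCommGroup E] [InnerProductSpace ℝ E] [Fintype ι] [Fintype κ]
  [DecidableEq ι] [DecidableEq κ] [MeasurableSpace α]

theorem measurable_matrix_det {A : α → Matrix ι ι ℝ} (hA : ∀ i j, Measurable fun a => A a i j) :
    Measurable fun a => (A a).det := by
  simp only [Matrix.det_apply]
  exact Finset.measurable_sum _ fun p _ =>
    (Finset.measurable_prod _ fun i _ => hA _ _).const_smul (Equiv.Perm.sign p)

theorem measurable_matrix_inv {A : α → Matrix ι ι ℝ} (hA : ∀ i j, Measurable fun a => A a i j)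
    (i j : ι) : Measurable fun a => (A a)⁻¹ i j := by
  simp only [Matrix.inv_def, Matrix.smul_apply, Ring.inverse_eq_inv', smul_eq_mul,
    Matrix.adjugate_apply]
  refine (measurable_matrix_det hA).inv.mul (measurable_matrix_det fun k l => ?_)
  simp only [Matrix.updateRow_apply]
  split_ifs
  · exact measurable_const
  · exact hA k l

section Measurability

variable [MeasurableSpace E] [BorelSpace E] [SecondCountableTopology E]

theorem measurable_one_add_gram {ι : Type*} [DecidableEq ι] (lam : ℝ) {f : α → ι → E}
    (hf : ∀ i, Measurable fun a => f a i) (i j : ι) :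
    Measurable fun a => (1 + lam⁻¹ • Matrix.gram ℝ (f a)) i j := by
  simp only [Matrix.add_apply, Matrix.smul_apply, Matrix.gram_apply, smul_eq_mul]
  exact measurable_const.add (((hf i).inner (hf j)).const_mul _)

theorem measurable_detRatio (lam : ℝ) {f : α → ι → E} (hf : ∀ i, Measurable fun a => f a i) :
    Measurable fun a => detRatio lam (f a) :=
  measurable_matrix_det (measurable_one_add_gram lam hf)

theorem measurable_selfNormSq [CompleteSpace E] {lam : ℝ} (hlam : 0 < lam) {f : α → ι → E}
    (hf : ∀ i, Measurable fun a => f a i) {y : α → ι → ℝ} (hy : ∀ i, Measurable fun a => y a i) :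
    Measurable fun a => selfNormSq lam (f a) (y a) := by
  simp only [selfNormSq_eq hlam, dotProduct, Matrix.mulVec]
  refine (Finset.measurable_sum _ fun i _ => (hy i).mul (hy i)).sub
    (Finset.measurable_sum _ fun i _ => (hy i).mul (Finset.measurable_sum _ fun j _ => ?_))
  exact (measurable_matrix_inv (measurable_one_add_gram lam hf) i j).mul (hy j)

end Measurability

/-- The Gaussian likelihood ratio `exp (½ ‖∑ᵢ yᵢ fᵢ‖²_{Σ⁻¹}) / √(det Σ / det (λ I))` between the
Bayesian linear model with features `fᵢ` and pure noise. -/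
noncomputable def mixtureRatio (lam : ℝ) (f : ι → E) (y : ι → ℝ) : ℝ≥0∞ :=
  ENNReal.ofReal (Real.exp (selfNormSq lam f y / 2) / √(detRatio lam f))

theorem mixtureRatio_comp_equiv (lam : ℝ) (f : ι → E) (y : ι → ℝ) (e : κ ≃ ι) :
    mixtureRatio lam (f ∘ e) (y ∘ e) = mixtureRatio lam f y := by
  rw [mixtureRatio, mixtureRatio, selfNormSq_comp_equiv, detRatio_comp_equiv]

theorem measurable_mixtureRatio [CompleteSpace E] [MeasurableSpace E] [BorelSpace E]
    [SecondCountableTopology E] {lam : ℝ} (hlam : 0 < lam) {f : α → ι → E}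
    (hf : ∀ i, Measurable fun a => f a i) {y : α → ι → ℝ} (hy : ∀ i, Measurable fun a => y a i) :
    Measurable fun a => mixtureRatio lam (f a) (y a) :=
  (((measurable_selfNormSq hlam hf hy).div_const 2).exp.div
    (measurable_detRatio lam hf).sqrt).ennreal_ofReal

variable [CompleteSpace E]

/-- One martingale step: by the rank-one updates of exponent and determinant, the new factor is the
density ratio of N(μ, 1 + s) to N(0, 1), evaluated at a standard Gaussian variable. -/
theorem lintegral_mixtureRatio_unit {lam : ℝ} (hlam : 0 < lam) {d : ℕ} {σ : ℝ} (hσ : 0 < σ)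
    {v : State d} (hv : ‖v‖ = 1) (f : ι → E) (y : ι → ℝ) (g : E) :
    ∫⁻ z, mixtureRatio lam (Sum.elim f fun _ : Unit => g)
        (Sum.elim y fun _ => inner ℝ v z / σ) ∂(gaussianNoise d σ) = mixtureRatio lam f y := by
  set s := inner ℝ g (regInv lam f g) with hs
  set μ := inner ℝ g (regInv lam f (∑ i, y i • f i)) with hμ
  have hs0 : 0 ≤ s := inner_regInv_self_nonneg hlam f g
  have h1s : 0 < 1 + s := by positivity
  have hfac : ∀ a : ℝ, mixtureRatio lam (Sum.elim f fun _ : Unit => g) (Sum.elim y fun _ => a) =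
      mixtureRatio lam f y * ENNReal.ofReal (√(1 + s))⁻¹ *
        ENNReal.ofReal (Real.exp ((a ^ 2 - (a - μ) ^ 2 / (1 + s)) / 2)) := by
    intro a
    have hD := detRatio_pos hlam f
    rw [mixtureRatio, mixtureRatio, selfNormSq_sumElim_unit hlam, detRatio_sumElim_unit hlam,
      ← hs, ← hμ, ← ENNReal.ofReal_mul (by positivity), ← ENNReal.ofReal_mul (by positivity)]
    congr 1
    rw [add_div, Real.exp_add, Real.sqrt_mul hD.le]
    field_simp
  have hmeas : Measurable fun z : State d => inner ℝ v z / σ := by fun_prop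
  simp only [hfac]
  rw [lintegral_const_mul _ (by fun_prop)]
  have h := lintegral_map (μ := gaussianNoise d σ)
    (f := fun a => ENNReal.ofReal (Real.exp ((a ^ 2 - (a - μ) ^ 2 / (1 + s)) / 2)))
    (by fun_prop) hmeas
  rw [map_inner_gaussianNoise hσ hv, lintegral_exp_gaussianReal hs0 μ] at h
  rw [← h, mul_assoc, ← ENNReal.ofReal_mul (by positivity),
    inv_mul_cancel₀ (Real.sqrt_pos.2 h1s).ne', ENNReal.ofReal_one, mul_one]

/-- The mixture ratio is a martingale along an episode. -/
theorem lintegral_mixtureRatio_path [MeasurableSpace E] [BorelSpace E] [SecondCountableTopology E]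
    {lam : ℝ} (hlam : 0 < lam) {d : ℕ} {σ : ℝ} (hσ : 0 < σ) {v : State d} (hv : ‖v‖ = 1) {n : ℕ} :
    ∀ {ι : Type} [Fintype ι] [DecidableEq ι] (f : ι → E) (y : ι → ℝ) (ψ : Fin n → State d → E)
      (_ : ∀ h, Measurable (ψ h)) (g : Fin n → State d → State d) (_ : ∀ h, Measurable (g h))
      (x₀ : State d),
      ∫⁻ ξ, mixtureRatio lam (Sum.elim f fun h => ψ h (path g x₀ ξ h.castSucc))
        (Sum.elim y fun h => inner ℝ v (ξ h) / σ) ∂(Measure.pi fun _ => gaussianNoise d σ) =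
        mixtureRatio lam f y := by
  induction n with
  | zero =>
    intro ι _ _ f y ψ _ g _ x₀
    have : ∀ ξ : Fin 0 → State d, mixtureRatio lam
        (Sum.elim f fun h => ψ h (path g x₀ ξ h.castSucc))
        (Sum.elim y fun h => inner ℝ v (ξ h) / σ) = mixtureRatio lam f y := by
      intro ξ
      rw [← mixtureRatio_comp_equiv _ _ _ (Equiv.sumEmpty ι (Fin 0)).symm]
      rfl
    simp only [this, lintegral_const, measure_univ, mul_one]
  | succ n ih =>
    intro ι _ _ f y ψ hψ g hg x₀
    -- The first transition of the episode is moved into the past, so that induction applies to the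
    -- remaining ones with index set ι ⊕ Unit.
    let e₀ : (ι ⊕ Unit) ⊕ Fin n → ι ⊕ Fin (n + 1) :=
      Sum.elim (Sum.elim Sum.inl fun _ => Sum.inr 0) fun h => Sum.inr h.succ
    have he₀ : Function.Bijective e₀ := by
      constructor
      · rintro ((i | i) | i) ((j | j) | j) hij <;>
          simp_all [e₀, Fin.succ_ne_zero, (Fin.succ_ne_zero _).symm]
      · rintro (i | i)
        · exact ⟨Sum.inl (Sum.inl i), rfl⟩
        · refine Fin.cases ?_ (fun j => ?_) i
          · exact ⟨Sum.inl (Sum.inr ()), rfl⟩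
          · exact ⟨Sum.inr j, rfl⟩
    let e := Equiv.ofBijective e₀ he₀
    have hre : ∀ a b, mixtureRatio lam
        (Sum.elim f fun h => ψ h (path g x₀ (Fin.cons a b) h.castSucc))
        (Sum.elim y fun h => inner ℝ v ((Fin.cons a b : Fin (n + 1) → State d) h) / σ) =
        mixtureRatio lam
          (Sum.elim (Sum.elim f fun _ : Unit => ψ 0 x₀)
            fun h => ψ h.succ (path (fun i => g i.succ) (g 0 x₀ + a) b h.castSucc))
          (Sum.elim (Sum.elim y fun _ => inner ℝ v a / σ) fun h => inner ℝ v (b h) / σ) := by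
      intro a b
      rw [← mixtureRatio_comp_equiv _ _ _ e]
      congr 1
      · funext i
        rcases i with (i | i) | i
        · rfl
        · rfl
        · change ψ i.succ (path g x₀ (Fin.cons a b) i.castSucc.succ) = _
          rw [path_cons]
          rfl
      · funext i
        rcases i with (i | i) | i <;> rfl
    have hmeas : Measurable fun ξ : Fin (n + 1) → State d => mixtureRatio lam
        (Sum.elim f fun h => ψ h (path g x₀ ξ h.castSucc))
        (Sum.elim y fun h => inner ℝ v (ξ h) / σ) := by
      have hp : Measurable fun ξ : Fin (n + 1) → State d => path g x₀ ξ :=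
        measurable_path (g := fun _ => g) (fun h => (hg h).comp measurable_snd) measurable_const
          measurable_id
      refine measurable_mixtureRatio hlam ?_ ?_
      · rintro (i | i)
        · exact measurable_const
        · exact (hψ i).comp ((measurable_pi_apply i.castSucc).comp hp)
      · rintro (i | i)
        · exact measurable_const
        · simp only [Sum.elim_inr]
          fun_prop
    rw [lintegral_pi_succ _ hmeas]
    simp only [hre]
    have hin : ∀ a, ∫⁻ b, mixtureRatio lam
        (Sum.elim (Sum.elim f fun _ : Unit => ψ 0 x₀)
          fun h => ψ h.succ (path (fun i => g i.succ) (g 0 x₀ + a) b h.castSucc))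
        (Sum.elim (Sum.elim y fun _ => inner ℝ v a / σ) fun h => inner ℝ v (b h) / σ)
          ∂(Measure.pi fun _ => gaussianNoise d σ) =
        mixtureRatio lam (Sum.elim f fun _ : Unit => ψ 0 x₀)
          (Sum.elim y fun _ => inner ℝ v a / σ) := fun a =>
      ih _ _ (fun h => ψ h.succ) (fun h => hψ h.succ) (fun h => g h.succ) (fun h => hg h.succ) _
    simp only [hin]
    exact lintegral_mixtureRatio_unit hlam hσ hv f y (ψ 0 x₀)

end SelfNormalized

/-! ### The martingale along the episodes, and its average over directions. -/

namespace KNR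

variable {d H : ℕ} {U E : Type*} [MeasurableSpace U] [NormedAddCommGroup E]
  [InnerProductSpace ℝ E] [MeasurableSpace E]

/-- The noise of the observed transitions. -/
def resid (M : KNR d H U E) (A : Algorithm d H U) {t : ℕ} (hist : History d H t)
    (i : Fin t × Fin H) : State d :=
  hist i.1 i.2.succ - M.Wstar (M.features A hist i)

theorem resid_runHist (M : KNR d H U E) (A : Algorithm d H U) (ω : ℕ → Fin H → State d) (t : ℕ)
    (i : Fin t × Fin H) : M.resid A (M.runHist A ω t) i = ω i.1 i.2 := by
  have h : M.runHist A ω t i.1 i.2.succ =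
      M.Wstar (M.features A (M.runHist A ω t) i) + ω i.1 i.2 := by
    have h1 : M.runHist A ω t i.1 =
        path (M.drift M.Wstar (A i.1 (M.runHist A ω i.1))) M.x₀ (ω i.1) := by
      rw [← rollout_eq_path, ← run_eq]
      rfl
    rw [features, h1, path_succ]
    rfl
  rw [resid, h, add_sub_cancel_left]

/-- The index set of `t + 1` episodes, with the last episode split off. -/
noncomputable def episodeEquiv (t H : ℕ) : (Fin t × Fin H) ⊕ Fin H ≃ Fin (t + 1) × Fin H :=
  Equiv.ofBijective (Sum.elim (fun i => (i.1.castSucc, i.2)) fun h => (Fin.last t, h)) (by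
    constructor
    · rintro (⟨i, i'⟩ | i) (⟨j, j'⟩ | j) hij
      · simp_all
      · simp only [Sum.elim_inl, Sum.elim_inr, Prod.mk.injEq] at hij
        exact absurd hij.1 (Fin.castSucc_lt_last i).ne
      · simp only [Sum.elim_inl, Sum.elim_inr, Prod.mk.injEq] at hij
        exact absurd hij.1.symm (Fin.castSucc_lt_last j).ne
      · simp_all
    · rintro ⟨i, h⟩
      refine Fin.lastCases ?_ (fun j => ?_) i
      · exact ⟨Sum.inr h, rfl⟩
      · exact ⟨Sum.inl (j, h), rfl⟩)

theorem features_succ (M : KNR d H U E) (A : Algorithm d H U) (ω : ℕ → Fin H → State d) (t : ℕ) :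
    M.features A (M.runHist A ω (t + 1)) ∘ episodeEquiv t H =
      Sum.elim (M.features A (M.runHist A ω t))
        (M.episodeFeatures (A t (M.runHist A ω t)) (M.run A ω t)) := by
  funext i
  rcases i with i | i <;> rfl

/-- The mixture ratio of the noise in direction `v`. -/
noncomputable def dirRatio (M : KNR d H U E) (lam : ℝ) (A : Algorithm d H U) {t : ℕ}
    (hist : History d H t) (v : State d) : ℝ≥0∞ :=
  mixtureRatio lam (M.features A hist) fun i => inner ℝ v (M.resid A hist i) / M.σ

variable [BorelSpace E] {Pol : Set (Policy d H U)} {A : Algorithm d H U} {lam : ℝ}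

theorem measurable_resid (M : KNR d H U E) (hA : IsAlgorithm Pol A) {t : ℕ}
    (i : Fin t × Fin H) : Measurable fun hist : History d H t => M.resid A hist i := by
  refine Measurable.sub ?_ (M.Wstar.continuous.measurable.comp (M.measurable_features hA i))
  exact (measurable_pi_apply i.2.succ).comp (measurable_pi_apply i.1)

variable [CompleteSpace E] [SecondCountableTopology E]

theorem measurable_dirRatio (M : KNR d H U E) (hlam : 0 < lam) (hA : IsAlgorithm Pol A) {t : ℕ} :
    Measurable fun p : History d H t × State d => M.dirRatio lam A p.1 p.2 := by
  refine measurable_mixtureRatio hlam (fun i => (M.measurable_features hA i).comp measurable_fst)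
    fun i => ?_
  exact (measurable_snd.inner ((M.measurable_resid hA i).comp measurable_fst)).div_const _

theorem lintegral_dirRatio (M : KNR d H U E) (hlam : 0 < lam) (hA : IsAlgorithm Pol A)
    {v : State d} (hv : ‖v‖ = 1) (t : ℕ) :
    ∫⁻ ω, M.dirRatio lam A (M.runHist A ω t) v ∂(fullNoise d H M.σ) = 1 := by
  have : IsProbabilityMeasure (fullNoise d H M.σ) := by unfold fullNoise; infer_instance
  induction t with
  | zero =>
    have : ∀ ω, M.dirRatio lam A (M.runHist A ω 0) v = 1 := by
      intro ω
      simp [dirRatio, mixtureRatio, selfNormSq, detRatio]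
    simp only [this, lintegral_const, measure_univ, mul_one]
  | succ t ih =>
    have hst : ∀ ω, M.dirRatio lam A (M.runHist A ω (t + 1)) v =
        (fun p : History d H t × (Fin H → State d) =>
          mixtureRatio lam (Sum.elim (M.features A p.1)
            (M.episodeFeatures (A t p.1) (M.rollout M.Wstar (A t p.1) p.2)))
          (Sum.elim (fun i => inner ℝ v (M.resid A p.1 i) / M.σ)
            fun h => inner ℝ v (p.2 h) / M.σ)) (M.runHist A ω t, ω t) := by
      intro ω
      rw [dirRatio, ← mixtureRatio_comp_equiv _ _ _ (episodeEquiv t H), features_succ, run_eq]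
      congr 1
      funext i
      rcases i with i | i
      · simp only [Function.comp_apply, resid_runHist, Sum.elim_inl]
        rfl
      · simp only [Function.comp_apply, resid_runHist, Sum.elim_inr]
        rfl
    have hπ : ∀ h, Measurable fun p : (History d H t × (Fin H → State d)) × State d =>
        A t p.1.1 p.2 h := fun h =>
      (hA.measurable t h).comp ((measurable_fst.comp measurable_fst).prodMk measurable_snd)
    have hroll : Measurable fun p : History d H t × (Fin H → State d) =>
        M.rollout M.Wstar (A t p.1) p.2 := M.measurable_rollout M.Wstar hπ measurable_snd
    have hmeas : Measurable (fun p : History d H t × (Fin H → State d) =>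
          mixtureRatio lam (Sum.elim (M.features A p.1)
            (M.episodeFeatures (A t p.1) (M.rollout M.Wstar (A t p.1) p.2)))
          (Sum.elim (fun i => inner ℝ v (M.resid A p.1 i) / M.σ)
            fun h => inner ℝ v (p.2 h) / M.σ)) := by
      refine measurable_mixtureRatio hlam ?_ ?_
      · rintro (i | i)
        · exact (M.measurable_features hA i).comp measurable_fst
        · exact M.measurable_episodeFeatures hπ hroll i
      · rintro (i | i)
        · exact (measurable_const.inner ((M.measurable_resid hA i).comp measurable_fst)).div_const _
        · exact (measurable_const.inner
            ((measurable_pi_apply i).comp measurable_snd)).div_const _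
    simp only [hst]
    -- Given the history, the mixture ratio integrates over the new episode to its previous value.
    rw [M.lintegral_runHist_episode hA t hmeas, ← ih]
    refine lintegral_congr fun ω => ?_
    have hπ' : ∀ h, Measurable fun x => A t (M.runHist A ω t) x h := fun h =>
      (hA.measurable t h).comp (measurable_const.prodMk measurable_id)
    exact lintegral_mixtureRatio_path hlam M.σ_pos hv (M.features A (M.runHist A ω t))
      (fun i => inner ℝ v (M.resid A (M.runHist A ω t) i) / M.σ)
      (fun h x => M.φ (x, A t (M.runHist A ω t) x h))
      (fun h => M.measurable_φ.comp (measurable_id.prodMk (hπ' h)))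
      (M.drift M.Wstar (A t (M.runHist A ω t)))
      (fun h => M.Wstar.continuous.measurable.comp
        (M.measurable_φ.comp (measurable_id.prodMk (hπ' h)))) M.x₀

/-- Normalization sends the zero vector to itself, where the exponent vanishes and the ratio is at
most 1 because the determinant is at least 1. The bound thus needs no exceptional point, even for d
= 0. -/
theorem lintegral_dirRatio_normalize_le (M : KNR d H U E) (hlam : 0 < lam)
    (hA : IsAlgorithm Pol A) (v : State d) (t : ℕ) :
    ∫⁻ ω, M.dirRatio lam A (M.runHist A ω t) (‖v‖⁻¹ • v) ∂(fullNoise d H M.σ) ≤ 1 := by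
  have : IsProbabilityMeasure (fullNoise d H M.σ) := by unfold fullNoise; infer_instance
  by_cases hv : v = 0
  · have h1 : ∀ ω, M.dirRatio lam A (M.runHist A ω t) (‖v‖⁻¹ • v) ≤ 1 := by
      intro ω
      rw [dirRatio, mixtureRatio, ENNReal.ofReal_le_one]
      have hD := one_le_detRatio hlam (M.features A (M.runHist A ω t))
      have : 1 ≤ √(detRatio lam (M.features A (M.runHist A ω t))) := Real.one_le_sqrt.2 hD
      simp only [hv, smul_zero, inner_zero_left, zero_div, selfNormSq, zero_smul,
        Finset.sum_const_zero, map_zero, Real.exp_zero]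
      rw [div_le_one (by positivity)]
      exact this
    calc _ ≤ ∫⁻ _, 1 ∂(fullNoise d H M.σ) := lintegral_mono h1
      _ = 1 := by simp
  · refine (M.lintegral_dirRatio hlam hA ?_ t).le
    rw [norm_smul, norm_inv, norm_norm, inv_mul_cancel₀ (norm_ne_zero_iff.2 hv)]

theorem measurable_normalize (d : ℕ) : Measurable fun v : State d => ‖v‖⁻¹ • v := by
  fun_prop

theorem measurable_prodMk_normalize {α β : Type*} [MeasurableSpace α] [MeasurableSpace β]
    {f : α → β} (hf : Measurable f) :
    Measurable fun p : α × State d => (f p.1, ‖p.2‖⁻¹ • p.2) :=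
  (hf.comp measurable_fst).prodMk ((measurable_normalize d).comp measurable_snd)

theorem measurable_dirRatio_normalize (M : KNR d H U E) (hlam : 0 < lam)
    (hA : IsAlgorithm Pol A) {t : ℕ} {α : Type*} [MeasurableSpace α] {hist : α → History d H t}
    (hh : Measurable hist) :
    Measurable fun p : α × State d => M.dirRatio lam A (hist p.1) (‖p.2‖⁻¹ • p.2) := by
  have h := (M.measurable_dirRatio hlam hA).comp (measurable_prodMk_normalize hh)
  exact h

/-- The mixture ratio averaged over the directions. -/
noncomputable def meanRatio (M : KNR d H U E) (lam : ℝ) (A : Algorithm d H U) {t : ℕ}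
    (hist : History d H t) : ℝ≥0∞ :=
  (∫⁻ v in Metric.ball (0 : State d) 1, M.dirRatio lam A hist (‖v‖⁻¹ • v)) /
    volume (Metric.ball (0 : State d) 1)

theorem measurable_meanRatio (M : KNR d H U E) (hlam : 0 < lam) (hA : IsAlgorithm Pol A) {t : ℕ} :
    Measurable fun hist : History d H t => M.meanRatio lam A hist := by
  have h : Measurable fun p : History d H t × State d =>
      M.dirRatio lam A p.1 (‖p.2‖⁻¹ • p.2) :=
    M.measurable_dirRatio_normalize hlam hA (hist := fun hist => hist) measurable_id
  exact h.lintegral_prod_right'.div_const _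

/-- Tonelli: the noise is integrated first, for a fixed direction. The average then yields one event
that serves all directions, without a net on the sphere. -/
theorem lintegral_meanRatio_le (M : KNR d H U E) (hlam : 0 < lam) (hA : IsAlgorithm Pol A)
    (t : ℕ) : ∫⁻ ω, M.meanRatio lam A (M.runHist A ω t) ∂(fullNoise d H M.σ) ≤ 1 := by
  have : IsProbabilityMeasure (fullNoise d H M.σ) := by unfold fullNoise; infer_instance
  have h : Measurable fun p : (ℕ → Fin H → State d) × State d =>
      M.dirRatio lam A (M.runHist A p.1 t) (‖p.2‖⁻¹ • p.2) :=
    M.measurable_dirRatio_normalize hlam hA (hist := fun ω => M.runHist A ω t)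
      (M.measurable_runHist hA t)
  simp only [meanRatio, div_eq_mul_inv]
  rw [lintegral_mul_const _ h.lintegral_prod_right', lintegral_lintegral_swap h.aemeasurable,
    ← div_eq_mul_inv]
  refine ENNReal.div_le_of_le_mul ?_
  rw [one_mul]
  calc _ ≤ ∫⁻ _ in Metric.ball (0 : State d) 1, 1 :=
        lintegral_mono fun v => M.lintegral_dirRatio_normalize_le hlam hA v t
    _ = _ := by simp

theorem measure_meanRatio_le (M : KNR d H U E) (hlam : 0 < lam) (hA : IsAlgorithm Pol A)
    (t : ℕ) {K : ℝ≥0∞} (hK : K ≠ 0) (hK' : K ≠ ⊤) :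
    fullNoise d H M.σ {ω | K ≤ M.meanRatio lam A (M.runHist A ω t)} ≤ K⁻¹ := by
  have h : Measurable fun ω => M.meanRatio lam A (M.runHist A ω t) :=
    (M.measurable_meanRatio hlam hA).comp (M.measurable_runHist hA t)
  refine (meas_ge_le_lintegral_div h.aemeasurable hK hK').trans ?_
  rw [← one_div]
  exact ENNReal.div_le_div_right (M.lintegral_meanRatio_le hlam hA t) K

end KNR

/-! ### From an average over directions to every direction. -/

section Directions

variable {E ι : Type*} [NormedAddCommGroup E] [InnerProductSpace ℝ E] [Fintype ι]

theorem selfNormSq_smul (lam : ℝ) (f : ι → E) (s : ℝ) (y : ι → ℝ) :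
    selfNormSq lam f (fun i => s * y i) = s ^ 2 * selfNormSq lam f y := by
  have : ∑ i, (s * y i) • f i = s • ∑ i, y i • f i := by
    rw [Finset.smul_sum]
    exact Finset.sum_congr rfl fun i _ => mul_smul _ _ _
  rw [selfNormSq, this, map_smul, inner_smul_left, inner_smul_right, selfNormSq,
    RCLike.conj_to_real]
  ring

theorem selfNormSq_add_sub (lam : ℝ) (f : ι → E) (y z : ι → ℝ) :
    selfNormSq lam f (y + z) + selfNormSq lam f (y - z) =
      2 * (selfNormSq lam f y + selfNormSq lam f z) := by
  have h1 : ∑ i, (y + z) i • f i = ∑ i, y i • f i + ∑ i, z i • f i := by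
    rw [← Finset.sum_add_distrib]
    exact Finset.sum_congr rfl fun i _ => add_smul _ _ _
  have h2 : ∑ i, (y - z) i • f i = ∑ i, y i • f i - ∑ i, z i • f i := by
    rw [← Finset.sum_sub_distrib]
    exact Finset.sum_congr rfl fun i _ => sub_smul _ _ _
  simp only [selfNormSq, h1, h2, map_add, map_sub, inner_add_left, inner_add_right,
    inner_sub_left, inner_sub_right]
  ring

variable [CompleteSpace E] {lam : ℝ}

theorem selfNormSq_nonneg (hlam : 0 < lam) (f : ι → E) (y : ι → ℝ) : 0 ≤ selfNormSq lam f y :=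
  inner_regInv_self_nonneg hlam f _

/-- A bound on the mean over the unit ball of the exponential of a quadratic form bounds the form
on unit vectors. -/
theorem le_of_mean_exp_le {d : ℕ} {q : State d → ℝ} (hqm : Measurable q) (hq0 : ∀ v, 0 ≤ q v)
    (hq2 : ∀ (s : ℝ) v, q (s • v) = s ^ 2 * q v)
    (hpar : ∀ v w, q (v + w) + q (v - w) = 2 * (q v + q w)) {K : ℝ}
    (hK : (∫⁻ v in Metric.ball (0 : State d) 1, ENNReal.ofReal (Real.exp (q (‖v‖⁻¹ • v) / 2))) /
      volume (Metric.ball (0 : State d) 1) ≤ ENNReal.ofReal K) {u : State d} (hu : ‖u‖ = 1) :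
    q u ≤ 8 * (Real.log K + d) := by
  set B := Metric.ball (0 : State d) 1
  set B' := Metric.ball (0 : State d) (1 / 2)
  have hB0 : volume B ≠ 0 := (Metric.measure_ball_pos _ _ one_pos).ne'
  have hBt : volume B ≠ ⊤ := measure_ball_lt_top.ne
  have hvol : volume B' = ENNReal.ofReal ((1 / 2) ^ d) * volume B := by
    have := Measure.addHaar_ball_mul_of_pos (volume : Measure (State d)) 0 (r := 1 / 2)
      (by norm_num) 1
    simpa [B, B'] using this
  let φ : State d → ℝ≥0∞ := fun w => ENNReal.ofReal (Real.exp (q ((1 / 2 : ℝ) • u + w) / 2))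
  have hφ : Measurable φ := by fun_prop
  -- Inside the unit ball, normalizing only enlarges the form, so the hypothesis also bounds the
  -- average of exp(q(v)/2).
  have hnorm : ∀ v ∈ B, q v ≤ q (‖v‖⁻¹ • v) := by
    intro v hv
    rw [hq2]
    by_cases h0 : v = 0
    · have : q v = 0 := by simpa [h0] using hq2 0 v
      rw [this, mul_zero]
    · have h1 : ‖v‖ < 1 := by simpa [B] using hv
      have h2 : 0 < ‖v‖ := norm_pos_iff.2 h0
      have : 1 ≤ ‖v‖⁻¹ := (one_le_inv₀ h2).2 h1.le
      exact le_mul_of_one_le_left (hq0 v) (one_le_pow₀ this)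
  -- The ball of radius 1/2 around u/2 lies in the unit ball.
  have hstep1 : ∫⁻ w in B', φ w ≤
      ∫⁻ v in B, ENNReal.ofReal (Real.exp (q (‖v‖⁻¹ • v) / 2)) := by
    have hsub : ∀ w ∈ B', (1 / 2 : ℝ) • u + w ∈ B := by
      intro w hw
      have hw' : ‖w‖ < 1 / 2 := by simpa [B'] using hw
      have : ‖(1 / 2 : ℝ) • u + w‖ ≤ 1 / 2 + ‖w‖ := by
        refine (norm_add_le _ _).trans ?_
        rw [norm_smul, hu]
        norm_num
      simp only [B, mem_ball_zero_iff]
      linarith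
    have hBm : MeasurableSet B := measurableSet_ball
    have hBm' : MeasurableSet B' := measurableSet_ball
    rw [← lintegral_indicator hBm, ← lintegral_indicator hBm',
      ← lintegral_add_left_eq_self (μ := volume)
        (B.indicator fun v => ENNReal.ofReal (Real.exp (q (‖v‖⁻¹ • v) / 2))) ((1 / 2 : ℝ) • u)]
    refine lintegral_mono fun w => ?_
    by_cases hw : w ∈ B'
    swap
    · rw [Set.indicator_of_notMem hw]
      exact zero_le
    rw [Set.indicator_of_mem hw, Set.indicator_of_mem (hsub w hw)]
    exact ENNReal.ofReal_le_ofReal (Real.exp_le_exp.2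
      (div_le_div_of_nonneg_right (hnorm _ (hsub w hw)) two_pos.le))
  have hneg : ∫⁻ w in B', φ (-w) = ∫⁻ w in B', φ w := by
    have hBm' : MeasurableSet B' := measurableSet_ball
    rw [← lintegral_indicator hBm', ← lintegral_indicator hBm',
      ← lintegral_neg_eq_self (μ := volume) (B'.indicator φ)]
    refine lintegral_congr fun w => ?_
    simp [Set.indicator, B']
  -- Averaging over w and -w: the parallelogram identity bounds the mean of the two values of q
  -- below by q(u/2) = q(u)/4, and the arithmetic-geometric mean inequality passes this to the
  -- exponentials.
  have hstep2 : 2 * (ENNReal.ofReal (Real.exp (q u / 8)) * volume B') ≤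
      2 * ∫⁻ w in B', φ w := by
    have hrhs : 2 * ∫⁻ w in B', φ w = ∫⁻ w in B', (φ w + φ (-w)) := by
      rw [lintegral_add_left hφ, hneg, two_mul]
    rw [hrhs, ← mul_assoc, ← setLIntegral_const]
    refine lintegral_mono fun w => ?_
    have h2 : ∀ e : ℝ, 2 * ENNReal.ofReal e = ENNReal.ofReal (2 * e) := fun e => by
      rw [ENNReal.ofReal_mul two_pos.le, ENNReal.ofReal_ofNat]
    simp only [φ]
    rw [h2, ← ENNReal.ofReal_add (Real.exp_pos _).le (Real.exp_pos _).le]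
    refine ENNReal.ofReal_le_ofReal ?_
    have hp := hpar ((1 / 2 : ℝ) • u) w
    rw [hq2, sub_eq_add_neg] at hp
    set a := q ((1 / 2 : ℝ) • u + w)
    set b := q ((1 / 2 : ℝ) • u + -w)
    have h1 : q u / 4 ≤ (a + b) / 2 := by
      have := hq0 w
      linarith
    have h3 : Real.exp (q u / 8) ≤ Real.exp (a / 4) * Real.exp (b / 4) := by
      rw [← Real.exp_add]
      exact Real.exp_le_exp.2 (by linarith)
    have h4 : Real.exp (a / 2) = Real.exp (a / 4) ^ 2 := by
      rw [← Real.exp_nat_mul]; congr 1; push_cast; ring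
    have h5 : Real.exp (b / 2) = Real.exp (b / 4) ^ 2 := by
      rw [← Real.exp_nat_mul]; congr 1; push_cast; ring
    rw [h4, h5]
    nlinarith [sq_nonneg (Real.exp (a / 4) - Real.exp (b / 4))]
  -- The volume ratio (1/2)^d of the two balls costs d log 2 ≤ d in the exponent.
  have hstep3 : ENNReal.ofReal (Real.exp (q u / 8) * (1 / 2) ^ d) ≤ ENNReal.ofReal K := by
    have h := (ENNReal.mul_le_mul_iff_right (by norm_num) (by norm_num)).1 hstep2
    have h' := h.trans hstep1
    rw [hvol, ← mul_assoc, ← ENNReal.ofReal_mul (Real.exp_pos _).le] at h'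
    exact ((ENNReal.le_div_iff_mul_le (Or.inl hB0) (Or.inl hBt)).2 h').trans hK
  have hpos : 0 < Real.exp (q u / 8) * (1 / 2) ^ d := by positivity
  have hKpos : 0 < K := by
    by_contra hcon
    rw [ENNReal.ofReal_of_nonpos (not_lt.1 hcon), nonpos_iff_eq_zero,
      ENNReal.ofReal_eq_zero] at hstep3
    linarith
  have hle := (ENNReal.ofReal_le_ofReal_iff hKpos.le).1 hstep3
  have hlog := Real.log_le_log hpos hle
  rw [Real.log_mul (Real.exp_pos _).ne' (by positivity), Real.log_exp, Real.log_pow, one_div,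
    Real.log_inv] at hlog
  have hl2 : Real.log 2 ≤ 1 := by
    have := Real.log_le_sub_one_of_pos (zero_lt_two' ℝ)
    linarith
  have hd : (d : ℝ) * Real.log 2 ≤ d := mul_le_of_le_one_right (Nat.cast_nonneg d) hl2
  linarith

end Directions

/-! ### Ridge regression, and norms weighted by the covariance. -/

section RidgeRegression

variable {E ι : Type*} [NormedAddCommGroup E] [InnerProductSpace ℝ E] [Fintype ι]

/-- The cross terms cancel by the normal equation `hw`. -/
theorem ridge_row_expand {lam : ℝ} (f : ι → E) (x : ι → ℝ) (w δ : E)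
    (hw : featureCov lam f w = ∑ i, x i • f i) :
    ∑ i, (inner ℝ (w + δ) (f i) - x i) ^ 2 + lam * ‖w + δ‖ ^ 2 =
      (∑ i, (inner ℝ w (f i) - x i) ^ 2 + lam * ‖w‖ ^ 2) +
        (∑ i, inner ℝ δ (f i) ^ 2 + lam * ‖δ‖ ^ 2) := by
  have h := congrArg (fun z => inner ℝ δ z) hw
  simp only [inner_featureCov, inner_sum, inner_smul_right] at h
  rw [norm_add_sq_real]
  have hexp : ∀ i, (inner ℝ (w + δ) (f i) - x i) ^ 2 = (inner ℝ w (f i) - x i) ^ 2 +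
      inner ℝ δ (f i) ^ 2 + 2 * (inner ℝ (f i) δ * inner ℝ (f i) w - x i * inner ℝ δ (f i)) := by
    intro i
    rw [inner_add_left, real_inner_comm δ (f i), real_inner_comm w (f i)]
    ring
  simp only [hexp, Finset.sum_add_distrib, ← Finset.mul_sum, Finset.sum_sub_distrib]
  rw [← h, real_inner_comm w δ]
  ring

variable [CompleteSpace E] {d : ℕ}

/-- The `k`-th row of `W`, as a vector. -/
noncomputable def matRow (W : E →L[ℝ] State d) (k : Fin d) : E :=
  ContinuousLinearMap.adjoint W (EuclideanSpace.single k (1 : ℝ))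

theorem inner_matRow (W : E →L[ℝ] State d) (k : Fin d) (z : E) :
    inner ℝ (matRow W k) z = W z k := by
  rw [matRow, ContinuousLinearMap.adjoint_inner_left]
  simp [EuclideanSpace.inner_single_left]

theorem matRow_add (W D : E →L[ℝ] State d) (k : Fin d) :
    matRow (W + D) k = matRow W k + matRow D k := by
  simp [matRow]

/-- The regularized least squares solution. -/
noncomputable def ridgeSol (lam : ℝ) (f : ι → E) (x : ι → State d) : E →L[ℝ] State d :=
  (∑ i, (innerSL ℝ (f i)).smulRight (x i)) ∘L regInv lam f

theorem ridgeSol_featureCov {lam : ℝ} (hlam : 0 < lam) (f : ι → E) (x : ι → State d) (z : E) :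
    ridgeSol lam f x (featureCov lam f z) = ∑ i, inner ℝ (f i) z • x i := by
  simp [ridgeSol, regInv_featureCov hlam]

theorem featureCov_matRow_ridgeSol {lam : ℝ} (hlam : 0 < lam) (f : ι → E) (x : ι → State d)
    (k : Fin d) : featureCov lam f (matRow (ridgeSol lam f x) k) = ∑ i, x i k • f i := by
  refine ext_inner_right ℝ fun z => ?_
  rw [inner_featureCov_comm, inner_matRow, ridgeSol_featureCov hlam, sum_inner]
  simp only [inner_smul_left, RCLike.conj_to_real, smul_eq_mul,
    WithLp.ofLp_sum, Finset.sum_apply, WithLp.ofLp_smul, Pi.smul_apply]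
  exact Finset.sum_congr rfl fun i _ => mul_comm _ _

/-- The regularized least squares objective. -/
noncomputable def ridgeObj (lam : ℝ) (f : ι → E) (x : ι → State d) (W : E →L[ℝ] State d) : ℝ :=
  ∑ i, ‖W (f i) - x i‖ ^ 2 + lam * KNR.frobeniusSq W

theorem ridgeObj_eq (lam : ℝ) (f : ι → E) (x : ι → State d) (W : E →L[ℝ] State d) :
    ridgeObj lam f x W =
      ∑ k, (∑ i, (inner ℝ (matRow W k) (f i) - x i k) ^ 2 + lam * ‖matRow W k‖ ^ 2) := by
  rw [ridgeObj, KNR.frobeniusSq, Finset.sum_add_distrib, Finset.mul_sum, Finset.sum_comm]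
  congr 1
  refine Finset.sum_congr rfl fun i _ => ?_
  rw [EuclideanSpace.real_norm_sq_eq]
  simp [inner_matRow]

/-- Strong convexity, obtained row by row. It gives minimality of `ridgeSol` and also uniqueness, so
the minimizer in the definition of the confidence set can be named. -/
theorem ridgeObj_ridgeSol_add_le {lam : ℝ} (hlam : 0 < lam) (f : ι → E) (x : ι → State d)
    (D : E →L[ℝ] State d) :
    ridgeObj lam f x (ridgeSol lam f x) + lam * KNR.frobeniusSq D ≤
      ridgeObj lam f x (ridgeSol lam f x + D) := by
  have hfrob : KNR.frobeniusSq D = ∑ k, ‖matRow D k‖ ^ 2 := rfl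
  rw [ridgeObj_eq, ridgeObj_eq, hfrob, Finset.mul_sum, ← Finset.sum_add_distrib]
  refine Finset.sum_le_sum fun k _ => ?_
  rw [matRow_add, ridge_row_expand f (fun i => x i k) _ _
    (featureCov_matRow_ridgeSol hlam f x k)]
  have : 0 ≤ ∑ i, inner ℝ (matRow D k) (f i) ^ 2 := Finset.sum_nonneg fun i _ => sq_nonneg _
  linarith

theorem ridgeObj_ridgeSol_le {lam : ℝ} (hlam : 0 < lam) (f : ι → E) (x : ι → State d)
    (W : E →L[ℝ] State d) : ridgeObj lam f x (ridgeSol lam f x) ≤ ridgeObj lam f x W := by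
  have h := ridgeObj_ridgeSol_add_le hlam f x (W - ridgeSol lam f x)
  rw [add_sub_cancel] at h
  have : 0 ≤ KNR.frobeniusSq (W - ridgeSol lam f x) :=
    Finset.sum_nonneg fun k _ => sq_nonneg _
  nlinarith

theorem eq_ridgeSol_of_forall_le {lam : ℝ} (hlam : 0 < lam) (f : ι → E) (x : ι → State d)
    {W : E →L[ℝ] State d} (hW : ∀ W', ridgeObj lam f x W ≤ ridgeObj lam f x W') :
    W = ridgeSol lam f x := by
  have h := ridgeObj_ridgeSol_add_le hlam f x (W - ridgeSol lam f x)
  rw [add_sub_cancel] at h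
  have hle := hW (ridgeSol lam f x)
  have h0 : KNR.frobeniusSq (W - ridgeSol lam f x) ≤ 0 := by
    by_contra hcon
    nlinarith [mul_pos hlam (not_le.1 hcon)]
  have hz : ∀ k, ‖matRow (W - ridgeSol lam f x) k‖ ^ 2 = 0 := by
    intro k
    have hs : ∑ k, ‖matRow (W - ridgeSol lam f x) k‖ ^ 2 = 0 :=
      le_antisymm h0 (Finset.sum_nonneg fun k _ => sq_nonneg _)
    exact (Finset.sum_eq_zero_iff_of_nonneg fun k _ => sq_nonneg _).1 hs k (Finset.mem_univ k)
  rw [← sub_eq_zero]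
  ext z k
  have : matRow (W - ridgeSol lam f x) k = 0 := by simpa using hz k
  rw [← inner_matRow, this, inner_zero_left]
  rfl

/-- D Σ D⋆ is positive, so its norm is controlled by its quadratic form; concretely, Cauchy–Schwarz
in the Σ form is applied to D⋆T and D⋆u, where T = D Σ D⋆u. -/
theorem norm_comp_featureCov_le {lam : ℝ} (hlam : 0 < lam) (f : ι → E) (D : E →L[ℝ] State d)
    {c : ℝ} (hc : 0 ≤ c)
    (h : ∀ u, inner ℝ (ContinuousLinearMap.adjoint D u)
      (featureCov lam f (ContinuousLinearMap.adjoint D u)) ≤ c * ‖u‖ ^ 2) :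
    ‖D ∘L featureCov lam f ∘L ContinuousLinearMap.adjoint D‖ ≤ c := by
  refine ContinuousLinearMap.opNorm_le_bound _ hc fun u => ?_
  set D' := ContinuousLinearMap.adjoint D
  set T := D (featureCov lam f (D' u)) with hT
  change ‖T‖ ≤ c * ‖u‖
  have h1 : ‖T‖ ^ 2 = inner ℝ (D' T) (featureCov lam f (D' u)) := by
    rw [← real_inner_self_eq_norm_sq, ContinuousLinearMap.adjoint_inner_left]
  have h2 := inner_sq_le_featureCov_mul_regInv hlam f (D' T) (featureCov lam f (D' u))
  rw [regInv_featureCov hlam, inner_featureCov_comm, ← h1] at h2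
  have h0 : 0 ≤ inner ℝ (D' u) (featureCov lam f (D' u)) :=
    le_trans (by positivity) (le_inner_featureCov_self lam f _)
  have h3 : (‖T‖ ^ 2) ^ 2 ≤ (c * ‖T‖ ^ 2) * (c * ‖u‖ ^ 2) :=
    h2.trans (mul_le_mul (h T) (h u) h0 (by positivity))
  rcases (norm_nonneg T).eq_or_lt with ht | ht
  · rw [← ht]
    positivity
  · have h4 : ‖T‖ ^ 2 ≤ (c * ‖u‖) ^ 2 := by
      refine le_of_mul_le_mul_left ?_ (pow_pos ht 2)
      nlinarith
    exact (pow_le_pow_iff_left₀ (norm_nonneg _) (by positivity) two_ne_zero).1 h4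

/-- Turns membership in the confidence set into a prediction error at z: ‖Dz‖² = ⟨D⋆Dz, z⟩, to which
the dual Cauchy–Schwarz inequality applies. -/
theorem norm_sq_apply_le_of_norm_comp_featureCov_le {lam : ℝ} (hlam : 0 < lam) (f : ι → E)
    (D : E →L[ℝ] State d) {c : ℝ}
    (h : ‖D ∘L featureCov lam f ∘L ContinuousLinearMap.adjoint D‖ ≤ c) (z : E) :
    ‖D z‖ ^ 2 ≤ c * inner ℝ z (regInv lam f z) := by
  set D' := ContinuousLinearMap.adjoint D
  have hs := inner_regInv_self_nonneg hlam f z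
  have h1 : ‖D z‖ ^ 2 = inner ℝ (D' (D z)) z := by
    rw [← real_inner_self_eq_norm_sq, ContinuousLinearMap.adjoint_inner_left]
  have h2 := inner_sq_le_featureCov_mul_regInv hlam f (D' (D z)) z
  rw [← h1] at h2
  have h3 : inner ℝ (D' (D z)) (featureCov lam f (D' (D z))) ≤ c * ‖D z‖ ^ 2 := by
    rw [ContinuousLinearMap.adjoint_inner_left]
    calc inner ℝ (D z) ((D ∘L featureCov lam f ∘L D') (D z))
        ≤ ‖D z‖ * ‖(D ∘L featureCov lam f ∘L D') (D z)‖ := real_inner_le_norm _ _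
      _ ≤ ‖D z‖ * (c * ‖D z‖) := by
          gcongr
          exact (ContinuousLinearMap.le_opNorm _ _).trans (by gcongr)
      _ = c * ‖D z‖ ^ 2 := by ring
  rcases (norm_nonneg (D z)).eq_or_lt with ht | ht
  · have hc : 0 ≤ c := (norm_nonneg _).trans h
    rw [← ht]
    simpa using mul_nonneg hc hs
  · refine le_of_mul_le_mul_left ?_ (pow_pos ht 2)
    nlinarith [mul_le_mul_of_nonneg_right h3 hs]

end RidgeRegression

/-! ### The confidence set contains the true model. -/

namespace KNR

variable {d H : ℕ} {U E : Type*} [MeasurableSpace U] [NormedAddCommGroup E]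
  [InnerProductSpace ℝ E] [MeasurableSpace E]

/-- Multiplying the mixture ratio by √(det ratio) leaves the exponential of half the quadratic form,
so its mean over directions is at most K √(det ratio). The bound on unit vectors extends by
homogeneity. -/
theorem selfNormSq_resid_le [BorelSpace E] [CompleteSpace E] [SecondCountableTopology E]
    {A : Algorithm d H U} {lam : ℝ} (M : KNR d H U E)
    (hlam : 0 < lam) {t : ℕ} (hist : History d H t) {K : ℝ}
    (hKpos : 0 < K) (hK : M.meanRatio lam A hist ≤ ENNReal.ofReal K) (u : State d) :
    selfNormSq lam (M.features A hist) (fun i => inner ℝ u (M.resid A hist i) / M.σ) ≤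
      8 * (Real.log K + Real.log (detRatio lam (M.features A hist)) / 2 + d) * ‖u‖ ^ 2 := by
  set D := detRatio lam (M.features A hist) with hD
  have hDpos : 0 < D := detRatio_pos hlam _
  let q : State d → ℝ := fun v =>
    selfNormSq lam (M.features A hist) fun i => inner ℝ v (M.resid A hist i) / M.σ
  have hq2 : ∀ (s : ℝ) v, q (s • v) = s ^ 2 * q v := by
    intro s v
    simp only [q]
    rw [← selfNormSq_smul]
    congr 1
    funext i
    rw [inner_smul_left, RCLike.conj_to_real]
    ring
  have hpar : ∀ v w, q (v + w) + q (v - w) = 2 * (q v + q w) := by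
    intro v w
    simp only [q]
    rw [← selfNormSq_add_sub]
    congr 2 <;> funext i
    · rw [inner_add_left, add_div]
      rfl
    · rw [inner_sub_left, sub_div]
      rfl
  have hq0 : ∀ v, 0 ≤ q v := fun v => selfNormSq_nonneg hlam _ _
  have hqm : Measurable q :=
    measurable_selfNormSq (f := fun _ => M.features A hist)
      (y := fun v i => inner ℝ v (M.resid A hist i) / M.σ) hlam (fun i => measurable_const)
      fun i => by fun_prop
  have hmean : (∫⁻ v in Metric.ball (0 : State d) 1,
      ENNReal.ofReal (Real.exp (q (‖v‖⁻¹ • v) / 2))) / volume (Metric.ball (0 : State d) 1) ≤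
        ENNReal.ofReal (K * √D) := by
    have hfac : ∀ v, ENNReal.ofReal (Real.exp (q (‖v‖⁻¹ • v) / 2)) =
        M.dirRatio lam A hist (‖v‖⁻¹ • v) * ENNReal.ofReal (√D) := by
      intro v
      have hsq : 0 < √D := Real.sqrt_pos.2 hDpos
      rw [dirRatio, mixtureRatio, ← ENNReal.ofReal_mul (by positivity), ← hD,
        div_mul_cancel₀ _ hsq.ne']
    simp only [hfac]
    rw [lintegral_mul_const' _ _ ENNReal.ofReal_ne_top, ENNReal.mul_div_right_comm,
      ENNReal.ofReal_mul hKpos.le]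
    gcongr
    exact hK
  have hunit : ∀ v : State d, ‖v‖ = 1 →
      q v ≤ 8 * (Real.log K + Real.log D / 2 + d) := by
    intro v hv
    have h := le_of_mean_exp_le hqm hq0 hq2 hpar hmean hv
    rwa [Real.log_mul hKpos.ne' (Real.sqrt_pos.2 hDpos).ne', Real.log_sqrt hDpos.le] at h
  change q u ≤ _
  by_cases hu : u = 0
  · have : q u = 0 := by simpa [hu] using hq2 0 u
    rw [this, hu, norm_zero]
    simp
  · have hn : ‖u‖ ≠ 0 := norm_ne_zero_iff.2 hu
    have h1 := hunit (‖u‖⁻¹ • u) (by rw [norm_smul, norm_inv, norm_norm, inv_mul_cancel₀ hn])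
    rw [hq2, inv_pow] at h1
    have hpos : 0 < ‖u‖ ^ 2 := by positivity
    rwa [inv_mul_le_iff₀ hpos, mul_comm] at h1

variable [CompleteSpace E] {A : Algorithm d H U} {lam : ℝ}

theorem ridgeLoss_eq (M : KNR d H U E) {t : ℕ} (hist : History d H t) (W : E →L[ℝ] State d) :
    M.ridgeLoss lam A hist W =
      ridgeObj lam (M.features A hist) (fun i => hist i.1 i.2.succ) W := by
  rw [ridgeLoss, ridgeObj, Fintype.sum_prod_type]

theorem mem_confBall_iff (M : KNR d H U E) (hlam : 0 < lam) {C₁ : ℝ} {t : ℕ}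
    (hist : History d H t) (W : E →L[ℝ] State d) :
    W ∈ M.confBall C₁ lam A hist ↔
      ‖(W - ridgeSol lam (M.features A hist) fun i => hist i.1 i.2.succ) ∘L
        featureCov lam (M.features A hist) ∘L ContinuousLinearMap.adjoint
          (W - ridgeSol lam (M.features A hist) fun i => hist i.1 i.2.succ)‖ ≤
        M.beta C₁ lam A hist := by
  simp only [confBall, Set.mem_ofPred_eq, ridgeLoss_eq]
  constructor
  · rintro ⟨W', hW', h⟩
    rwa [eq_ridgeSol_of_forall_le hlam _ _ hW'] at h
  · exact fun h => ⟨_, ridgeObj_ridgeSol_le hlam _ _, h⟩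

/-- Two elements of the confidence set agree on `z` up to `2 √β ‖z‖_{Σ⁻¹}`. -/
theorem norm_sub_apply_sq_le (M : KNR d H U E) (hlam : 0 < lam) {C₁ : ℝ} {t : ℕ}
    (hist : History d H t) {W W' : E →L[ℝ] State d} (hW : W ∈ M.confBall C₁ lam A hist)
    (hW' : W' ∈ M.confBall C₁ lam A hist) (z : E) :
    ‖W z - W' z‖ ^ 2 ≤ 4 * M.beta C₁ lam A hist *
      inner ℝ z (regInv lam (M.features A hist) z) := by
  rw [mem_confBall_iff M hlam] at hW hW'
  have h1 := norm_sq_apply_le_of_norm_comp_featureCov_le hlam _ _ hW z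
  have h2 := norm_sq_apply_le_of_norm_comp_featureCov_le hlam _ _ hW' z
  set W₀ := ridgeSol lam (M.features A hist) fun i => hist i.1 i.2.succ
  have h3 : W z - W' z = (W - W₀) z - (W' - W₀) z := by simp
  have h4 : ‖W z - W' z‖ ≤ ‖(W - W₀) z‖ + ‖(W' - W₀) z‖ := by
    rw [h3]
    exact norm_sub_le _ _
  -- (p + q)² ≤ 2p² + 2q², where each square is at most β times the width; hence the factor 4.
  nlinarith [sq_nonneg (‖(W - W₀) z‖ - ‖(W' - W₀) z‖), norm_nonneg (W z - W' z),
    norm_nonneg ((W - W₀) z), norm_nonneg ((W' - W₀) z)]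

/-- By the normal equations, Σ applied to the error in direction u is a bias λ W⋆ᵀu minus σ times
the self-normalized noise sum. The bias costs λ‖W⋆‖², the noise is bounded by the mixture argument.
-/
theorem Wstar_mem_confBall [BorelSpace E] [SecondCountableTopology E]
    (M : KNR d H U E) (hlam : 0 < lam)
    {t : ℕ} (ht : 1 ≤ t) (hist : History d H t)
    (hK : M.meanRatio lam A hist ≤ ENNReal.ofReal ((t : ℝ) ^ 2)) :
    M.Wstar ∈ M.confBall 32 lam A hist := by
  rw [mem_confBall_iff M hlam]
  set f := M.features A hist with hf
  set x : Fin t × Fin H → State d := fun i => hist i.1 i.2.succ with hx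
  set D := M.Wstar - ridgeSol lam f x with hD
  set L := Real.log (detRatio lam f) with hL
  have htpos : (0 : ℝ) < t := by exact_mod_cast ht
  have hlogt : 0 ≤ Real.log t := Real.log_nonneg (by exact_mod_cast ht)
  have hL0 : 0 ≤ L := Real.log_nonneg (one_le_detRatio hlam f)
  have hβ : M.beta 32 lam A hist =
      32 * (lam * ‖M.Wstar‖ ^ 2 + M.σ ^ 2 * (d + (Real.log t + L))) := by
    rw [beta, Real.log_mul htpos.ne' (detRatio_pos hlam _).ne']
  have hσ := M.σ_pos
  rw [hβ]
  refine norm_comp_featureCov_le hlam f D (by positivity) fun u => ?_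
  set r := featureCov lam f (ContinuousLinearMap.adjoint D u) with hr
  set a := lam • ContinuousLinearMap.adjoint M.Wstar u with ha
  set S := ∑ i, (inner ℝ u (M.resid A hist i) / M.σ) • f i with hS
  have hra : r = a - M.σ • S := by
    refine ext_inner_right ℝ fun z => ?_
    rw [hr, inner_featureCov_comm, ContinuousLinearMap.adjoint_inner_left, hD,
      sub_apply, ridgeSol_featureCov hlam, featureCov_apply, map_add, map_smul,
      map_sum, inner_sub_left, ha, inner_smul_left, ContinuousLinearMap.adjoint_inner_left,
      inner_smul_left, hS, sum_inner, inner_sub_right, inner_add_right, inner_smul_right, inner_sum,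
      inner_sum, Finset.mul_sum]
    simp only [map_smul, RCLike.conj_to_real]
    rw [add_sub_assoc, sub_eq_add_neg (lam * _)]
    congr 1
    rw [← Finset.sum_sub_distrib, ← Finset.sum_neg_distrib]
    refine Finset.sum_congr rfl fun i _ => ?_
    rw [inner_smul_right, inner_smul_right, inner_smul_left, resid, inner_sub_right,
      RCLike.conj_to_real]
    simp only [hx, ← hf]
    field_simp
    ring
  have hrP : inner ℝ (ContinuousLinearMap.adjoint D u) r = inner ℝ r (regInv lam f r) := by
    rw [hr, regInv_featureCov hlam, real_inner_comm]
  have hsub : inner ℝ r (regInv lam f r) ≤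
      2 * inner ℝ a (regInv lam f a) + 2 * M.σ ^ 2 * inner ℝ S (regInv lam f S) := by
    have h0 := inner_regInv_self_nonneg hlam f (a + M.σ • S)
    rw [hra]
    simp only [map_add, map_sub, map_smul, inner_add_left, inner_add_right, inner_sub_left,
      inner_sub_right, inner_smul_left, inner_smul_right, RCLike.conj_to_real] at h0 ⊢
    linarith
  have h1 : inner ℝ a (regInv lam f a) ≤ lam * ‖M.Wstar‖ ^ 2 * ‖u‖ ^ 2 := by
    have h := mul_inner_regInv_self_le hlam f a
    have hn : ‖a‖ ≤ lam * (‖M.Wstar‖ * ‖u‖) := by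
      rw [ha, norm_smul, Real.norm_of_nonneg hlam.le]
      gcongr
      refine (ContinuousLinearMap.le_opNorm _ _).trans ?_
      rw [LinearIsometryEquiv.norm_map]
    have hn2 : ‖a‖ ^ 2 ≤ (lam * (‖M.Wstar‖ * ‖u‖)) ^ 2 := by gcongr
    refine le_of_mul_le_mul_left ((h.trans hn2).trans (le_of_eq ?_)) hlam
    ring
  have h2 : inner ℝ S (regInv lam f S) ≤
      8 * (Real.log ((t : ℝ) ^ 2) + L / 2 + d) * ‖u‖ ^ 2 :=
    M.selfNormSq_resid_le hlam hist (by positivity) hK u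
  rw [Real.log_pow] at h2
  rw [hrP]
  refine hsub.trans ?_
  -- With threshold t², log K = 2 log t, and the coefficient 2 · 8 · 2 = 32 of log t is the largest
  -- that occurs; it determines C₁.
  have h3 : 2 * M.σ ^ 2 * inner ℝ S (regInv lam f S) ≤
      2 * M.σ ^ 2 * (8 * ((2 : ℕ) * Real.log t + L / 2 + d) * ‖u‖ ^ 2) := by gcongr
  have hlw : 0 ≤ lam * ‖M.Wstar‖ ^ 2 * ‖u‖ ^ 2 := by positivity
  have e1 : 0 ≤ M.σ ^ 2 * ‖u‖ ^ 2 * d := by positivity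
  have e3 : 0 ≤ M.σ ^ 2 * ‖u‖ ^ 2 * L := by positivity
  push_cast at h3
  nlinarith

end KNR

/-! ### Second moment of the deficit of a Girsanov density. -/

section Simulation

variable {d H : ℕ} {σ : ℝ}

/-- Passes through (1 - √r)²: it is at most r - 1 - log r because log r ≤ 2(√r - 1), and for r ≤ 1
the remaining factor (1 + √r)² is at most 4. The right side integrates to a Kullback–Leibler
divergence. -/
theorem sq_one_sub_le_log {r : ℝ} (hr : 0 < r) :
    max (1 - r) 0 ^ 2 ≤ 4 * (r - 1 - Real.log r) := by
  have hs : 0 < √r := Real.sqrt_pos.2 hr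
  have h1 : √r ^ 2 = r := Real.sq_sqrt hr.le
  have h2 : Real.log r ≤ 2 * (√r - 1) := by
    have h := Real.log_le_sub_one_of_pos hs
    rw [Real.log_sqrt hr.le] at h
    linarith
  rcases le_or_gt 1 r with h | h
  · rw [max_eq_right (by linarith)]
    nlinarith [sq_nonneg (√r - 1)]
  · rw [max_eq_left (by linarith)]
    have h3 : √r ≤ 1 := Real.sqrt_le_one.2 h.le
    have h4 : (1 - r) ^ 2 = (1 - √r) ^ 2 * (1 + √r) ^ 2 := by
      nth_rewrite 1 [← h1]
      ring
    have h5 : (1 + √r) ^ 2 ≤ 4 := by nlinarith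
    nlinarith [mul_le_mul_of_nonneg_left h5 (sq_nonneg (1 - √r))]

theorem shiftDensity_nonneg (σ : ℝ) (m z : State d) : 0 ≤ shiftDensity σ m z :=
  (Real.exp_pos _).le

theorem measurable_prod_shiftDensity {m : (Fin H → State d) → Fin H → State d}
    (hm : Measurable m) : Measurable fun ξ => ∏ h, shiftDensity σ (m ξ h) (ξ h) := by
  refine Finset.measurable_prod _ fun h _ => ?_
  have h1 : Measurable fun ξ => m ξ h := (measurable_pi_apply h).comp hm
  have h2 : Measurable fun ξ : Fin H → State d => ξ h := measurable_pi_apply h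
  unfold shiftDensity
  exact (((h2.inner h1).div_const _).add ((h1.norm.pow_const 2).div_const _)).neg.exp

theorem prod_shiftDensity_pos (m ξ : Fin H → State d) : 0 < ∏ h, shiftDensity σ (m h) (ξ h) :=
  Finset.prod_pos fun _ _ => Real.exp_pos _

theorem log_prod_shiftDensity (m ξ : Fin H → State d) :
    Real.log (∏ h, shiftDensity σ (m h) (ξ h)) =
      -(∑ h, inner ℝ (ξ h) (m h) / σ ^ 2 + (∑ h, ‖m h‖ ^ 2) / (2 * σ ^ 2)) := by
  simp only [shiftDensity]
  rw [← Real.exp_sum, Real.log_exp, Finset.sum_neg_distrib, Finset.sum_add_distrib,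
    Finset.sum_div]

theorem lintegral_prod_shiftDensity (hσ : 0 < σ)
    {m : (Fin H → State d) → Fin H → State d} (hm : Measurable m)
    (hadap : ∀ i x y, (∀ j < i, x j = y j) → m x i = m y i) :
    ∫⁻ ξ, ENNReal.ofReal (∏ h, shiftDensity σ (m ξ h) (ξ h)) ∂(episodeNoise d H σ) = 1 := by
  have h := lintegral_episodeNoise_shift hσ m hm hadap (fun _ => 1) measurable_const
  simp only [one_mul, lintegral_const, measure_univ] at h
  rw [← h]
  refine lintegral_congr fun ξ => ?_
  exact ENNReal.ofReal_prod_of_nonneg fun i _ => shiftDensity_nonneg σ _ _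

/-- Flipping the sign of the noise at time h preserves the law, leaves the adapted shift at time h
unchanged and negates the integrand. -/
theorem integral_inner_adapted (m : (Fin H → State d) → Fin H → State d) (hm : Measurable m)
    (hadap : ∀ i x y, (∀ j < i, x j = y j) → m x i = m y i) (h : Fin H) :
    ∫ ξ, inner ℝ (ξ h) (m ξ h) ∂(episodeNoise d H σ) = 0 := by
  let T : (Fin H → State d) → Fin H → State d := fun ξ i => (if i = h then Neg.neg else id) (ξ i)
  have hT : MeasurePreserving T (episodeNoise d H σ) (episodeNoise d H σ) := by
    refine measurePreserving_pi (fun _ => gaussianNoise d σ) (fun _ => gaussianNoise d σ)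
      fun i => ?_
    by_cases hi : i = h
    · simp only [hi, if_true]
      exact ⟨measurable_neg, map_neg_gaussianNoise d σ⟩
    · simp only [hi, if_false]
      exact MeasurePreserving.id _
  have hG : Measurable fun ξ : Fin H → State d => (inner ℝ (ξ h) (m ξ h) : ℝ) :=
    (measurable_pi_apply h).inner ((measurable_pi_apply h).comp hm)
  have h1 := integral_map (μ := episodeNoise d H σ) hT.measurable.aemeasurable
    (f := fun ξ : Fin H → State d => (inner ℝ (ξ h) (m ξ h) : ℝ)) hG.aestronglyMeasurable
  rw [hT.map_eq] at h1
  have h2 : ∀ ξ, (inner ℝ (T ξ h) (m (T ξ) h) : ℝ) = -inner ℝ (ξ h) (m ξ h) := by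
    intro ξ
    have hm' : m (T ξ) h = m ξ h := hadap h _ _ fun j hj => by simp [T, hj.ne]
    rw [hm']
    simp [T]
  simp only [h2, integral_neg] at h1
  linarith

/-- After `sq_one_sub_le_log`, the density has mean 1 and the linear terms of its logarithm have
mean 0, so only half the normalized squared shift remains, times 4. The bound `hb` makes every term
integrable. -/
theorem lintegral_sq_one_sub_prod_le (hσ : 0 < σ)
    {m : (Fin H → State d) → Fin H → State d} (hm : Measurable m)
    (hadap : ∀ i x y, (∀ j < i, x j = y j) → m x i = m y i)
    (hb : ∀ ξ, ∑ h, ‖m ξ h‖ ^ 2 ≤ σ ^ 2) :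
    ∫⁻ ξ, ENNReal.ofReal (1 - ∏ h, shiftDensity σ (m ξ h) (ξ h)) ^ 2 ∂(episodeNoise d H σ) ≤
      2 * ∫⁻ ξ, ENNReal.ofReal (∑ h, ‖m ξ h‖ ^ 2 / σ ^ 2) ∂(episodeNoise d H σ) := by
  set r : (Fin H → State d) → ℝ := fun ξ => ∏ h, shiftDensity σ (m ξ h) (ξ h) with hr
  have hrm : Measurable r := measurable_prod_shiftDensity hm
  have hmh : ∀ h, Measurable fun ξ => m ξ h := fun h => (measurable_pi_apply h).comp hm
  have hr1 := lintegral_prod_shiftDensity hσ hm hadap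
  have hrpos : ∀ ξ, 0 < r ξ := fun ξ => prod_shiftDensity_pos _ _
  have hri : Integrable r (episodeNoise d H σ) := by
    refine ⟨hrm.aestronglyMeasurable, ?_⟩
    rw [hasFiniteIntegral_iff_ofReal (Filter.Eventually.of_forall fun ξ => (hrpos ξ).le), hr1]
    exact ENNReal.one_lt_top
  have hrint : ∫ ξ, r ξ ∂(episodeNoise d H σ) = 1 := by
    rw [integral_eq_lintegral_of_nonneg_ae (Filter.Eventually.of_forall fun ξ => (hrpos ξ).le)
      hrm.aestronglyMeasurable, hr1, ENNReal.toReal_one]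
  have hsi : Integrable (fun ξ => ∑ h, ‖m ξ h‖ ^ 2 / σ ^ 2) (episodeNoise d H σ) := by
    refine Integrable.of_bound (C := 1) (Finset.measurable_sum _ fun h _ =>
      ((hmh h).norm.pow_const 2).div_const _).aestronglyMeasurable
      (Filter.Eventually.of_forall fun ξ => ?_)
    rw [Real.norm_of_nonneg (Finset.sum_nonneg fun h _ => by positivity), ← Finset.sum_div,
      div_le_one (by positivity)]
    exact hb ξ
  have hmle : ∀ ξ h, ‖m ξ h‖ ≤ σ := by
    intro ξ h
    refine (pow_le_pow_iff_left₀ (norm_nonneg _) hσ.le two_ne_zero).1 (le_trans ?_ (hb ξ))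
    exact Finset.single_le_sum (f := fun h => ‖m ξ h‖ ^ 2) (fun _ _ => sq_nonneg _)
      (Finset.mem_univ h)
  have hnorm : ∀ h, Integrable (fun ξ : Fin H → State d => ‖ξ h‖) (episodeNoise d H σ) :=
    fun h => (measurePreserving_eval (fun _ => gaussianNoise d σ) h).integrable_comp_of_integrable
      (integrable_norm_gaussianNoise d σ)
  have hii : ∀ h, Integrable (fun ξ => inner ℝ (ξ h) (m ξ h) / σ ^ 2) (episodeNoise d H σ) := by
    intro h
    refine Integrable.div_const ?_ _
    refine ((hnorm h).const_mul σ).mono'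
      ((measurable_pi_apply h).inner (hmh h)).aestronglyMeasurable
      (Filter.Eventually.of_forall fun ξ => ?_)
    calc ‖(inner ℝ (ξ h) (m ξ h) : ℝ)‖ ≤ ‖ξ h‖ * ‖m ξ h‖ := norm_inner_le_norm _ _
      _ ≤ ‖ξ h‖ * σ := by gcongr; exact hmle ξ h
      _ = σ * ‖ξ h‖ := mul_comm _ _
  have hsumi : Integrable (fun ξ => ∑ h, inner ℝ (ξ h) (m ξ h) / σ ^ 2) (episodeNoise d H σ) :=
    integrable_finsetSum _ fun h _ => hii h
  have hsum0 : ∫ ξ, ∑ h, inner ℝ (ξ h) (m ξ h) / σ ^ 2 ∂(episodeNoise d H σ) = 0 := by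
    rw [integral_finsetSum _ fun h _ => hii h]
    refine Finset.sum_eq_zero fun h _ => ?_
    rw [integral_div, integral_inner_adapted m hm hadap h, zero_div]
  let F : (Fin H → State d) → ℝ := fun ξ => 4 * (r ξ - 1 +
    (∑ h, inner ℝ (ξ h) (m ξ h) / σ ^ 2 + (1 / 2) * ∑ h, ‖m ξ h‖ ^ 2 / σ ^ 2))
  have hFlog : ∀ ξ, F ξ = 4 * (r ξ - 1 - Real.log (r ξ)) := by
    intro ξ
    simp only [F, hr]
    rw [log_prod_shiftDensity, ← Finset.sum_div Finset.univ (fun h => ‖m ξ h‖ ^ 2)]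
    field_simp
    ring
  have hFi : Integrable F (episodeNoise d H σ) :=
    ((hri.sub (integrable_const 1)).add (hsumi.add (hsi.const_mul (1 / 2)))).const_mul 4
  have hF0 : ∀ ξ, 0 ≤ F ξ := fun ξ => by
    rw [hFlog]
    exact (sq_nonneg _).trans (sq_one_sub_le_log (hrpos ξ))
  have hFint : ∫ ξ, F ξ ∂(episodeNoise d H σ) =
      2 * ∫ ξ, ∑ h, ‖m ξ h‖ ^ 2 / σ ^ 2 ∂(episodeNoise d H σ) := by
    have e1 := integral_add (hri.sub (integrable_const 1)) (hsumi.add (hsi.const_mul (1 / 2)))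
    have e2 := integral_sub hri (integrable_const (1 : ℝ))
    have e3 := integral_add hsumi (hsi.const_mul (1 / 2))
    simp only [Pi.add_apply, Pi.sub_apply] at e1 e2 e3
    simp only [F]
    rw [integral_const_mul, e1, e2, e3, hsum0, hrint, integral_const_mul]
    simp only [integral_const, probReal_univ, smul_eq_mul]
    ring
  calc ∫⁻ ξ, ENNReal.ofReal (1 - r ξ) ^ 2 ∂(episodeNoise d H σ)
      ≤ ∫⁻ ξ, ENNReal.ofReal (F ξ) ∂(episodeNoise d H σ) := by
        refine lintegral_mono fun ξ => ?_
        have : ENNReal.ofReal (1 - r ξ) = ENNReal.ofReal (max (1 - r ξ) 0) := by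
          rcases le_total (1 - r ξ) 0 with h | h
          · rw [max_eq_right h, ENNReal.ofReal_of_nonpos h, ENNReal.ofReal_zero]
          · rw [max_eq_left h]
        rw [this, ← ENNReal.ofReal_pow (le_max_right _ _), hFlog]
        exact ENNReal.ofReal_le_ofReal (sq_one_sub_le_log (hrpos ξ))
    _ = ENNReal.ofReal (∫ ξ, F ξ ∂(episodeNoise d H σ)) :=
        (ofReal_integral_eq_lintegral_ofReal hFi (Filter.Eventually.of_forall hF0)).symm
    _ = 2 * ENNReal.ofReal (∫ ξ, ∑ h, ‖m ξ h‖ ^ 2 / σ ^ 2 ∂(episodeNoise d H σ)) := by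
        rw [hFint, ENNReal.ofReal_mul two_pos.le, ENNReal.ofReal_ofNat]
    _ = _ := by
        rw [ofReal_integral_eq_lintegral_ofReal hsi (Filter.Eventually.of_forall fun ξ =>
          Finset.sum_nonneg fun h _ => by positivity)]

/-- The shift `m`, switched off once its accumulated squared norm exceeds `σ²`. -/
noncomputable def truncShift (σ : ℝ) (m : (Fin H → State d) → Fin H → State d)
    (ξ : Fin H → State d) (h : Fin H) : State d :=
  if ∑ k ∈ Finset.Iic h, ‖m ξ k‖ ^ 2 ≤ σ ^ 2 then m ξ h else 0

theorem measurable_truncShift {m : (Fin H → State d) → Fin H → State d} (hm : Measurable m) :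
    Measurable (truncShift σ m) := by
  have hmh : ∀ h, Measurable fun ξ => m ξ h := fun h => (measurable_pi_apply h).comp hm
  refine measurable_pi_lambda _ fun h => ?_
  have hs : Measurable fun ξ => ∑ k ∈ Finset.Iic h, ‖m ξ k‖ ^ 2 :=
    Finset.measurable_sum _ fun k _ => (hmh k).norm.pow_const 2
  exact Measurable.ite (measurableSet_le hs measurable_const) (hmh h) measurable_const

theorem truncShift_adapted {m : (Fin H → State d) → Fin H → State d}
    (hadap : ∀ i x y, (∀ j < i, x j = y j) → m x i = m y i) (i : Fin H)
    (x y : Fin H → State d) (hxy : ∀ j < i, x j = y j) :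
    truncShift σ m x i = truncShift σ m y i := by
  have h : ∀ k ∈ Finset.Iic i, m x k = m y k := fun k hk =>
    hadap k x y fun j hj => hxy j (hj.trans_le (Finset.mem_Iic.1 hk))
  have hs : ∑ k ∈ Finset.Iic i, ‖m x k‖ ^ 2 = ∑ k ∈ Finset.Iic i, ‖m y k‖ ^ 2 :=
    Finset.sum_congr rfl fun k hk => by rw [h k hk]
  rw [truncShift, truncShift, hs, h i (Finset.mem_Iic.2 le_rfl)]

theorem norm_truncShift_le (m : (Fin H → State d) → Fin H → State d) (ξ : Fin H → State d)
    (h : Fin H) : ‖truncShift σ m ξ h‖ ≤ ‖m ξ h‖ := by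
  rw [truncShift]
  split_ifs
  · exact le_rfl
  · simp

theorem sum_norm_truncShift_le (m : (Fin H → State d) → Fin H → State d) (ξ : Fin H → State d) :
    ∑ h, ‖truncShift σ m ξ h‖ ^ 2 ≤ σ ^ 2 := by
  let F := Finset.univ.filter fun h : Fin H => ∑ k ∈ Finset.Iic h, ‖m ξ k‖ ^ 2 ≤ σ ^ 2
  have h1 : ∑ h, ‖truncShift σ m ξ h‖ ^ 2 = ∑ h ∈ F, ‖m ξ h‖ ^ 2 := by
    rw [Finset.sum_filter]
    refine Finset.sum_congr rfl fun h _ => ?_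
    rw [truncShift]
    split_ifs <;> simp
  rw [h1]
  rcases F.eq_empty_or_nonempty with he | hne
  · rw [he, Finset.sum_empty]
    positivity
  · have hmem := F.max'_mem hne
    have hle := (Finset.mem_filter.1 hmem).2
    refine le_trans (Finset.sum_le_sum_of_subset_of_nonneg (fun h hh => ?_)
      fun _ _ _ => sq_nonneg _) hle
    exact Finset.mem_Iic.2 (F.le_max' h hh)

/-- No size bound on the shift is needed: the truncated shift obeys one and is still adapted. Where
the two shifts differ, the capped sum equals 1, which already dominates the integrand. The constant
is 1 + 2. -/
theorem lintegral_sq_one_sub_prod_le_min (hσ : 0 < σ)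
    {m : (Fin H → State d) → Fin H → State d} (hm : Measurable m)
    (hadap : ∀ i x y, (∀ j < i, x j = y j) → m x i = m y i) :
    ∫⁻ ξ, ENNReal.ofReal (1 - ∏ h, shiftDensity σ (m ξ h) (ξ h)) ^ 2 ∂(episodeNoise d H σ) ≤
      3 * ∫⁻ ξ, min 1 (ENNReal.ofReal (∑ h, ‖m ξ h‖ ^ 2 / σ ^ 2)) ∂(episodeNoise d H σ) := by
  set m' := truncShift σ m
  have hm' : Measurable m' := measurable_truncShift hm
  have hmh : ∀ h, Measurable fun ξ => m ξ h := fun h => (measurable_pi_apply h).comp hm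
  let S : (Fin H → State d) → ℝ≥0∞ := fun ξ => min 1 (ENNReal.ofReal (∑ h, ‖m ξ h‖ ^ 2 / σ ^ 2))
  have hS : Measurable S := by
    refine measurable_const.min (Measurable.ennreal_ofReal ?_)
    exact Finset.measurable_sum _ fun h _ => ((hmh h).norm.pow_const 2).div_const _
  have hpt : ∀ ξ, ENNReal.ofReal (1 - ∏ h, shiftDensity σ (m ξ h) (ξ h)) ^ 2 ≤
      S ξ + ENNReal.ofReal (1 - ∏ h, shiftDensity σ (m' ξ h) (ξ h)) ^ 2 := by
    intro ξ
    by_cases hle : ∑ h, ‖m ξ h‖ ^ 2 ≤ σ ^ 2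
    · have : ∀ h, m' ξ h = m ξ h := by
        intro h
        refine if_pos (le_trans ?_ hle)
        exact Finset.sum_le_sum_of_subset_of_nonneg (Finset.subset_univ _)
          fun _ _ _ => sq_nonneg _
      simp only [this]
      exact le_add_self
    · have h1 : S ξ = 1 := by
        refine min_eq_left ?_
        rw [ENNReal.one_le_ofReal, ← Finset.sum_div, one_le_div (by positivity)]
        exact (not_le.1 hle).le
      rw [h1]
      refine le_trans ?_ le_self_add
      refine pow_le_one₀ zero_le (ENNReal.ofReal_le_one.2 ?_)
      linarith [prod_shiftDensity_pos (σ := σ) (m ξ) ξ]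
  refine (lintegral_mono hpt).trans ?_
  rw [lintegral_add_left hS]
  have h2 := lintegral_sq_one_sub_prod_le hσ hm' (truncShift_adapted hadap)
    (sum_norm_truncShift_le m)
  have h3 : ∫⁻ ξ, ENNReal.ofReal (∑ h, ‖m' ξ h‖ ^ 2 / σ ^ 2) ∂(episodeNoise d H σ) ≤
      ∫⁻ ξ, S ξ ∂(episodeNoise d H σ) := by
    refine lintegral_mono fun ξ => le_min ?_ (ENNReal.ofReal_le_ofReal ?_)
    · rw [ENNReal.ofReal_le_one, ← Finset.sum_div, div_le_one (by positivity)]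
      exact sum_norm_truncShift_le m ξ
    · refine Finset.sum_le_sum fun h _ => ?_
      gcongr
      exact norm_truncShift_le m ξ h
  calc _ ≤ ∫⁻ ξ, S ξ ∂(episodeNoise d H σ) + 2 * ∫⁻ ξ, S ξ ∂(episodeNoise d H σ) := by
        gcongr
        exact h2.trans (by gcongr)
    _ = 3 * ∫⁻ ξ, S ξ ∂(episodeNoise d H σ) := by ring

end Simulation

/-! ### The simulation lemma. -/

namespace KNR

variable {d H : ℕ} {U E : Type*} [MeasurableSpace U] [NormedAddCommGroup E]
  [InnerProductSpace ℝ E] [MeasurableSpace E] [BorelSpace E]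

/-- The simulation lemma, with the second moment of the cost under the true dynamics. -/
theorem J_Wstar_le (M : KNR d H U E) {π : Policy d H U} (hπ : ∀ h, Measurable fun x => π x h)
    {c : State d × U → ℝ≥0} (hc : Measurable c) (W : E →L[ℝ] State d) :
    M.J π c M.Wstar ≤ M.J π c W + (M.secondMoment π c) ^ (1 / 2 : ℝ) *
      (3 * ∫⁻ ξ, min 1 (ENNReal.ofReal (∑ h,
        ‖M.Wstar (M.episodeFeatures π (M.rollout M.Wstar π ξ) h) -
          W (M.episodeFeatures π (M.rollout M.Wstar π ξ) h)‖ ^ 2 / M.σ ^ 2))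
        ∂(episodeNoise d H M.σ)) ^ (1 / 2 : ℝ) := by
  have hπ' : ∀ h, Measurable fun p : (Fin H → State d) × State d => π p.2 h :=
    fun h => (hπ h).comp measurable_snd
  have hroll : ∀ W : E →L[ℝ] State d, Measurable fun ξ => M.rollout W π ξ := fun W =>
    M.measurable_rollout W (π := fun _ : Fin H → State d => π) hπ' measurable_id
  have hcost : ∀ W : E →L[ℝ] State d,
      Measurable fun ξ => (trajCost c π (M.rollout W π ξ) : ℝ≥0∞) := fun W =>
    (measurable_trajCost (π := fun _ : Fin H → State d => π) hc hπ' (hroll W)).coe_nnreal_ennreal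
  -- The discrepancy of the two models along the true trajectory; adding it to the noise makes W
  -- follow that trajectory.
  let m : (Fin H → State d) → Fin H → State d := fun ξ h =>
    M.Wstar (M.episodeFeatures π (M.rollout M.Wstar π ξ) h) -
      W (M.episodeFeatures π (M.rollout M.Wstar π ξ) h)
  have hm : Measurable m := by
    refine measurable_pi_lambda _ fun h => ?_
    have hf : Measurable fun ξ => M.episodeFeatures π (M.rollout M.Wstar π ξ) h :=
      M.measurable_episodeFeatures (π := fun _ : Fin H → State d => π) hπ' (hroll M.Wstar) h
    exact (M.Wstar.continuous.measurable.comp hf).sub (W.continuous.measurable.comp hf)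
  have hadap : ∀ i x y, (∀ j < i, x j = y j) → m x i = m y i := by
    intro i x y hxy
    have : M.rollout M.Wstar π x i.castSucc = M.rollout M.Wstar π y i.castSucc :=
      path_congr _ _ _ fun j hj => hxy j (Fin.castSucc_lt_castSucc_iff.1 hj)
    simp only [m, episodeFeatures, this]
  have hshift : ∀ ξ, M.rollout W π (ξ + m ξ) = M.rollout M.Wstar π ξ := fun ξ =>
    path_add_sub (M.drift M.Wstar π) (M.drift W π) M.x₀ ξ
  let r : (Fin H → State d) → ℝ := fun ξ => ∏ h, shiftDensity M.σ (m ξ h) (ξ h)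
  have hr : Measurable r := measurable_prod_shiftDensity hm
  let X : (Fin H → State d) → ℝ≥0∞ := fun ξ => trajCost c π (M.rollout M.Wstar π ξ)
  have hX : Measurable X := hcost M.Wstar
  have hJW : ∫⁻ ξ, X ξ * ENNReal.ofReal (r ξ) ∂(episodeNoise d H M.σ) = M.J π c W := by
    rw [J, ← lintegral_episodeNoise_shift M.σ_pos m hm hadap _ (hcost W)]
    refine lintegral_congr fun ξ => ?_
    rw [hshift, ← ENNReal.ofReal_prod_of_nonneg fun i _ => shiftDensity_nonneg M.σ _ _]
  -- Since 1 ≤ r + (1 - r)⁺, the first part integrates to the value under W. The second involves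
  -- only costs under the true dynamics, and Cauchy–Schwarz applies to it.
  have hpt : ∀ ξ, X ξ ≤ X ξ * ENNReal.ofReal (r ξ) + X ξ * ENNReal.ofReal (1 - r ξ) := by
    intro ξ
    rw [← mul_add]
    refine le_mul_of_one_le_right zero_le ?_
    refine le_trans ?_ ENNReal.ofReal_add_le
    rw [add_sub_cancel, ENNReal.ofReal_one]
  have hholder := ENNReal.lintegral_mul_le_Lp_mul_Lq (episodeNoise d H M.σ)
    Real.HolderConjugate.two_two hX.aemeasurable
    (g := fun ξ => ENNReal.ofReal (1 - r ξ)) (measurable_const.sub hr).ennreal_ofReal.aemeasurable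
  calc M.J π c M.Wstar = ∫⁻ ξ, X ξ ∂(episodeNoise d H M.σ) := rfl
    _ ≤ ∫⁻ ξ, (X ξ * ENNReal.ofReal (r ξ) + X ξ * ENNReal.ofReal (1 - r ξ))
        ∂(episodeNoise d H M.σ) := lintegral_mono hpt
    _ = M.J π c W + ∫⁻ ξ, X ξ * ENNReal.ofReal (1 - r ξ) ∂(episodeNoise d H M.σ) := by
        rw [← hJW]
        exact lintegral_add_left (hX.mul hr.ennreal_ofReal) _
    _ ≤ _ := by
        gcongr
        refine hholder.trans ?_
        simp only [ENNReal.rpow_two]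
        gcongr
        · exact le_rfl
        · exact lintegral_sq_one_sub_prod_le_min M.σ_pos hm hadap

end KNR

/-! ### Telescoping of capped gains. -/

section Potential

theorem le_two_mul_log_one_add {x : ℝ} (h0 : 0 ≤ x) (h1 : x ≤ 1) : x ≤ 2 * Real.log (1 + x) := by
  have h := Real.one_sub_inv_le_log_of_pos (by linarith : 0 < 1 + x)
  have h2 : x / 2 ≤ 1 - (1 + x)⁻¹ := by
    rw [le_sub_iff_add_le, ← le_sub_iff_add_le', inv_le_iff_one_le_mul₀ (by linarith)]
    nlinarith
  linarith

theorem sum_min_le {L : ℕ → ℝ} (h0 : L 0 = 0) (T : ℕ) :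
    ∑ t ∈ Finset.range T, min 1 (2 * (L (t + 1) - L t)) ≤ 2 * L T := by
  calc _ ≤ ∑ t ∈ Finset.range T, 2 * (L (t + 1) - L t) :=
        Finset.sum_le_sum fun t _ => min_le_right _ _
    _ = 2 * L T := by rw [← Finset.mul_sum, Finset.sum_range_sub, h0, sub_zero]

/-- The last term uses the cap 1 instead of the gain, so the quadratic part involves L only up to
index n. This is why the second-moment information gain stops one episode before T. -/
theorem sum_mul_min_le {L : ℕ → ℝ} (h0 : L 0 = 0) (hL : Monotone L) (n : ℕ) :
    ∑ t ∈ Finset.range (n + 1), L t * min 1 (2 * (L (t + 1) - L t)) ≤ 2 * L n ^ 2 + L n := by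
  have hpos : ∀ t, 0 ≤ L t := fun t => h0 ▸ hL (Nat.zero_le t)
  rw [Finset.sum_range_succ]
  refine add_le_add ?_ (mul_le_of_le_one_right (hpos n) (min_le_left _ _))
  calc _ ≤ ∑ t ∈ Finset.range n, L n * (2 * (L (t + 1) - L t)) := by
        refine Finset.sum_le_sum fun t ht => ?_
        have hd : 0 ≤ 2 * (L (t + 1) - L t) := by linarith [hL (Nat.le_succ t)]
        exact mul_le_mul (hL (Finset.mem_range.1 ht).le) (min_le_right _ _)
          (le_min zero_le_one hd) (hpos n)
    _ = 2 * L n ^ 2 := by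
        rw [← Finset.mul_sum, ← Finset.mul_sum, Finset.sum_range_sub, h0]
        ring

end Potential

/-! ### Regret of a single episode. -/

namespace KNR

variable {d H : ℕ} {U E : Type*} [MeasurableSpace U] [NormedAddCommGroup E]
  [InnerProductSpace ℝ E] [MeasurableSpace E]

/-- The gain in log-determinant of an episode with noise `ξ`, doubled and capped at `1`. -/
noncomputable def episodeGain (M : KNR d H U E) (lam : ℝ) (A : Algorithm d H U) {t : ℕ}
    (hist : History d H t) (ξ : Fin H → State d) : ℝ :=
  min 1 (2 * (Real.log (detRatio lam (Sum.elim (M.features A hist)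
    (M.episodeFeatures (A t hist) (M.rollout M.Wstar (A t hist) ξ)))) - M.logDet lam A hist))

/-- The radius of the confidence set, relative to the noise level. -/
noncomputable def relRadius (M : KNR d H U E) (lam : ℝ) (A : Algorithm d H U) {t : ℕ}
    (hist : History d H t) : ℝ :=
  32 * (1 + d + Real.log t + M.logDet lam A hist)

/-- The bound on the squared model error of an episode, in units of the noise level. -/
noncomputable def modelError (M : KNR d H U E) (lam : ℝ) (A : Algorithm d H U) {t : ℕ}
    (hist : History d H t) : ℝ≥0∞ :=
  ENNReal.ofReal (12 * M.relRadius lam A hist) *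
    ∫⁻ ξ, ENNReal.ofReal (M.episodeGain lam A hist ξ) ∂(episodeNoise d H M.σ)

section LogDet

variable {A : Algorithm d H U} {lam : ℝ}

theorem logDet_nonneg (M : KNR d H U E) (hlam : 0 < lam) {t : ℕ} (hist : History d H t) :
    0 ≤ M.logDet lam A hist :=
  Real.log_nonneg (one_le_detRatio hlam _)

theorem logDet_zero (M : KNR d H U E) (hist : History d H 0) : M.logDet lam A hist = 0 := by
  simp [logDet, detRatio]

theorem le_relRadius (M : KNR d H U E) (hlam : 0 < lam) {t : ℕ} (hist : History d H t) :
    32 ≤ M.relRadius lam A hist := by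
  have h1 := M.logDet_nonneg hlam (A := A) hist
  have h2 : 0 ≤ Real.log t := Real.log_natCast_nonneg t
  have h3 : (0 : ℝ) ≤ d := Nat.cast_nonneg d
  rw [relRadius]
  linarith

theorem log_detRatio_runHist_succ (M : KNR d H U E) (ω : ℕ → Fin H → State d) (t : ℕ) :
    M.logDet lam A (M.runHist A ω (t + 1)) = Real.log (detRatio lam
      (Sum.elim (M.features A (M.runHist A ω t))
        (M.episodeFeatures (A t (M.runHist A ω t))
          (M.rollout M.Wstar (A t (M.runHist A ω t)) (ω t))))) := by
  rw [logDet, ← detRatio_comp_equiv _ (episodeEquiv t H), features_succ, run_eq]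

theorem episodeGain_runHist (M : KNR d H U E) (ω : ℕ → Fin H → State d) (t : ℕ) :
    M.episodeGain lam A (M.runHist A ω t) (ω t) =
      min 1 (2 * (M.logDet lam A (M.runHist A ω (t + 1)) - M.logDet lam A (M.runHist A ω t))) := by
  rw [episodeGain, log_detRatio_runHist_succ]

variable [CompleteSpace E]

theorem monotone_logDet (M : KNR d H U E) (hlam : 0 < lam) (ω : ℕ → Fin H → State d) :
    Monotone fun t => M.logDet lam A (M.runHist A ω t) := by
  refine monotone_nat_of_le_succ fun t => ?_
  rw [log_detRatio_runHist_succ]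
  refine Real.log_le_log (detRatio_pos hlam _) ?_
  refine le_trans ?_ (detRatio_mul_one_add_sum_le hlam _ _)
  refine le_mul_of_one_le_right (detRatio_pos hlam _).le ?_
  have : 0 ≤ ∑ k, inner ℝ (M.episodeFeatures (A t (M.runHist A ω t))
      (M.rollout M.Wstar (A t (M.runHist A ω t)) (ω t)) k)
      (regInv lam (M.features A (M.runHist A ω t)) (M.episodeFeatures (A t (M.runHist A ω t))
      (M.rollout M.Wstar (A t (M.runHist A ω t)) (ω t)) k)) :=
    Finset.sum_nonneg fun k _ => inner_regInv_self_nonneg hlam _ _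
  linarith

/-- Let s be the total width of the episode. If s ≤ 1, then s ≤ 2 log (1 + s), which is at most the
doubled gain in log-determinant; if s ≥ 1, that doubled gain is at least 2 log 2 ≥ 1 and the cap is
reached. The hypothesis `hb` covers the second case. -/
theorem min_one_ofReal_sum_le (M : KNR d H U E) (hlam : 0 < lam) {t : ℕ} (hist : History d H t)
    (ξ : Fin H → State d) {b : ℝ} (hb : 1 ≤ 4 * b) {x : Fin H → ℝ}
    (hx : ∀ h, x h ≤ 4 * b * inner ℝ
      (M.episodeFeatures (A t hist) (M.rollout M.Wstar (A t hist) ξ) h)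
      (regInv lam (M.features A hist)
        (M.episodeFeatures (A t hist) (M.rollout M.Wstar (A t hist) ξ) h))) :
    min 1 (ENNReal.ofReal (∑ h, x h)) ≤
      ENNReal.ofReal (4 * b) * ENNReal.ofReal (M.episodeGain lam A hist ξ) := by
  set g := M.episodeFeatures (A t hist) (M.rollout M.Wstar (A t hist) ξ) with hg
  set s := ∑ h, inner ℝ (g h) (regInv lam (M.features A hist) (g h)) with hs
  have hs0 : 0 ≤ s := Finset.sum_nonneg fun h _ => inner_regInv_self_nonneg hlam _ _
  have hsum : ∑ h, x h ≤ 4 * b * s := by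
    rw [hs, Finset.mul_sum]
    exact Finset.sum_le_sum fun h _ => hx h
  have hDpos := detRatio_pos hlam (M.features A hist)
  have hlog : Real.log (1 + s) ≤ Real.log (detRatio lam (Sum.elim (M.features A hist) g)) -
      M.logDet lam A hist := by
    have h := Real.log_le_log (by positivity) (detRatio_mul_one_add_sum_le hlam
      (M.features A hist) g)
    rw [Real.log_mul hDpos.ne' (by positivity)] at h
    rw [logDet]
    linarith
  have hgain : M.episodeGain lam A hist ξ = min 1 (2 *
      (Real.log (detRatio lam (Sum.elim (M.features A hist) g)) - M.logDet lam A hist)) := rfl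
  rw [← ENNReal.ofReal_mul (by linarith)]
  rcases le_total s 1 with h1 | h1
  · refine (min_le_right _ _).trans (ENNReal.ofReal_le_ofReal (hsum.trans ?_))
    refine mul_le_mul_of_nonneg_left ?_ (by linarith)
    rw [hgain]
    exact le_min h1 ((le_two_mul_log_one_add hs0 h1).trans (by linarith))
  · refine (min_le_left _ _).trans ?_
    have h2 := le_two_mul_log_one_add zero_le_one le_rfl
    have h3 : Real.log (1 + 1) ≤ Real.log (1 + s) :=
      Real.log_le_log (by norm_num) (by linarith)
    rw [hgain, min_eq_left (by linarith), mul_one]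
    exact ENNReal.one_le_ofReal.2 hb

end LogDet

section Episode

variable [BorelSpace E] {A : Algorithm d H U} {lam : ℝ} {Pol : Set (Policy d H U)}

theorem J_Wstar_le_secondMoment (M : KNR d H U E) {π : Policy d H U}
    (hπ : ∀ h, Measurable fun x => π x h) {c : State d × U → ℝ≥0} (hc : Measurable c) :
    M.J π c M.Wstar ≤ M.secondMoment π c ^ (1 / 2 : ℝ) := by
  have hπ' : ∀ h, Measurable fun p : (Fin H → State d) × State d => π p.2 h :=
    fun h => (hπ h).comp measurable_snd
  have hroll : Measurable fun ξ => M.rollout M.Wstar π ξ :=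
    M.measurable_rollout M.Wstar (π := fun _ : Fin H → State d => π) hπ' measurable_id
  have hX : Measurable fun ξ => (trajCost c π (M.rollout M.Wstar π ξ) : ℝ≥0∞) :=
    (measurable_trajCost (π := fun _ : Fin H → State d => π) hc hπ' hroll).coe_nnreal_ennreal
  have h := ENNReal.lintegral_mul_le_Lp_mul_Lq (episodeNoise d H M.σ)
    Real.HolderConjugate.two_two hX.aemeasurable (g := fun _ => 1) aemeasurable_const
  simpa [J, secondMoment] using h

variable [CompleteSpace E] [SecondCountableTopology E]

/-- Optimism with infima that need not be attained: the simulation bound has the same error for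
every W in the confidence set, so it passes to the infimum, which is compared with the value of any
policy at `Wstar`. -/
theorem J_Wstar_le_Jopt_add (M : KNR d H U E) (hW : M.Wstar ≠ 0)
    (hlam : lam = M.σ ^ 2 / ‖M.Wstar‖ ^ 2) (hPol : ∀ π ∈ Pol, ∀ h, Measurable fun x => π x h)
    {c : State d × U → ℝ≥0} (hc : Measurable c) {t : ℕ} (ht : 1 ≤ t) (hist : History d H t)
    (hA : A t hist ∈ Pol)
    (hgood : M.meanRatio lam A hist ≤ ENNReal.ofReal ((t : ℝ) ^ 2))
    (hopt : ∀ π ∈ Pol, ⨅ W ∈ M.confBall 32 lam A hist, M.J (A t hist) c W ≤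
      ⨅ W ∈ M.confBall 32 lam A hist, M.J π c W) :
    M.J (A t hist) c M.Wstar ≤ M.Jopt Pol c +
      M.secondMoment (A t hist) c ^ (1 / 2 : ℝ) * M.modelError lam A hist ^ (1 / 2 : ℝ) := by
  have hσ := M.σ_pos
  have hWn : 0 < ‖M.Wstar‖ := norm_pos_iff.2 hW
  have hlampos : 0 < lam := by rw [hlam]; positivity
  have hmem := M.Wstar_mem_confBall hlampos ht hist hgood
  have hβ : M.beta 32 lam A hist = M.σ ^ 2 * M.relRadius lam A hist := by
    have htpos : (0 : ℝ) < t := by exact_mod_cast ht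
    -- The choice of λ makes the bias term one unit of σ², so the radius is proportional to the
    -- noise variance.
    have h1 : lam * ‖M.Wstar‖ ^ 2 = M.σ ^ 2 := by
      rw [hlam]
      field_simp
    rw [beta, relRadius, logDet, Real.log_mul htpos.ne' (detRatio_pos hlampos _).ne', h1]
    ring
  have hb := M.le_relRadius hlampos (A := A) hist
  rw [← tsub_le_iff_right]
  have hall : ∀ W ∈ M.confBall 32 lam A hist, M.J (A t hist) c M.Wstar -
      M.secondMoment (A t hist) c ^ (1 / 2 : ℝ) * M.modelError lam A hist ^ (1 / 2 : ℝ) ≤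
        M.J (A t hist) c W := by
    intro W hWm
    rw [tsub_le_iff_right]
    refine (M.J_Wstar_le (hPol _ hA) hc W).trans ?_
    gcongr
    rw [modelError]
    -- 12 = 3 · 4: the constant of the simulation lemma times the one for two members of the
    -- confidence set.
    have h12 : ENNReal.ofReal (12 * M.relRadius lam A hist) =
        3 * ENNReal.ofReal (4 * M.relRadius lam A hist) := by
      rw [show (3 : ℝ≥0∞) = ENNReal.ofReal 3 by simp, ← ENNReal.ofReal_mul (by norm_num)]
      congr 1
      ring
    rw [h12, mul_assoc, ← lintegral_const_mul' _ _ ENNReal.ofReal_ne_top]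
    gcongr with ξ
    refine M.min_one_ofReal_sum_le hlampos hist ξ (by linarith) fun h => ?_
    rw [div_le_iff₀ (by positivity)]
    refine (M.norm_sub_apply_sq_le hlampos hist hmem hWm _).trans (le_of_eq ?_)
    rw [hβ]
    ring
  refine (le_iInf₂ hall).trans ?_
  refine le_iInf₂ fun π hπ => (hopt π hπ).trans ?_
  exact iInf₂_le M.Wstar hmem

theorem J_Wstar_sub_Jopt_le (M : KNR d H U E) (hW : M.Wstar ≠ 0)
    (hlam : lam = M.σ ^ 2 / ‖M.Wstar‖ ^ 2) (hPol : ∀ π ∈ Pol, ∀ h, Measurable fun x => π x h)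
    {c : State d × U → ℝ≥0} (hc : Measurable c) {Vmax α Jstar : ℝ≥0} {t : ℕ} (ht : 1 ≤ t)
    (hist : History d H t) (hA : A t hist ∈ Pol)
    (hV : M.secondMoment (A t hist) c ≤ Vmax)
    (hα : M.secondMoment (A t hist) c ≤ (α * M.J (A t hist) c M.Wstar) ^ 2)
    (hJ : M.Jopt Pol c ≤ Jstar)
    (hgood : M.meanRatio lam A hist ≤ ENNReal.ofReal ((t : ℝ) ^ 2))
    (hopt : ∀ π ∈ Pol, ⨅ W ∈ M.confBall 32 lam A hist, M.J (A t hist) c W ≤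
      ⨅ W ∈ M.confBall 32 lam A hist, M.J π c W) :
    M.J (A t hist) c M.Wstar - M.Jopt Pol c ≤
      α * Jstar * M.modelError lam A hist ^ (1 / 2 : ℝ) +
        α * (Vmax : ℝ≥0∞) ^ (1 / 2 : ℝ) * M.modelError lam A hist := by
  have h := M.J_Wstar_le_Jopt_add hW hlam hPol hc ht hist hA hgood hopt
  set B := M.modelError lam A hist
  set V := M.secondMoment (A t hist) c
  have hVr : V ^ (1 / 2 : ℝ) ≤ (Vmax : ℝ≥0∞) ^ (1 / 2 : ℝ) := by gcongr
  -- The optimism bound is inserted into √V ≤ α J, with √V replaced by √Vmax only in the lower-order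
  -- term.
  have hVα : V ^ (1 / 2 : ℝ) ≤ α * (Jstar + (Vmax : ℝ≥0∞) ^ (1 / 2 : ℝ) * B ^ (1 / 2 : ℝ)) := by
    calc V ^ (1 / 2 : ℝ) ≤ ((α * M.J (A t hist) c M.Wstar) ^ 2) ^ (1 / 2 : ℝ) := by gcongr
      _ = α * M.J (A t hist) c M.Wstar := by
          rw [← ENNReal.rpow_natCast, ← ENNReal.rpow_mul]
          norm_num
      _ ≤ _ := by
          gcongr
          exact h.trans (by gcongr)
  have hBB : B ^ (1 / 2 : ℝ) * B ^ (1 / 2 : ℝ) = B := by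
    rw [← ENNReal.rpow_add_of_nonneg _ _ (by norm_num) (by norm_num)]
    norm_num
  rw [tsub_le_iff_left]
  refine h.trans ?_
  gcongr
  calc V ^ (1 / 2 : ℝ) * B ^ (1 / 2 : ℝ)
      ≤ α * (Jstar + (Vmax : ℝ≥0∞) ^ (1 / 2 : ℝ) * B ^ (1 / 2 : ℝ)) * B ^ (1 / 2 : ℝ) := by gcongr
    _ = α * Jstar * B ^ (1 / 2 : ℝ) +
        α * (Vmax : ℝ≥0∞) ^ (1 / 2 : ℝ) * (B ^ (1 / 2 : ℝ) * B ^ (1 / 2 : ℝ)) := by ring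
    _ = _ := by rw [hBB]

end Episode

end KNR

/-! ### Expected model errors summed over the episodes. -/

namespace KNR

variable {d H : ℕ} {U E : Type*} [MeasurableSpace U] [NormedAddCommGroup E]
  [InnerProductSpace ℝ E] [MeasurableSpace E]

instance isProbabilityMeasure_fullNoise (d H : ℕ) (σ : ℝ) :
    IsProbabilityMeasure (fullNoise d H σ) := by
  unfold fullNoise; infer_instance

section Gain

variable [CompleteSpace E] {A : Algorithm d H U} {lam : ℝ} {Pol : Set (Policy d H U)}

theorem episodeGain_runHist_nonneg (M : KNR d H U E) (hlam : 0 < lam) (ω : ℕ → Fin H → State d)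
    (t : ℕ) : 0 ≤ M.episodeGain lam A (M.runHist A ω t) (ω t) := by
  rw [episodeGain_runHist]
  have := M.monotone_logDet hlam (A := A) ω (Nat.le_succ t)
  exact le_min zero_le_one (by simp only at this; linarith)

theorem lintegral_relRadius_le (M : KNR d H U E) (hlam : 0 < lam) (hA : IsAlgorithm Pol A)
    {t T : ℕ} (htT : t < T) :
    ∫⁻ ω, ENNReal.ofReal (12 * M.relRadius lam A (M.runHist A ω t)) ∂(fullNoise d H M.σ) ≤
      384 * (1 + d + ENNReal.ofReal (Real.log T) + M.gamma Pol lam T) := by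
  have hγ : ∫⁻ ω, ENNReal.ofReal (M.logDet lam A (M.runHist A ω T)) ∂(fullNoise d H M.σ) ≤
      M.gamma Pol lam T := le_iSup₂ (f := fun (A : Algorithm d H U) (_ : IsAlgorithm Pol A) =>
    ∫⁻ ω, ENNReal.ofReal (M.logDet lam A (M.runHist A ω T)) ∂(fullNoise d H M.σ)) A hA
  have hlog : Real.log t ≤ Real.log T := by
    rcases Nat.eq_zero_or_pos t with rfl | ht
    · simpa using Real.log_natCast_nonneg T
    · exact Real.log_le_log (by exact_mod_cast ht) (by exact_mod_cast htT.le)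
  have hlogT : 0 ≤ Real.log T := Real.log_natCast_nonneg T
  calc _ ≤ ∫⁻ ω, 384 * ((1 + d + ENNReal.ofReal (Real.log T)) +
        ENNReal.ofReal (M.logDet lam A (M.runHist A ω T))) ∂(fullNoise d H M.σ) := by
        refine lintegral_mono fun ω => ?_
        have hmono : M.logDet lam A (M.runHist A ω t) ≤ M.logDet lam A (M.runHist A ω T) :=
          M.monotone_logDet hlam (A := A) ω htT.le
        have hL := M.logDet_nonneg hlam (A := A) (M.runHist A ω T)
        have hd : (0 : ℝ) ≤ d := Nat.cast_nonneg d
        have he : 384 * ((1 + d + ENNReal.ofReal (Real.log T)) +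
            ENNReal.ofReal (M.logDet lam A (M.runHist A ω T))) =
            ENNReal.ofReal (384 * (1 + d + Real.log T + M.logDet lam A (M.runHist A ω T))) := by
          rw [ENNReal.ofReal_mul (by norm_num), ENNReal.ofReal_add (by positivity) hL,
            ENNReal.ofReal_add (by positivity) hlogT, ENNReal.ofReal_add zero_le_one hd]
          simp
        simp only
        rw [he]
        refine ENNReal.ofReal_le_ofReal ?_
        rw [relRadius]
        linarith
    _ = 384 * ((1 + d + ENNReal.ofReal (Real.log T)) +
        ∫⁻ ω, ENNReal.ofReal (M.logDet lam A (M.runHist A ω T)) ∂(fullNoise d H M.σ)) := by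
        rw [lintegral_const_mul' _ _ (by simp), lintegral_add_left measurable_const]
        simp
    _ ≤ _ := by gcongr

end Gain

section Sums

variable [BorelSpace E] [SecondCountableTopology E] {A : Algorithm d H U} {lam : ℝ}
  {Pol : Set (Policy d H U)}

theorem measurable_logDet (M : KNR d H U E) (hA : IsAlgorithm Pol A) {t : ℕ} :
    Measurable fun hist : History d H t => M.logDet lam A hist :=
  (measurable_detRatio lam (M.measurable_features hA)).log

theorem measurable_episodeGain (M : KNR d H U E) (hA : IsAlgorithm Pol A) {t : ℕ} :
    Measurable fun p : History d H t × (Fin H → State d) => M.episodeGain lam A p.1 p.2 := by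
  have hπ : ∀ h, Measurable fun p : (History d H t × (Fin H → State d)) × State d =>
      A t p.1.1 p.2 h := fun h =>
    (hA.measurable t h).comp (f := fun p : (History d H t × (Fin H → State d)) × State d =>
      (p.1.1, p.2)) (by fun_prop)
  have hroll : Measurable fun p : History d H t × (Fin H → State d) =>
      M.rollout M.Wstar (A t p.1) p.2 :=
    M.measurable_rollout M.Wstar (π := fun p : History d H t × (Fin H → State d) => A t p.1) hπ
      measurable_snd
  have hf : ∀ i, Measurable fun p : History d H t × (Fin H → State d) =>
      Sum.elim (M.features A p.1)
        (M.episodeFeatures (A t p.1) (M.rollout M.Wstar (A t p.1) p.2)) i := by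
    rintro (i | h)
    · exact (M.measurable_features hA i).comp measurable_fst
    · exact M.measurable_episodeFeatures
        (π := fun p : History d H t × (Fin H → State d) => A t p.1) hπ hroll h
  have h1 := (measurable_detRatio lam hf).log
  have h2 : Measurable fun p : History d H t × (Fin H → State d) => M.logDet lam A p.1 :=
    (M.measurable_logDet hA).comp measurable_fst
  unfold episodeGain
  exact measurable_const.min ((h1.sub h2).const_mul 2)

theorem measurable_relRadius (M : KNR d H U E) (hA : IsAlgorithm Pol A) {t : ℕ} :
    Measurable fun hist : History d H t => M.relRadius lam A hist := by
  have h := M.measurable_logDet hA (lam := lam) (t := t)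
  unfold relRadius
  fun_prop

theorem measurable_lintegral_episodeGain (M : KNR d H U E) (hA : IsAlgorithm Pol A) {t : ℕ} :
    Measurable fun hist : History d H t =>
      ∫⁻ ξ, ENNReal.ofReal (M.episodeGain lam A hist ξ) ∂(episodeNoise d H M.σ) :=
  (M.measurable_episodeGain hA).ennreal_ofReal.lintegral_prod_right'

theorem measurable_modelError (M : KNR d H U E) (hA : IsAlgorithm Pol A) {t : ℕ} :
    Measurable fun hist : History d H t => M.modelError lam A hist :=
  ((M.measurable_relRadius hA).const_mul 12).ennreal_ofReal.mul
    (M.measurable_lintegral_episodeGain hA)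

theorem measurable_episodeGain_runHist (M : KNR d H U E) (hA : IsAlgorithm Pol A) (t : ℕ) :
    Measurable fun ω => M.episodeGain lam A (M.runHist A ω t) (ω t) := by
  have hp : Measurable fun ω : ℕ → Fin H → State d => (M.runHist A ω t, ω t) :=
    (M.measurable_runHist hA t).prodMk (measurable_pi_apply t)
  have h := (M.measurable_episodeGain hA (lam := lam) (t := t)).comp hp
  exact h

theorem lintegral_lintegral_episodeGain (M : KNR d H U E) (hA : IsAlgorithm Pol A) (t : ℕ) :
    ∫⁻ ω, ∫⁻ ξ, ENNReal.ofReal (M.episodeGain lam A (M.runHist A ω t) ξ)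
      ∂(episodeNoise d H M.σ) ∂(fullNoise d H M.σ) =
    ∫⁻ ω, ENNReal.ofReal (M.episodeGain lam A (M.runHist A ω t) (ω t)) ∂(fullNoise d H M.σ) :=
  (M.lintegral_runHist_episode hA t (M.measurable_episodeGain hA).ennreal_ofReal).symm

/-- The radius depends on the history only, so the resampled gain can be replaced by the realized
one, and realized gains telescope. -/
theorem lintegral_modelError (M : KNR d H U E) (hA : IsAlgorithm Pol A) (t : ℕ) :
    ∫⁻ ω, M.modelError lam A (M.runHist A ω t) ∂(fullNoise d H M.σ) =
    ∫⁻ ω, ENNReal.ofReal (12 * M.relRadius lam A (M.runHist A ω t)) *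
      ENNReal.ofReal (M.episodeGain lam A (M.runHist A ω t) (ω t)) ∂(fullNoise d H M.σ) := by
  have h1 : Measurable fun p : History d H t × (Fin H → State d) =>
      ENNReal.ofReal (12 * M.relRadius lam A p.1) :=
    (((M.measurable_relRadius hA).const_mul 12).ennreal_ofReal).comp measurable_fst
  have h := M.lintegral_runHist_episode hA t
    (h1.mul (M.measurable_episodeGain hA (lam := lam)).ennreal_ofReal)
  simp only [Pi.mul_apply] at h
  rw [h]
  refine lintegral_congr fun ω => ?_
  rw [lintegral_const_mul' _ _ ENNReal.ofReal_ne_top, modelError]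

variable [CompleteSpace E]

theorem sum_lintegral_episodeGain_le (M : KNR d H U E) (hlam : 0 < lam) (hA : IsAlgorithm Pol A)
    (T : ℕ) :
    ∑ t ∈ Finset.range T, ∫⁻ ω, ENNReal.ofReal (M.episodeGain lam A (M.runHist A ω t) (ω t))
      ∂(fullNoise d H M.σ) ≤ 2 * M.gamma Pol lam T := by
  rw [← lintegral_finsetSum _ fun t _ => (M.measurable_episodeGain_runHist hA t).ennreal_ofReal]
  have hγ : ∫⁻ ω, ENNReal.ofReal (M.logDet lam A (M.runHist A ω T)) ∂(fullNoise d H M.σ) ≤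
      M.gamma Pol lam T := le_iSup₂ (f := fun (A : Algorithm d H U) (_ : IsAlgorithm Pol A) =>
    ∫⁻ ω, ENNReal.ofReal (M.logDet lam A (M.runHist A ω T)) ∂(fullNoise d H M.σ)) A hA
  calc _ ≤ ∫⁻ ω, 2 * ENNReal.ofReal (M.logDet lam A (M.runHist A ω T)) ∂(fullNoise d H M.σ) := by
        refine lintegral_mono fun ω => ?_
        simp only
        rw [← ENNReal.ofReal_sum_of_nonneg fun t _ => M.episodeGain_runHist_nonneg hlam ω t,
          show (2 : ℝ≥0∞) = ENNReal.ofReal 2 by simp, ← ENNReal.ofReal_mul (by norm_num)]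
        refine ENNReal.ofReal_le_ofReal ?_
        simp only [episodeGain_runHist]
        exact sum_min_le (L := fun t => M.logDet lam A (M.runHist A ω t)) (M.logDet_zero _) T
    _ = 2 * ∫⁻ ω, ENNReal.ofReal (M.logDet lam A (M.runHist A ω T)) ∂(fullNoise d H M.σ) :=
        lintegral_const_mul' _ _ (by simp)
    _ ≤ _ := by gcongr

/-- Cauchy–Schwarz twice: over the noise, to separate radius and gain so that first moments suffice,
then over the episodes, to produce √T. -/
theorem sum_lintegral_sqrt_modelError_le (M : KNR d H U E) (hlam : 0 < lam) (hd : 1 ≤ d)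
    (hA : IsAlgorithm Pol A) (T : ℕ) :
    ∑ t ∈ Finset.range T, ∫⁻ ω, M.modelError lam A (M.runHist A ω t) ^ (1 / 2 : ℝ)
      ∂(fullNoise d H M.σ) ≤
        40 * M.dTildeSq Pol lam T ^ (1 / 2 : ℝ) * (T : ℝ≥0∞) ^ (1 / 2 : ℝ) := by
  set Q : ℝ≥0∞ := 384 * (1 + d + ENNReal.ofReal (Real.log T) + M.gamma Pol lam T) with hQ
  set G : ℕ → ℝ≥0∞ := fun t => ∫⁻ ω,
    ENNReal.ofReal (M.episodeGain lam A (M.runHist A ω t) (ω t)) ∂(fullNoise d H M.σ) with hG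
  have hsq : ∀ x : ℝ≥0∞, (x ^ (1 / 2 : ℝ)) ^ (2 : ℝ) = x := fun x => by
    rw [← ENNReal.rpow_mul]
    norm_num
  have hstep : ∀ t ∈ Finset.range T,
      ∫⁻ ω, M.modelError lam A (M.runHist A ω t) ^ (1 / 2 : ℝ) ∂(fullNoise d H M.σ) ≤
        Q ^ (1 / 2 : ℝ) * G t ^ (1 / 2 : ℝ) := by
    intro t ht
    have hm1 : Measurable fun ω => ENNReal.ofReal (12 * M.relRadius lam A (M.runHist A ω t)) :=
      (((M.measurable_relRadius hA).comp (M.measurable_runHist hA t)).const_mul 12).ennreal_ofReal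
    have hm2 : Measurable fun ω => ∫⁻ ξ, ENNReal.ofReal (M.episodeGain lam A (M.runHist A ω t) ξ)
        ∂(episodeNoise d H M.σ) :=
      (M.measurable_lintegral_episodeGain hA).comp (M.measurable_runHist hA t)
    have h := ENNReal.lintegral_mul_le_Lp_mul_Lq (fullNoise d H M.σ)
      Real.HolderConjugate.two_two (hm1.pow_const (1 / 2 : ℝ)).aemeasurable
      (hm2.pow_const (1 / 2 : ℝ)).aemeasurable
    simp only [Pi.mul_apply, hsq] at h
    rw [M.lintegral_lintegral_episodeGain hA t] at h
    calc _ = ∫⁻ ω, ENNReal.ofReal (12 * M.relRadius lam A (M.runHist A ω t)) ^ (1 / 2 : ℝ) *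
          (∫⁻ ξ, ENNReal.ofReal (M.episodeGain lam A (M.runHist A ω t) ξ)
            ∂(episodeNoise d H M.σ)) ^ (1 / 2 : ℝ) ∂(fullNoise d H M.σ) := by
          refine lintegral_congr fun ω => ?_
          rw [modelError, ENNReal.mul_rpow_of_nonneg _ _ (by norm_num)]
      _ ≤ _ := h
      _ ≤ _ := by
          gcongr
          exact M.lintegral_relRadius_le hlam hA (Finset.mem_range.1 ht)
  have hcs := ENNReal.inner_le_Lp_mul_Lq (Finset.range T) (fun _ => (1 : ℝ≥0∞))
    (fun t => G t ^ (1 / 2 : ℝ)) Real.HolderConjugate.two_two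
  simp only [hsq, one_mul, ENNReal.one_rpow, Finset.sum_const, Finset.card_range, nsmul_eq_mul,
    mul_one] at hcs
  have hGsum : ∑ t ∈ Finset.range T, G t ≤ 2 * M.gamma Pol lam T :=
    M.sum_lintegral_episodeGain_le hlam hA T
  -- 384 · 2 · 2 = 1536 ≤ 40²; one factor 2 comes from absorbing the constant 1 into d ≥ 1.
  have hQγ : Q * (2 * M.gamma Pol lam T) ≤ 40 ^ 2 * M.dTildeSq Pol lam T := by
    have hd' : (1 : ℝ≥0∞) ≤ d := by exact_mod_cast hd
    rw [hQ, dTildeSq]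
    calc _ ≤ 384 * (d + d + ENNReal.ofReal (Real.log T) + M.gamma Pol lam T) *
          (2 * M.gamma Pol lam T) := by gcongr
      _ ≤ 384 * (2 * (M.gamma Pol lam T + d + ENNReal.ofReal (Real.log T) + H)) *
          (2 * M.gamma Pol lam T) := by
          gcongr
          generalize ENNReal.ofReal (Real.log T) = a
          generalize M.gamma Pol lam T = b
          calc (d : ℝ≥0∞) + d + a + b ≤ d + d + a + b + (a + b + 2 * H) := le_self_add
            _ = _ := by ring
      _ = 1536 * (M.gamma Pol lam T *
          (M.gamma Pol lam T + d + ENNReal.ofReal (Real.log T) + H)) := by ring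
      _ ≤ _ := by
          gcongr
          norm_num
  calc _ ≤ ∑ t ∈ Finset.range T, Q ^ (1 / 2 : ℝ) * G t ^ (1 / 2 : ℝ) := Finset.sum_le_sum hstep
    _ = Q ^ (1 / 2 : ℝ) * ∑ t ∈ Finset.range T, G t ^ (1 / 2 : ℝ) := by rw [Finset.mul_sum]
    _ ≤ Q ^ (1 / 2 : ℝ) *
        ((T : ℝ≥0∞) ^ (1 / 2 : ℝ) * (2 * M.gamma Pol lam T) ^ (1 / 2 : ℝ)) := by
        gcongr
        exact hcs.trans (by gcongr)
    _ = (Q * (2 * M.gamma Pol lam T)) ^ (1 / 2 : ℝ) * (T : ℝ≥0∞) ^ (1 / 2 : ℝ) := by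
        rw [ENNReal.mul_rpow_of_nonneg Q _ (by norm_num)]
        ring
    _ ≤ (40 ^ 2 * M.dTildeSq Pol lam T) ^ (1 / 2 : ℝ) * (T : ℝ≥0∞) ^ (1 / 2 : ℝ) := by gcongr
    _ = _ := by
        rw [ENNReal.mul_rpow_of_nonneg _ _ (by norm_num), ← ENNReal.rpow_natCast,
          ← ENNReal.rpow_mul]
        norm_num

/-- Radius and gain are correlated and cannot be separated here by first moments, so the sum is
bounded pathwise before integration; the product of log-determinant and gain is the source of
`gamma₂`. -/
theorem sum_lintegral_modelError_le (M : KNR d H U E) (hlam : 0 < lam) (hd : 1 ≤ d)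
    (hA : IsAlgorithm Pol A) (T : ℕ) :
    ∑ t ∈ Finset.range T, ∫⁻ ω, M.modelError lam A (M.runHist A ω t) ∂(fullNoise d H M.σ) ≤
      1920 * (M.dTildeSq Pol lam T + M.gamma₂ Pol lam T) := by
  rcases T with _ | n
  · simp
  set T := n + 1 with hT
  have hγ : ∫⁻ ω, ENNReal.ofReal (M.logDet lam A (M.runHist A ω T)) ∂(fullNoise d H M.σ) ≤
      M.gamma Pol lam T := le_iSup₂ (f := fun (A : Algorithm d H U) (_ : IsAlgorithm Pol A) =>
    ∫⁻ ω, ENNReal.ofReal (M.logDet lam A (M.runHist A ω T)) ∂(fullNoise d H M.σ)) A hA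
  have hγ₂ : ∫⁻ ω, ENNReal.ofReal (M.logDet lam A (M.runHist A ω n) ^ 2) ∂(fullNoise d H M.σ) ≤
      M.gamma₂ Pol lam T := le_iSup₂ (f := fun (A : Algorithm d H U) (_ : IsAlgorithm Pol A) =>
    ∫⁻ ω, ENNReal.ofReal (M.logDet lam A (M.runHist A ω n) ^ 2) ∂(fullNoise d H M.σ)) A hA
  have hlogT : 0 ≤ Real.log T := Real.log_natCast_nonneg T
  have hd0 : (1 : ℝ) ≤ d := by exact_mod_cast hd
  have hmL : Measurable fun ω => ENNReal.ofReal (M.logDet lam A (M.runHist A ω T)) :=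
    ((M.measurable_logDet hA).comp (M.measurable_runHist hA T)).ennreal_ofReal
  simp_rw [M.lintegral_modelError hA]
  have hmeas : ∀ t, Measurable fun ω => ENNReal.ofReal (12 * M.relRadius lam A (M.runHist A ω t)) *
      ENNReal.ofReal (M.episodeGain lam A (M.runHist A ω t) (ω t)) := fun t =>
    (((M.measurable_relRadius hA).comp (M.measurable_runHist hA t)).const_mul 12).ennreal_ofReal.mul
      (M.measurable_episodeGain_runHist hA t).ennreal_ofReal
  rw [← lintegral_finsetSum _ fun t _ => hmeas t]
  calc _ ≤ ∫⁻ ω, (384 * (5 * d + 2 * ENNReal.ofReal (Real.log T)) *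
        ENNReal.ofReal (M.logDet lam A (M.runHist A ω T)) +
        768 * ENNReal.ofReal (M.logDet lam A (M.runHist A ω n) ^ 2)) ∂(fullNoise d H M.σ) := by
        refine lintegral_mono fun ω => ?_
        set L : ℕ → ℝ := fun t => M.logDet lam A (M.runHist A ω t) with hL
        have hL0 : L 0 = 0 := M.logDet_zero _
        have hLm : Monotone L := M.monotone_logDet hlam ω
        have hLpos : ∀ t, 0 ≤ L t := fun t => M.logDet_nonneg hlam _
        have hg0 : ∀ t, 0 ≤ min 1 (2 * (L (t + 1) - L t)) := fun t =>
          le_min zero_le_one (by linarith [hLm (Nat.le_succ t)])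
        have hr0 : ∀ t, 0 ≤ 12 * M.relRadius lam A (M.runHist A ω t) := fun t => by
          linarith [M.le_relRadius hlam (A := A) (M.runHist A ω t)]
        simp only [episodeGain_runHist]
        rw [show 384 * (5 * d + 2 * ENNReal.ofReal (Real.log T)) * ENNReal.ofReal (L T) +
          768 * ENNReal.ofReal (L n ^ 2) = ENNReal.ofReal
            (384 * (5 * d + 2 * Real.log T) * L T + 768 * L n ^ 2) by
          rw [ENNReal.ofReal_add (mul_nonneg (by positivity) (hLpos T)) (by positivity),
            ENNReal.ofReal_mul (by positivity), ENNReal.ofReal_mul (by norm_num),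
            ENNReal.ofReal_add (by positivity) (by positivity),
            ENNReal.ofReal_mul (by norm_num), ENNReal.ofReal_mul (by norm_num),
            ENNReal.ofReal_mul (by norm_num)]
          simp]
        simp_rw [← ENNReal.ofReal_mul (hr0 _)]
        rw [← ENNReal.ofReal_sum_of_nonneg fun t _ => mul_nonneg (hr0 t) (hg0 t)]
        refine ENNReal.ofReal_le_ofReal ?_
        have h1 := sum_min_le hL0 T
        have h2 := sum_mul_min_le hL0 hLm n
        have h3 : L n ≤ L T := hLm (Nat.le_succ n)
        calc _ ≤ ∑ t ∈ Finset.range T, 384 * ((1 + d + Real.log T) *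
              min 1 (2 * (L (t + 1) - L t)) + L t * min 1 (2 * (L (t + 1) - L t))) := by
              refine Finset.sum_le_sum fun t ht => ?_
              have hlog : Real.log t ≤ Real.log T := by
                rcases Nat.eq_zero_or_pos t with rfl | ht'
                · simpa using hlogT
                · exact Real.log_le_log (by exact_mod_cast ht')
                    (by exact_mod_cast (Finset.mem_range.1 ht).le)
              rw [← add_mul, ← mul_assoc]
              refine mul_le_mul_of_nonneg_right ?_ (hg0 t)
              have : M.relRadius lam A (M.runHist A ω t) = 32 * (1 + d + Real.log t + L t) := rfl
              linarith
          _ = 384 * ((1 + d + Real.log T) * ∑ t ∈ Finset.range T, min 1 (2 * (L (t + 1) - L t)) +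
              ∑ t ∈ Finset.range T, L t * min 1 (2 * (L (t + 1) - L t))) := by
              rw [← Finset.mul_sum, Finset.sum_add_distrib, ← Finset.mul_sum]
          _ ≤ 384 * ((1 + d + Real.log T) * (2 * L T) + (2 * L n ^ 2 + L n)) := by gcongr
          -- Uses 2(1 + d) + 1 ≤ 5d for d ≥ 1; the later constant is 1920 = 384 · 5.
          _ ≤ _ := by nlinarith [mul_le_mul_of_nonneg_right hd0 (hLpos T)]
    _ = 384 * (5 * d + 2 * ENNReal.ofReal (Real.log T)) *
        ∫⁻ ω, ENNReal.ofReal (M.logDet lam A (M.runHist A ω T)) ∂(fullNoise d H M.σ) +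
        768 * ∫⁻ ω, ENNReal.ofReal (M.logDet lam A (M.runHist A ω n) ^ 2) ∂(fullNoise d H M.σ) := by
        rw [lintegral_add_left (hmL.const_mul _), lintegral_const_mul _ hmL,
          lintegral_const_mul' _ _ (by simp)]
    _ ≤ 384 * (5 * d + 2 * ENNReal.ofReal (Real.log T)) * M.gamma Pol lam T +
        768 * M.gamma₂ Pol lam T := by gcongr
    _ ≤ 1920 * M.dTildeSq Pol lam T + 1920 * M.gamma₂ Pol lam T := by
        refine add_le_add ?_ (by gcongr; norm_num)
        rw [dTildeSq]
        generalize ENNReal.ofReal (Real.log T) = a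
        generalize M.gamma Pol lam T = b
        calc 384 * (5 * (d : ℝ≥0∞) + 2 * a) * b
            ≤ 384 * (5 * (d : ℝ≥0∞) + 2 * a) * b + (1152 * a + 1920 * b + 1920 * H) * b :=
              le_self_add
          _ = _ := by ring
    _ = _ := by ring

end Sums

end KNR

/-! ### From single episodes to the expected regret. -/

namespace KNR

variable {d H : ℕ} {U E : Type*} [MeasurableSpace U] [NormedAddCommGroup E]
  [InnerProductSpace ℝ E] [MeasurableSpace E]

section Regret

variable [BorelSpace E] {A : Algorithm d H U} {lam : ℝ} {Pol : Set (Policy d H U)}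

theorem measurable_trajCost_episode (M : KNR d H U E) (hA : IsAlgorithm Pol A) {t : ℕ}
    {c : State d × U → ℝ≥0} (hc : Measurable c) :
    Measurable fun p : History d H t × (Fin H → State d) =>
      trajCost c (A t p.1) (M.rollout M.Wstar (A t p.1) p.2) := by
  have hπ : ∀ h, Measurable fun p : (History d H t × (Fin H → State d)) × State d =>
      A t p.1.1 p.2 h := fun h =>
    (hA.measurable t h).comp (f := fun p : (History d H t × (Fin H → State d)) × State d =>
      (p.1.1, p.2)) (by fun_prop)
  exact measurable_trajCost (π := fun p : History d H t × (Fin H → State d) => A t p.1) hc hπ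
    (M.measurable_rollout M.Wstar (π := fun p : History d H t × (Fin H → State d) => A t p.1) hπ
      measurable_snd)

theorem lintegral_trajCost_run (M : KNR d H U E) (hA : IsAlgorithm Pol A)
    {c : State d × U → ℝ≥0} (hc : Measurable c) (t : ℕ) :
    ∫⁻ ω, (trajCost c (A t (M.runHist A ω t)) (M.run A ω t) : ℝ≥0∞) ∂(fullNoise d H M.σ) =
      ∫⁻ ω, M.J (A t (M.runHist A ω t)) c M.Wstar ∂(fullNoise d H M.σ) := by
  have h := M.lintegral_runHist_episode hA t
    (M.measurable_trajCost_episode hA (t := t) hc).coe_nnreal_ennreal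
  simp only [run_eq]
  exact h

theorem measurable_trajCost_run (M : KNR d H U E) (hA : IsAlgorithm Pol A)
    {c : State d × U → ℝ≥0} (hc : Measurable c) (t : ℕ) :
    Measurable fun ω => trajCost c (A t (M.runHist A ω t)) (M.run A ω t) := by
  have hp : Measurable fun ω : ℕ → Fin H → State d => (M.runHist A ω t, ω t) :=
    (M.measurable_runHist hA t).prodMk (measurable_pi_apply t)
  have h := (M.measurable_trajCost_episode hA (t := t) hc).comp hp
  simp only [run_eq]
  exact h

variable {c : ℕ → State d × U → ℝ≥0} {Vmax : ℝ≥0}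

theorem J_Wstar_le_sqrt (M : KNR d H U E) {π : Policy d H U}
    (hπ : ∀ h, Measurable fun x => π x h) {c : State d × U → ℝ≥0} (hc : Measurable c)
    (hV : M.secondMoment π c ≤ Vmax) : M.J π c M.Wstar ≤ (Vmax : ℝ≥0∞) ^ (1 / 2 : ℝ) :=
  (M.J_Wstar_le_secondMoment hπ hc).trans (by gcongr)

theorem lintegral_J_runHist_ne_top (M : KNR d H U E) (hA : IsAlgorithm Pol A)
    (hPol : ∀ π ∈ Pol, ∀ h, Measurable fun x => π x h) (hc : ∀ t, Measurable (c t))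
    (hV : ∀ t, ∀ π ∈ Pol, M.secondMoment π (c t) ≤ Vmax) (t : ℕ) :
    ∫⁻ ω, M.J (A t (M.runHist A ω t)) (c t) M.Wstar ∂(fullNoise d H M.σ) ≠ ⊤ := by
  have h : ∫⁻ ω, M.J (A t (M.runHist A ω t)) (c t) M.Wstar ∂(fullNoise d H M.σ) ≤
      ∫⁻ _, (Vmax : ℝ≥0∞) ^ (1 / 2 : ℝ) ∂(fullNoise d H M.σ) :=
    lintegral_mono fun ω => M.J_Wstar_le_sqrt (hPol _ (hA.mem _ _)) (hc t) (hV t _ (hA.mem _ _))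
  refine ne_top_of_le_ne_top ?_ h
  simp

theorem integrable_trajCost_run (M : KNR d H U E) (hA : IsAlgorithm Pol A)
    (hPol : ∀ π ∈ Pol, ∀ h, Measurable fun x => π x h) (hc : ∀ t, Measurable (c t))
    (hV : ∀ t, ∀ π ∈ Pol, M.secondMoment π (c t) ≤ Vmax) (t : ℕ) :
    Integrable (fun ω => (trajCost (c t) (A t (M.runHist A ω t)) (M.run A ω t) : ℝ))
      (fullNoise d H M.σ) := by
  refine ⟨(M.measurable_trajCost_run hA (hc t) t).coe_nnreal_real.aestronglyMeasurable, ?_⟩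
  rw [hasFiniteIntegral_iff_ofNNReal, M.lintegral_trajCost_run hA (hc t)]
  exact (M.lintegral_J_runHist_ne_top hA hPol hc hV t).lt_top

theorem integrable_regret (M : KNR d H U E) (hA : IsAlgorithm Pol A)
    (hPol : ∀ π ∈ Pol, ∀ h, Measurable fun x => π x h) (hc : ∀ t, Measurable (c t))
    (hV : ∀ t, ∀ π ∈ Pol, M.secondMoment π (c t) ≤ Vmax) (T : ℕ) :
    Integrable (M.regret Pol c A T) (fullNoise d H M.σ) :=
  (integrable_finsetSum _ fun t _ => M.integrable_trajCost_run hA hPol hc hV t).sub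
    (integrable_const _)

/-- Conditioning replaces realized costs by values J. Positive parts are taken episode by episode,
so the truncated subtraction of `ℝ≥0∞` is harmless. -/
theorem ofReal_integral_regret_le (M : KNR d H U E) (hA : IsAlgorithm Pol A)
    (hPol : ∀ π ∈ Pol, ∀ h, Measurable fun x => π x h) (hc : ∀ t, Measurable (c t))
    (hV : ∀ t, ∀ π ∈ Pol, M.secondMoment π (c t) ≤ Vmax) (T : ℕ) :
    ENNReal.ofReal (∫ ω, M.regret Pol c A T ω ∂(fullNoise d H M.σ)) ≤
      ∑ t ∈ Finset.range T, ∫⁻ ω, (M.J (A t (M.runHist A ω t)) (c t) M.Wstar -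
        M.Jopt Pol (c t)) ∂(fullNoise d H M.σ) := by
  have hint := M.integrable_trajCost_run hA hPol hc hV
  have heq : ∀ t, ∫ ω, (trajCost (c t) (A t (M.runHist A ω t)) (M.run A ω t) : ℝ)
      ∂(fullNoise d H M.σ) =
        (∫⁻ ω, M.J (A t (M.runHist A ω t)) (c t) M.Wstar ∂(fullNoise d H M.σ)).toReal := by
    intro t
    rw [integral_eq_lintegral_of_nonneg_ae
      (Filter.Eventually.of_forall fun _ => NNReal.coe_nonneg _) (hint t).aestronglyMeasurable, ← M.lintegral_trajCost_run hA (hc t)]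
    simp
  have hsum : ∫ ω, M.regret Pol c A T ω ∂(fullNoise d H M.σ) = ∑ t ∈ Finset.range T,
      ((∫⁻ ω, M.J (A t (M.runHist A ω t)) (c t) M.Wstar ∂(fullNoise d H M.σ)).toReal -
        (M.Jopt Pol (c t)).toReal) := by
    unfold regret
    rw [integral_sub (integrable_finsetSum _ fun t _ => hint t) (integrable_const _),
      integral_finsetSum _ fun t _ => hint t, Finset.sum_sub_distrib]
    simp [heq]
  rw [hsum]
  refine (Finset.le_sum_of_subadditive ENNReal.ofReal ENNReal.ofReal_zero.le
    (fun _ _ => ENNReal.ofReal_add_le) _ _).trans (Finset.sum_le_sum fun t _ => ?_)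
  rw [ENNReal.ofReal_sub _ ENNReal.toReal_nonneg,
    ENNReal.ofReal_toReal (M.lintegral_J_runHist_ne_top hA hPol hc hV t), ENNReal.ofReal_toReal]
  · rw [tsub_le_iff_right]
    calc _ ≤ ∫⁻ ω, ((M.J (A t (M.runHist A ω t)) (c t) M.Wstar - M.Jopt Pol (c t)) +
          M.Jopt Pol (c t)) ∂(fullNoise d H M.σ) := lintegral_mono fun ω => le_tsub_add
      _ = _ := by
          rw [lintegral_add_right _ measurable_const]
          simp
  -- An algorithm supplies a policy at any history, so the policy class is nonempty and the best
  -- value is finite.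
  · have hmem := hA.mem t (fun _ => 0)
    refine ne_top_of_le_ne_top ?_ ((iInf₂_le _ hmem).trans
      (M.J_Wstar_le_sqrt (hPol _ hmem) (hc t) (hV t _ hmem)))
    simp

/-- In the degenerate cases of an empty horizon or of `α < 1` all the costs vanish. -/
theorem ofReal_integral_regret_eq_zero (M : KNR d H U E) (hA : IsAlgorithm Pol A)
    (hPol : ∀ π ∈ Pol, ∀ h, Measurable fun x => π x h) (hc : ∀ t, Measurable (c t))
    (hV : ∀ t, ∀ π ∈ Pol, M.secondMoment π (c t) ≤ Vmax) {α : ℝ≥0}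
    (hα : ∀ t, ∀ π ∈ Pol, M.secondMoment π (c t) ≤ (α * M.J π (c t) M.Wstar) ^ 2)
    (hdeg : H = 0 ∨ α < 1) (T : ℕ) :
    ENNReal.ofReal (∫ ω, M.regret Pol c A T ω ∂(fullNoise d H M.σ)) = 0 := by
  have hJ0 : ∀ t, ∀ π ∈ Pol, M.J π (c t) M.Wstar = 0 := by
    intro t π hπ
    rcases hdeg with rfl | hα1
    · simp [J, trajCost]
    -- The mean is at most the root of the second moment, hence at most α times itself; being
    -- finite, it vanishes when α < 1.
    · have h1 : M.J π (c t) M.Wstar ≤ α * M.J π (c t) M.Wstar := by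
        refine (M.J_Wstar_le_secondMoment (hPol π hπ) (hc t)).trans ?_
        calc _ ≤ ((α * M.J π (c t) M.Wstar) ^ 2) ^ (1 / 2 : ℝ) := by
              gcongr
              exact hα t π hπ
          _ = _ := by
              rw [← ENNReal.rpow_natCast, ← ENNReal.rpow_mul]
              norm_num
      have htop : M.J π (c t) M.Wstar ≠ ⊤ := ne_top_of_le_ne_top (by simp)
        (M.J_Wstar_le_sqrt (hPol π hπ) (hc t) (hV t π hπ))
      by_contra h0
      have h2 : α * M.J π (c t) M.Wstar < 1 * M.J π (c t) M.Wstar :=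
        ENNReal.mul_lt_mul_left h0 htop (by exact_mod_cast hα1)
      rw [one_mul] at h2
      exact absurd h1 (not_le.2 h2)
  refine le_antisymm ((M.ofReal_integral_regret_le hA hPol hc hV T).trans ?_) (zero_le)
  simp [hJ0 _ _ (hA.mem _ _)]

variable [SecondCountableTopology E] [CompleteSpace E]

/-- The event that the confidence set of episode `t` may fail to contain `Wstar`. -/
def badEvent (M : KNR d H U E) (lam : ℝ) (A : Algorithm d H U) (t : ℕ) :
    Set (ℕ → Fin H → State d) :=
  {ω | t = 0 ∨ ENNReal.ofReal ((t : ℝ) ^ 2) ≤ M.meanRatio lam A (M.runHist A ω t)}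

theorem measurableSet_badEvent (M : KNR d H U E) (hlam : 0 < lam) (hA : IsAlgorithm Pol A)
    (t : ℕ) : MeasurableSet (M.badEvent lam A t) :=
  (MeasurableSet.const _).union (measurableSet_le measurable_const
    ((M.measurable_meanRatio hlam hA).comp (M.measurable_runHist hA t)))

/-- Episode 0, whose initial set is arbitrary, counts as bad and contributes at most 1; the inverse
squares from t = 1 on contribute at most 2. -/
theorem sum_measure_badEvent_le (M : KNR d H U E) (hlam : 0 < lam) (hA : IsAlgorithm Pol A)
    (T : ℕ) : ∑ t ∈ Finset.range T, fullNoise d H M.σ (M.badEvent lam A t) ≤ 3 := by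
  have hbad : ∀ t : ℕ, 1 ≤ t → fullNoise d H M.σ (M.badEvent lam A t) ≤
      ENNReal.ofReal (((t : ℝ) ^ 2)⁻¹) := by
    intro t ht
    have htp : (0 : ℝ) < (t : ℝ) ^ 2 := by positivity
    have hset : M.badEvent lam A t =
        {ω | ENNReal.ofReal ((t : ℝ) ^ 2) ≤ M.meanRatio lam A (M.runHist A ω t)} := by
      ext ω
      simp [badEvent, Nat.one_le_iff_ne_zero.1 ht]
    rw [hset, ENNReal.ofReal_inv_of_pos htp]
    exact M.measure_meanRatio_le hlam hA t (ENNReal.ofReal_pos.2 htp).ne' ENNReal.ofReal_ne_top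
  rcases T with _ | n
  · simp
  rw [Finset.sum_range_eq_add_Ico _ (Nat.succ_pos n)]
  have h2 : ∑ t ∈ Finset.Ico 1 (n + 1), fullNoise d H M.σ (M.badEvent lam A t) ≤ 2 := by
    calc _ ≤ ∑ t ∈ Finset.Ico 1 (n + 1), ENNReal.ofReal (((t : ℝ) ^ 2)⁻¹) :=
          Finset.sum_le_sum fun t ht => hbad t (Finset.mem_Ico.1 ht).1
      _ = ENNReal.ofReal (∑ t ∈ Finset.Ioo 0 (n + 1), ((t : ℝ) ^ 2)⁻¹) := by
          rw [ENNReal.ofReal_sum_of_nonneg fun t _ => by positivity]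
          rfl
      _ ≤ ENNReal.ofReal 2 := by
          refine ENNReal.ofReal_le_ofReal ?_
          simpa using sum_Ioo_inv_sq_le (α := ℝ) 0 (n + 1)
      _ = 2 := by simp
  calc _ ≤ (1 : ℝ≥0∞) + 2 := add_le_add prob_le_one h2
    _ = 3 := by norm_num

variable {α Jstar : ℝ≥0} {Ball₀ : Set (E →L[ℝ] State d)}

theorem lintegral_J_sub_Jopt_le (M : KNR d H U E) (hW : M.Wstar ≠ 0)
    (hlam : lam = M.σ ^ 2 / ‖M.Wstar‖ ^ 2) (hPol : ∀ π ∈ Pol, ∀ h, Measurable fun x => π x h)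
    (hc : ∀ t, Measurable (c t))
    (hV : ∀ t, ∀ π ∈ Pol, M.secondMoment π (c t) ≤ Vmax)
    (hα : ∀ t, ∀ π ∈ Pol, M.secondMoment π (c t) ≤ (α * M.J π (c t) M.Wstar) ^ 2)
    (hJ : ∀ t, M.Jopt Pol (c t) ≤ Jstar) (hLC : M.IsLC3 Pol c Ball₀ 32 lam A) (t : ℕ) :
    ∫⁻ ω, (M.J (A t (M.runHist A ω t)) (c t) M.Wstar - M.Jopt Pol (c t)) ∂(fullNoise d H M.σ) ≤
      (Vmax : ℝ≥0∞) ^ (1 / 2 : ℝ) * fullNoise d H M.σ (M.badEvent lam A t) +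
      (α * Jstar * ∫⁻ ω, M.modelError lam A (M.runHist A ω t) ^ (1 / 2 : ℝ)
        ∂(fullNoise d H M.σ) +
      α * (Vmax : ℝ≥0∞) ^ (1 / 2 : ℝ) * ∫⁻ ω, M.modelError lam A (M.runHist A ω t)
        ∂(fullNoise d H M.σ)) := by
  have hσ := M.σ_pos
  have hWn : 0 < ‖M.Wstar‖ := norm_pos_iff.2 hW
  have hlampos : 0 < lam := by rw [hlam]; positivity
  have hA := hLC.isAlgorithm
  have hmB : Measurable fun ω => M.modelError lam A (M.runHist A ω t) :=
    (M.measurable_modelError hA).comp (M.measurable_runHist hA t)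
  have hbad := M.measurableSet_badEvent hlampos hA t
  have hVtop : (Vmax : ℝ≥0∞) ^ (1 / 2 : ℝ) ≠ ⊤ := by simp
  calc _ ≤ ∫⁻ ω, ((M.badEvent lam A t).indicator (fun _ => (Vmax : ℝ≥0∞) ^ (1 / 2 : ℝ)) ω +
        (α * Jstar * M.modelError lam A (M.runHist A ω t) ^ (1 / 2 : ℝ) +
        α * (Vmax : ℝ≥0∞) ^ (1 / 2 : ℝ) * M.modelError lam A (M.runHist A ω t)))
          ∂(fullNoise d H M.σ) := by
        refine lintegral_mono_ae ?_
        filter_upwards [hLC.optimistic] with ω hω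
        have hmem := hA.mem t (M.runHist A ω t)
        by_cases hb : ω ∈ M.badEvent lam A t
        · rw [Set.indicator_of_mem hb]
          exact (tsub_le_self.trans (M.J_Wstar_le_sqrt (hPol _ hmem) (hc t) (hV t _ hmem))).trans
            le_self_add
        · rw [Set.indicator_of_notMem hb, zero_add]
          simp only [badEvent, Set.mem_ofPred_eq, not_or, not_le] at hb
          have hopt := hω t
          rw [ball, if_neg hb.1] at hopt
          exact M.J_Wstar_sub_Jopt_le hW hlam hPol (hc t) (Nat.one_le_iff_ne_zero.2 hb.1) _ hmem
            (hV t _ hmem) (hα t _ hmem) (hJ t) hb.2.le hopt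
    _ = _ := by
        rw [lintegral_add_left (measurable_const.indicator hbad),
          lintegral_add_left ((hmB.pow_const _).const_mul _), lintegral_indicator_const hbad,
          lintegral_const_mul _ (hmB.pow_const _), lintegral_const_mul _ hmB]

theorem ofReal_integral_regret_le_of_isLC3 (M : KNR d H U E) (hW : M.Wstar ≠ 0)
    (hlam : lam = M.σ ^ 2 / ‖M.Wstar‖ ^ 2) (hPol : ∀ π ∈ Pol, ∀ h, Measurable fun x => π x h)
    (hc : ∀ t, Measurable (c t))
    (hV : ∀ t, ∀ π ∈ Pol, M.secondMoment π (c t) ≤ Vmax)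
    (hα : ∀ t, ∀ π ∈ Pol, M.secondMoment π (c t) ≤ (α * M.J π (c t) M.Wstar) ^ 2)
    (hJ : ∀ t, M.Jopt Pol (c t) ≤ Jstar) (hLC : M.IsLC3 Pol c Ball₀ 32 lam A) (T : ℕ) :
    ENNReal.ofReal (∫ ω, M.regret Pol c A T ω ∂(fullNoise d H M.σ)) ≤
      2000 * (α * Jstar * M.dTildeSq Pol lam T ^ (1 / 2 : ℝ) * (T : ℝ≥0∞) ^ (1 / 2 : ℝ) +
        α * (Vmax : ℝ≥0∞) ^ (1 / 2 : ℝ) * (M.dTildeSq Pol lam T + M.gamma₂ Pol lam T)) +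
        3 * (Vmax : ℝ≥0∞) ^ (1 / 2 : ℝ) := by
  have hσ := M.σ_pos
  have hWn : 0 < ‖M.Wstar‖ := norm_pos_iff.2 hW
  have hlampos : 0 < lam := by rw [hlam]; positivity
  have hA := hLC.isAlgorithm
  -- A nonzero linear map cannot take values in the zero space.
  have hd : 1 ≤ d := by
    rw [Nat.one_le_iff_ne_zero]
    rintro rfl
    exact hW (Subsingleton.elim _ _)
  refine (M.ofReal_integral_regret_le hA hPol hc hV T).trans ?_
  refine (Finset.sum_le_sum fun t _ =>
    M.lintegral_J_sub_Jopt_le hW hlam hPol hc hV hα hJ hLC t).trans ?_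
  rw [Finset.sum_add_distrib, Finset.sum_add_distrib, ← Finset.mul_sum, ← Finset.mul_sum,
    ← Finset.mul_sum]
  set V := (Vmax : ℝ≥0∞) ^ (1 / 2 : ℝ)
  set D := M.dTildeSq Pol lam T
  calc _ ≤ V * 3 + (α * Jstar * (40 * D ^ (1 / 2 : ℝ) * (T : ℝ≥0∞) ^ (1 / 2 : ℝ)) +
        α * V * (1920 * (D + M.gamma₂ Pol lam T))) := by
        gcongr
        · exact M.sum_measure_badEvent_le hlampos hA T
        · exact M.sum_lintegral_sqrt_modelError_le hlampos hd hA T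
        · exact M.sum_lintegral_modelError_le hlampos hd hA T
    _ ≤ V * 3 + (α * Jstar * (2000 * D ^ (1 / 2 : ℝ) * (T : ℝ≥0∞) ^ (1 / 2 : ℝ)) +
        α * V * (2000 * (D + M.gamma₂ Pol lam T))) := by
        gcongr <;> norm_num
    _ = _ := by ring

end Regret

end KNR

/-! ### Assembly of the constants. -/

theorem sqrt_coe_eq_rpow (x : ℝ≥0) : (NNReal.sqrt x : ℝ≥0∞) = (x : ℝ≥0∞) ^ (1 / 2 : ℝ) := by
  rw [NNReal.sqrt_eq_rpow, ENNReal.coe_rpow_of_nonneg _ (by norm_num)]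

theorem theorem2 :
    ∃ C₁ C₂ : ℝ≥0, 0 < C₁ ∧ 0 < C₂ ∧
      ∀ (d H : ℕ) (U E : Type*) [MeasurableSpace U] [NormedAddCommGroup E]
        [InnerProductSpace ℝ E] [CompleteSpace E] [TopologicalSpace.SeparableSpace E]
        [MeasurableSpace E] [BorelSpace E]
        (M : KNR d H U E) (_ : M.Wstar ≠ 0)
        (Pol : Set (Policy d H U)) (_ : ∀ π ∈ Pol, ∀ h, Measurable fun x => π x h)
        (c : ℕ → State d × U → ℝ≥0) (_ : ∀ t, Measurable (c t))
        (Vmax α Jstar : ℝ≥0)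
        (_ : ∀ t, ∀ π ∈ Pol, M.secondMoment π (c t) ≤ Vmax)
        (_ : ∀ t, ∀ π ∈ Pol, M.secondMoment π (c t) ≤ (α * M.J π (c t) M.Wstar) ^ 2)
        (_ : ∀ t, M.Jopt Pol (c t) ≤ Jstar)
        (lam : ℝ) (_ : lam = M.σ ^ 2 / ‖M.Wstar‖ ^ 2)
        (Ball₀ : Set (E →L[ℝ] State d)) (A : Algorithm d H U)
        (_ : M.IsLC3 Pol c Ball₀ C₁ lam A) (T : ℕ),
        Integrable (M.regret Pol c A T) (fullNoise d H M.σ) ∧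
        ENNReal.ofReal (∫ ω, M.regret Pol c A T ω ∂(fullNoise d H M.σ)) ≤
          C₂ * (α * Jstar * M.dTildeSq Pol lam T ^ (1 / 2 : ℝ) * NNReal.sqrt (H * T) +
            α * H * NNReal.sqrt Vmax * (M.dTildeSq Pol lam T + M.gamma₂ Pol lam T) +
            NNReal.sqrt Vmax) ∧
        (1 ≤ M.dTildeSq Pol lam T →
          ENNReal.ofReal (∫ ω, M.regret Pol c A T ω ∂(fullNoise d H M.σ)) ≤
            C₂ * (α * Jstar * M.dTildeSq Pol lam T ^ (1 / 2 : ℝ) * NNReal.sqrt (H * T) +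
              α * H * NNReal.sqrt Vmax * (M.dTildeSq Pol lam T + M.gamma₂ Pol lam T))) := by
  -- 2003 = 2000 + 3: the main terms, and the total weight of the bad events.
  refine ⟨32, 2003, by norm_num, by norm_num, ?_⟩
  intro d H U E _ _ _ _ _ _ _ M hW Pol hPol c hc Vmax α Jstar hV hα hJ lam hlam Ball₀ A hLC T
  have : SecondCountableTopology E := UniformSpace.secondCountable_of_separable E
  have hLC' : M.IsLC3 Pol c Ball₀ 32 lam A := by simpa using hLC
  have hA := hLC'.isAlgorithm
  refine ⟨M.integrable_regret hA hPol hc hV T, ?_⟩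
  -- Outside these cases α ≥ 1 and H ≥ 1, which is needed to absorb √Vmax and to insert the powers
  -- of H.
  by_cases hdeg : H = 0 ∨ α < 1
  · rw [M.ofReal_integral_regret_eq_zero hA hPol hc hV hα hdeg T]
    exact ⟨zero_le, fun _ => zero_le⟩
  simp only [not_or, not_lt] at hdeg
  have hH : (1 : ℝ≥0∞) ≤ H := by exact_mod_cast Nat.one_le_iff_ne_zero.2 hdeg.1
  have hα1 : (1 : ℝ≥0∞) ≤ α := by exact_mod_cast hdeg.2
  have h := M.ofReal_integral_regret_le_of_isLC3 hW hlam hPol hc hV hα hJ hLC' T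
  rw [sqrt_coe_eq_rpow, sqrt_coe_eq_rpow]
  push_cast
  set V := (Vmax : ℝ≥0∞) ^ (1 / 2 : ℝ)
  set D := M.dTildeSq Pol lam T
  set G := M.gamma₂ Pol lam T
  -- The explicit factors √H and H enter only here and in `hαH`; the preceding bound does not
  -- contain them.
  have hT : (T : ℝ≥0∞) ^ (1 / 2 : ℝ) ≤ ((H : ℝ≥0∞) * T) ^ (1 / 2 : ℝ) := by
    gcongr
    exact le_mul_of_one_le_left (zero_le) hH
  have hαH : (α : ℝ≥0∞) * V ≤ α * H * V := by
    gcongr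
    exact le_mul_of_one_le_right (zero_le) hH
  rw [show (2003 : ℝ≥0∞) = 2000 + 3 by norm_num]
  refine ⟨h.trans ?_, fun hD => h.trans ?_⟩
  · rw [add_mul]
    refine add_le_add ?_ ?_
    · exact mul_le_mul' le_rfl ((add_le_add (by gcongr) (by gcongr)).trans le_self_add)
    · exact mul_le_mul' le_rfl le_add_self
  -- The cost of the bad events is dominated by the second main term, as α, H and d̃_T² are all at
  -- least 1.
  · have hV1 : V ≤ α * H * V * (D + G) := by
      calc V = 1 * 1 * V * 1 := by ring
        _ ≤ α * H * V * (D + G) := by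
          gcongr
          exact hD.trans le_self_add
    rw [add_mul]
    refine add_le_add ?_ ?_
    · gcongr
    · gcongr
      exact hV1.trans le_add_self
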